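/- Let $a,b$ be positive integers. The $(a:b)$ Maker-PhantomBreaker connectivity game on $K_n$ is played on the edge set of the complete graph on $n$ vertices, all edges being unclaimed at the start. In every round, Maker first names $a$ edges of $K_n$, one after another; a named edge that is unclaimed becomes hers, while naming an edge that is already claimed is a lost move, and after each named edge she is told whether her attempt succeeded. Then PhantomBreaker claims $b$ unclaimed edges (all unclaimed edges, if fewer than $b$ are left). Maker gets no other information about PhantomBreaker's edges, whereas PhantomBreaker sees the whole course of the game. Maker wins if at some point her edges contain all the edges of a spanning tree of $K_n$. Both players may use randomized strategies, i.e. probability distributions over deterministic strategies, chosen independently of each other. (a) If $b>2a$, then there is a constant $c=c(a,b)>0$ such that, for all sufficiently large $n$, Maker has a randomized strategy in the $(a:b)$ connectivity game on $K_n$ that wins with probability at least $c$ against every strategy of PhantomBreaker. (b) If $b\le 2a$, then Maker has a randomized strategy that wins asymptotically almost surely: there is a sequence $\delta_n\to 0$ such that, for all sufficiently large $n$, Maker has a randomized strategy in the $(a:b)$ connectivity game on $K_n$ that wins with probability at least $1-\delta_n$ against every strategy of PhantomBreaker. -/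

import Mathlib

open Filter Topology

namespace MakerPhantomBreaker

/-- The board: the edges of the complete graph `K_n` on the vertex set `Fin n`. -/
abbrev Edge (n : ℕ) : Type := (⊤ : SimpleGraph (Fin n)).edgeSet

/-- The complete record of a partially played game. Both lists have the most recent entry first.
`attempts` lists the edges Maker has tried to claim, each with a flag telling whether the attempt
succeeded; `replies` lists the sets of edges PhantomBreaker has claimed on his turns. -/
structure History (n : ℕ) where
  attempts : List (Edge n × Bool)
  replies : List (Finset (Edge n))

namespace History

variable {n : ℕ}

/-- Maker's edges: those that she attempted successfully. -/
def maker (h : History n) : Finset (Edge n) :=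
  ((h.attempts.filter fun p => p.2).map Prod.fst).toFinset

/-- PhantomBreaker's edges. -/
def breaker (h : History n) : Finset (Edge n) :=
  h.replies.foldr (fun S B => S ∪ B) ∅

/-- The unclaimed edges. -/
def free (h : History n) : Finset (Edge n) :=
  Finset.univ \ (h.maker ∪ h.breaker)

/-- The record before the first move. -/
def start (n : ℕ) : History n := ⟨[], []⟩

end History

/-- A deterministic strategy of Maker. It sees only her own attempts and whether they succeeded,
and it names the next edge of `K_n` that she tries to claim. -/
abbrev MakerStrategy (n : ℕ) : Type := List (Edge n × Bool) → Edge n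

/-- A deterministic strategy of PhantomBreaker with bias `b`. It sees the complete record of the
game, and it claims `b` unclaimed edges (all of them, if fewer than `b` are left). -/
abbrev BreakerStrategy (n b : ℕ) : Type :=
  {β : History n → Finset (Edge n) // ∀ h, β h ⊆ h.free ∧ (β h).card = min b h.free.card}

/-- Maker tries to claim one edge. If the edge is unclaimed it becomes hers; otherwise the move
is lost. She is told which of the two happened. -/
def makerStep {n : ℕ} (σ : MakerStrategy n) (h : History n) : History n :=
  ⟨(σ h.attempts, decide (σ h.attempts ∈ h.free)) :: h.attempts, h.replies⟩

/-- PhantomBreaker takes his turn. -/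
def breakerStep {n b : ℕ} (β : BreakerStrategy n b) (h : History n) : History n :=
  ⟨h.attempts, β.1 h :: h.replies⟩

/-- One round of the `(a : b)` game: Maker makes `a` single-edge attempts one after another, then
PhantomBreaker takes his turn. -/
def playRound {n b : ℕ} (a : ℕ) (σ : MakerStrategy n) (β : BreakerStrategy n b)
    (h : History n) : History n :=
  breakerStep β ((makerStep σ)^[a] h)

/-- The record after `t` rounds. Once all edges are claimed, further rounds change neither player's
edge set. -/
def play {n b : ℕ} (a : ℕ) (σ : MakerStrategy n) (β : BreakerStrategy n b) (t : ℕ) : History n :=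
  (playRound a σ β)^[t] (History.start n)

/-- The family of winning sets of the connectivity game: edge sets of spanning trees of `K_n`. -/
def spanningTrees (n : ℕ) : Set (Finset (Edge n)) :=
  {F | (SimpleGraph.fromEdgeSet ((fun e : Edge n => (e : Sym2 (Fin n))) '' (F : Set (Edge n)))).IsTree}

/-- Maker wins the game with winning sets `𝓕` if at some point she has claimed every edge of some
`F ∈ 𝓕`. -/
def MakerWins {n b : ℕ} (a : ℕ) (𝓕 : Set (Finset (Edge n)))
    (σ : MakerStrategy n) (β : BreakerStrategy n b) : Prop :=
  ∃ t : ℕ, ∃ F ∈ 𝓕, F ⊆ (play a σ β t).maker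

/-- A randomized strategy of a player is a probability distribution on the player's deterministic
strategies. This is the probability that Maker wins when Maker and PhantomBreaker use the
randomized strategies `μ` and `ν`, the two players' random choices being independent. -/
noncomputable def winProb {n b : ℕ} (a : ℕ) (𝓕 : Set (Finset (Edge n)))
    (μ : PMF (MakerStrategy n)) (ν : PMF (BreakerStrategy n b)) : ℝ :=
  ((μ.bind fun σ => ν.map fun β => (σ, β)).toOuterMeasure
    {p | MakerWins a 𝓕 p.1 p.2}).toReal

end MakerPhantomBreaker

/-! Both halves rest on one principle. Maker remembers the components of her own graph, encoded as
labels, and a small auxiliary set of vertices, and draws the next pair uniformly from a set computed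
from this memory (a `Plan`). Suppose a function of memory, PhantomBreaker's graph and time is at
most 1 once her graph is connected, is nonpositive at some horizon otherwise, and never decreases on
average over the draw, whatever PhantomBreaker answers (`Drift`). Then its initial value bounds her
winning probability from below (`exists_mixed`). It remains to find two strategies with such
potentials.

For an arbitrary bias, Maker draws among the pairs leaving components with fewer than `s = 12 * b`
vertices. The slack of a component measures how far its degree sum in PhantomBreaker's graph is
below `n / 4` times its size, and `weight` is the product of the powers `slack ^ (2 * (s - size))`.
If `z` is the least slack of a small component, PhantomBreaker's answer costs a relative loss `O(1 /
(n * z))` (`weight_mul_le`). The worst component is hit with chance at least `1 / (2 * n)`, and this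
multiplies the weight by at least `z⁻¹ ^ 2` (`IsMerge.weight_le`). By AM-GM the quadratic gain
covers the linear loss up to `O(1 / n)`, which is paid by a discount factor `exp(-K * components /
n)`, since at least half of the draws merge two components (`growth_step`). In total this costs a
constant factor. Two vanishing corrections cover the event that `3 * n` draws do not suffice and the
positions with `z = O(1 / n)`.

For `b ≤ 2 * a`, PhantomBreaker has at most `2 * t` edges after `t` attempts. Maker first matches
random pairs of isolated vertices until fewer than `E`, about `ε * n`, are left. Failures are rare,
and the endpoints of a failed draw are served at once. With `σ` isolated vertices left,
PhantomBreaker has only about `n - σ` edges, so he cannot block all pairs at such an endpoint; this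
is where the bias matters (`PairParams.le_nextSum_pend`). Every draw, successful or not, removes a
uniformly random pair from the live vertices, so he cannot concentrate degrees on the survivors: the
supermartingale `degPot` keeps their final degree sum below `n / 4` with high probability, because
`ε * log (1 / ε)` is small (`PairParams.le_nextSum_pair`). Afterwards Maker removes the last
isolated vertices, pairs up the components with two or three vertices, and joins the rest. Once all
components have at least 2, respectively 4, vertices, every cut she uses has at least `2 * (n - 2)`,
respectively `4 * (n - 4)`, pairs, against about `3 * n / 2`, respectively `2 * n`, edges of
PhantomBreaker. Each of these levels is a Markov bound on a linear clock
(`PairParams.sum_levelVal`). -/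

namespace MakerPhantomBreaker
open scoped Classical

/-! ## Randomized strategies that choose uniformly from a finite set of vertex pairs -/

/-- A label function describes the partition of the vertices into the components of Maker's graph.
Merging the components of the endpoints of an edge keeps the smaller label. -/
noncomputable def mergeAlong {n : ℕ} (lab : Fin n → Fin n) : Sym2 (Fin n) → Fin n → Fin n :=
  Sym2.lift ⟨fun v x u => if lab u = max (lab v) (lab x) then min (lab v) (lab x) else lab u, by
    intro v x; funext u; simp only [max_comm, min_comm]⟩

/-- The rules of a memory-bounded randomized strategy of Maker: from the current component labels
and an auxiliary set of vertices she computes the set of vertex pairs from which the next one is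
drawn uniformly, and after a failed attempt she updates the auxiliary set. -/
structure Plan (n : ℕ) where
  moves : (Fin n → Fin n) → Finset (Fin n) → Finset (Fin n × Fin n)
  onFail : (Fin n → Fin n) → Finset (Fin n) → Sym2 (Fin n) → Finset (Fin n)

/-- The update of Maker's memory after an attempt. -/
noncomputable def Plan.update {n : ℕ} (D : Plan n) (m : (Fin n → Fin n) × Finset (Fin n))
    (e : Sym2 (Fin n)) (f : Bool) : (Fin n → Fin n) × Finset (Fin n) :=
  if f then (mergeAlong m.1 e, m.2) else (m.1, D.onFail m.1 m.2 e)

/-- Maker's memory after a list of attempts. -/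
noncomputable def Plan.memory {n : ℕ} (D : Plan n) :
    List (Edge n × Bool) → (Fin n → Fin n) × Finset (Fin n)
  | [] => (id, ∅)
  | p :: l => D.update (D.memory l) p.1 p.2

/-- Turns a pair of distinct vertices into an edge. -/
noncomputable def toEdge {n : ℕ} (e₀ : Edge n) (p : Fin n × Fin n) : Edge n :=
  if h : p.1 ≠ p.2 then ⟨s(p.1, p.2), by simpa using h⟩ else e₀

/-- Picks an element of a finite set by a number modulo its size. -/
noncomputable def pick {α : Type*} (x₀ : α) (Q : Finset α) (c : ℕ) : α :=
  if h : 0 < Q.card then (Q.equivFin.symm ⟨c % Q.card, Nat.mod_lt _ h⟩ : Q) else x₀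

/-- The deterministic strategy that follows a plan with a given sequence of random numbers. -/
noncomputable def Plan.strategy {n : ℕ} (D : Plan n) (e₀ : Edge n) (ω : ℕ → ℕ) :
    MakerStrategy n := fun l =>
  toEdge e₀ (pick ((e₀ : Sym2 (Fin n)).out) (D.moves (D.memory l).1 (D.memory l).2) (ω l.length))

/-- The record after `j` attempts of Maker. -/
def recordAfter {n b : ℕ} (a : ℕ) (σ : MakerStrategy n) (β : BreakerStrategy n b) : ℕ → History n
  | 0 => History.start n
  | j + 1 => if a ∣ j + 1 then breakerStep β (makerStep σ (recordAfter a σ β j))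
      else makerStep σ (recordAfter a σ β j)

/-- The graph of PhantomBreaker's edges. -/
def breakerGraph {n : ℕ} (B : Finset (Edge n)) : SimpleGraph (Fin n) :=
  SimpleGraph.fromEdgeSet ((fun e : Edge n => (e : Sym2 (Fin n))) '' (B : Set (Edge n)))

/-- The number of edges. -/
noncomputable def edgeCount {n : ℕ} (G : SimpleGraph (Fin n)) : ℕ := G.edgeSet.ncard

/-! ### PhantomBreaker's graph and uniform picks -/

section Basic
variable {n : ℕ}

lemma edge_not_isDiag (e : Edge n) : ¬ (e : Sym2 (Fin n)).IsDiag := by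
  have := e.2
  simpa using this

lemma edgeSet_breakerGraph (B : Finset (Edge n)) : (breakerGraph B).edgeSet =
    (fun e : Edge n => (e : Sym2 (Fin n))) '' (B : Set (Edge n)) := by
  rw [breakerGraph, SimpleGraph.edgeSet_fromEdgeSet]
  ext e
  constructor
  · exact fun h => h.1
  · rintro ⟨f, hf, rfl⟩
    exact ⟨⟨f, hf, rfl⟩, edge_not_isDiag f⟩

lemma edgeCount_breakerGraph (B : Finset (Edge n)) : edgeCount (breakerGraph B) = B.card := by
  rw [edgeCount, edgeSet_breakerGraph, Set.ncard_image_of_injective _ Subtype.val_injective,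
    Set.ncard_coe_finset]

lemma breakerGraph_mono {B B' : Finset (Edge n)} (h : B ⊆ B') :
    breakerGraph B ≤ breakerGraph B' := by
  apply SimpleGraph.fromEdgeSet_mono
  exact Set.image_mono (by exact_mod_cast h)

lemma breakerGraph_empty : breakerGraph (∅ : Finset (Edge n)) = ⊥ := by
  simp [breakerGraph]

lemma mem_breaker_iff_adj (B : Finset (Edge n)) (e : Edge n) (v x : Fin n)
    (h : (e : Sym2 (Fin n)) = s(v, x)) : e ∈ B ↔ (breakerGraph B).Adj v x := by
  rw [← SimpleGraph.mem_edgeSet, edgeSet_breakerGraph, ← h]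
  simpa using fun _ => edge_not_isDiag e

/-- Reduction modulo the size covers `Q` evenly on each block of `Q.card` consecutive numbers, so a
uniform number from a range whose length is divisible by `Q.card` yields an exactly uniform element.
-/
lemma sum_pick {α : Type*} (x₀ : α) (Q : Finset α) (hQ : Q.Nonempty) (f : α → ℝ) (M : ℕ) :
    ∑ c ∈ Finset.range (Q.card * M), f (pick x₀ Q c) = M * ∑ p ∈ Q, f p := by
  have hpos : 0 < Q.card := hQ.card_pos
  induction M with
  | zero => simp
  | succ M ih =>
    rw [Nat.mul_succ, Finset.sum_range_add, ih]
    have : ∑ x ∈ Finset.range Q.card, f (pick x₀ Q (Q.card * M + x)) = ∑ p ∈ Q, f p := by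
      rw [Finset.sum_range, ← Finset.sum_coe_sort Q, ← Q.equivFin.symm.sum_comp]
      refine Finset.sum_congr rfl fun i _ => ?_
      have hi : (Q.card * M + (i : ℕ)) % Q.card = i := by
        rw [Nat.mul_add_mod, Nat.mod_eq_of_lt i.2]
      simp [pick, hpos, hi]
    rw [this]; push_cast; ring

lemma coe_toEdge (e₀ : Edge n) (p : Fin n × Fin n) (h : p.1 ≠ p.2) :
    (toEdge e₀ p : Sym2 (Fin n)) = s(p.1, p.2) := by
  simp [toEdge, h]

end Basic

/-! ### The game counted in single attempts -/

section Play
variable {n a b : ℕ}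

lemma recordAfter_attempts_length (σ : MakerStrategy n) (β : BreakerStrategy n b) (j : ℕ) :
    (recordAfter a σ β j).attempts.length = j := by
  induction j with
  | zero => rfl
  | succ j ih =>
    rw [recordAfter]
    split_ifs <;> simp [breakerStep, makerStep, ih]

lemma recordAfter_add (σ : MakerStrategy n) (β : BreakerStrategy n b) (k i : ℕ)
    (hi : i < a) : recordAfter a σ β (a * k + i) = (makerStep σ)^[i] (recordAfter a σ β (a * k)) := by
  induction i with
  | zero => rfl
  | succ i ih =>
    have hnd : ¬ a ∣ a * k + i + 1 := by
      intro h
      have h1 : a ∣ i + 1 := by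
        have := (Nat.dvd_add_right (Dvd.intro k rfl : a ∣ a * k)).1 (by rwa [← add_assoc])
        exact this
      exact absurd (Nat.le_of_dvd (Nat.succ_pos _) h1) (by omega)
    rw [← add_assoc, recordAfter, if_neg hnd, ih (by omega), Function.iterate_succ_apply']

lemma play_eq_recordAfter (ha : 0 < a) (σ : MakerStrategy n) (β : BreakerStrategy n b) (k : ℕ) :
    play a σ β k = recordAfter a σ β (a * k) := by
  induction k with
  | zero => rfl
  | succ k ih =>
    obtain ⟨c, rfl⟩ : ∃ c, a = c + 1 := ⟨a - 1, by omega⟩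
    rw [play, Function.iterate_succ_apply', ← play, ih, playRound,
      show (c + 1) * (k + 1) = (c + 1) * k + c + 1 by ring, recordAfter, if_pos (by
        exact ⟨k + 1, by ring⟩), recordAfter_add _ _ _ _ (Nat.lt_succ_self c),
      Function.iterate_succ_apply']

lemma breaker_breakerStep (β : BreakerStrategy n b) (h : History n) :
    (breakerStep β h).breaker = β.1 h ∪ h.breaker := rfl

lemma breaker_makerStep (σ : MakerStrategy n) (h : History n) :
    (makerStep σ h).breaker = h.breaker := rfl

lemma breaker_card_recordAfter (σ : MakerStrategy n) (β : BreakerStrategy n b)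
    (j : ℕ) : (recordAfter a σ β j).breaker.card ≤ b * (j / a) := by
  induction j with
  | zero => simp [recordAfter, History.start, History.breaker]
  | succ j ih =>
    rw [recordAfter, Nat.succ_div]
    split_ifs with h
    · rw [breaker_breakerStep, breaker_makerStep, mul_add, mul_one, add_comm]
      refine (Finset.card_union_le _ _).trans ?_
      have := (β.2 (makerStep σ (recordAfter a σ β j))).2
      omega
    · rw [breaker_makerStep]; simpa using ih

/-- The first `j` attempts consult the strategy only on lists shorter than `j`. Hence the random
number for attempt `j` can be resampled without disturbing the past. -/
lemma recordAfter_congr (σ σ' : MakerStrategy n) (β : BreakerStrategy n b) (j : ℕ)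
    (h : ∀ l, l.length < j → σ l = σ' l) : recordAfter a σ β j = recordAfter a σ' β j := by
  induction j with
  | zero => rfl
  | succ j ih =>
    have h1 := ih fun l hl => h l (by omega)
    have h2 : makerStep σ (recordAfter a σ β j) = makerStep σ' (recordAfter a σ' β j) := by
      rw [← h1, makerStep, makerStep, h _ (by rw [recordAfter_attempts_length]; omega)]
    rw [recordAfter, recordAfter, h2]

end Play

/-! ### Merging labels -/

section Labels
variable {n : ℕ}

lemma mergeAlong_mk (lab : Fin n → Fin n) (v x u : Fin n) : mergeAlong lab s(v, x) u =
    if lab u = max (lab v) (lab x) then min (lab v) (lab x) else lab u := rfl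

lemma mergeAlong_idem (lab : Fin n → Fin n) (h : ∀ v, lab (lab v) = lab v) (e : Sym2 (Fin n)) (u) :
    mergeAlong lab e (mergeAlong lab e u) = mergeAlong lab e u := by
  induction e with | _ v x
  have hmin : lab (min (lab v) (lab x)) = min (lab v) (lab x) := by
    rcases min_choice (lab v) (lab x) with h' | h' <;> rw [h', h]
  simp only [mergeAlong_mk]
  by_cases h1 : lab u = max (lab v) (lab x)
  · simp only [h1, if_true, hmin]
    split_ifs <;> rfl
  · simp [h1, h]

lemma mergeAlong_eq_of_eq (lab : Fin n → Fin n) (e : Sym2 (Fin n)) {u w : Fin n}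
    (h : lab u = lab w) : mergeAlong lab e u = mergeAlong lab e w := by
  induction e with | _ v x
  simp only [mergeAlong_mk, h]

lemma mergeAlong_endpoints (lab : Fin n → Fin n) (v x : Fin n) :
    mergeAlong lab s(v, x) v = mergeAlong lab s(v, x) x := by
  simp only [mergeAlong_mk]
  rcases le_total (lab v) (lab x) with h | h
  · simp only [max_eq_right h, min_eq_left h, if_true]; split_ifs <;> rfl
  · simp only [max_eq_left h, min_eq_right h, if_true]; split_ifs with h1
    · rfl
    · rfl

lemma mergeAlong_cases (lab : Fin n → Fin n) (v x : Fin n) {u w : Fin n}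
    (h : mergeAlong lab s(v, x) u = mergeAlong lab s(v, x) w) : lab u = lab w ∨
      (lab u = lab v ∧ lab w = lab x) ∨ (lab u = lab x ∧ lab w = lab v) := by
  simp only [mergeAlong_mk] at h
  rcases le_total (lab v) (lab x) with h' | h'
  · simp only [max_eq_right h', min_eq_left h'] at h
    split_ifs at h with h1 h2 h2
    · left; rw [h1, h2]
    · right; right; exact ⟨h1, h.symm⟩
    · right; left; exact ⟨h, h2⟩
    · left; exact h
  · simp only [max_eq_left h', min_eq_right h'] at h
    split_ifs at h with h1 h2 h2
    · left; rw [h1, h2]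
    · right; left; exact ⟨h1, h.symm⟩
    · right; right; exact ⟨h, h2⟩
    · left; exact h

end Labels

/-! ### Labels describe Maker's components -/

section Record
variable {n a b : ℕ}

lemma mem_maker_iff (h : History n) (e : Edge n) : e ∈ h.maker ↔ (e, true) ∈ h.attempts := by
  simp [History.maker]

lemma mem_maker_makerStep (σ : MakerStrategy n) (h : History n) (e : Edge n) :
    e ∈ (makerStep σ h).maker ↔
      (e = σ h.attempts ∧ σ h.attempts ∈ h.free) ∨ e ∈ h.maker := by
  simp only [mem_maker_iff, makerStep, List.mem_cons, Prod.mk.injEq]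
  constructor
  · rintro (⟨h1, h2⟩ | h1)
    · exact Or.inl ⟨h1, by simpa using h2.symm⟩
    · exact Or.inr h1
  · rintro (⟨h1, h2⟩ | h1)
    · exact Or.inl ⟨h1, by simp [h2]⟩
    · exact Or.inr h1

/-- The labels in Maker's memory describe the components of her graph. -/
structure LabelsSound (h : History n) (lab : Fin n → Fin n) : Prop where
  idem : ∀ v, lab (lab v) = lab v
  of_mem : ∀ e ∈ h.maker, ∀ v x, (e : Sym2 (Fin n)) = s(v, x) → lab v = lab x
  reachable : ∀ v x, lab v = lab x → (breakerGraph h.maker).Reachable v x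

lemma labelsSound_start : LabelsSound (History.start n) id where
  idem _ := rfl
  of_mem e he := by simp [History.start, History.maker] at he
  reachable v x h := by cases h; exact SimpleGraph.Reachable.refl _

/-- A success merges exactly the label classes of the two endpoints, and new paths run through the
new edge; a failure changes neither the labels nor Maker's edges. -/
lemma LabelsSound.makerStep {h : History n} {D : Plan n} {σ : MakerStrategy n}
    (hs : LabelsSound h (D.memory h.attempts).1) :
    LabelsSound (makerStep σ h) (D.memory (makerStep σ h).attempts).1 := by
  have hsub : h.maker ⊆ (MakerPhantomBreaker.makerStep σ h).maker := fun e he =>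
    (mem_maker_makerStep σ h e).2 (Or.inr he)
  have hmem : D.memory (MakerPhantomBreaker.makerStep σ h).attempts =
      D.update (D.memory h.attempts) (σ h.attempts) (decide (σ h.attempts ∈ h.free)) := rfl
  by_cases hf : σ h.attempts ∈ h.free
  · have hlab : (D.memory (MakerPhantomBreaker.makerStep σ h).attempts).1 =
        mergeAlong (D.memory h.attempts).1 (σ h.attempts) := by
      rw [hmem, Plan.update]; simp [hf]
    rw [hlab]
    obtain ⟨v, x, hvx⟩ : ∃ v x, ((σ h.attempts : Edge n) : Sym2 (Fin n)) = s(v, x) := by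
      induction h' : ((σ h.attempts : Edge n) : Sym2 (Fin n)) with | _ v x
      exact ⟨v, x, rfl⟩
    refine ⟨mergeAlong_idem _ hs.idem _, ?_, ?_⟩
    · intro e he u w huw
      rcases (mem_maker_makerStep σ h e).1 he with ⟨rfl, -⟩ | he
      · rw [huw]; exact mergeAlong_endpoints _ _ _
      · exact mergeAlong_eq_of_eq _ _ (hs.of_mem e he u w huw)
    · intro u w huw
      have hadj : (breakerGraph (MakerPhantomBreaker.makerStep σ h).maker).Reachable v x :=
        ((mem_breaker_iff_adj _ _ v x hvx).1
          ((mem_maker_makerStep σ h _).2 (Or.inl ⟨rfl, hf⟩))).reachable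
      have hmono := breakerGraph_mono hsub
      rw [hvx] at huw
      rcases mergeAlong_cases _ _ _ huw with h1 | ⟨h1, h2⟩ | ⟨h1, h2⟩
      · exact (hs.reachable _ _ h1).mono hmono
      · exact ((hs.reachable _ _ h1).mono hmono).trans
          (hadj.trans ((hs.reachable _ _ h2.symm).mono hmono))
      · exact ((hs.reachable _ _ h1).mono hmono).trans
          (hadj.symm.trans ((hs.reachable _ _ h2.symm).mono hmono))
  · have hlab : (D.memory (MakerPhantomBreaker.makerStep σ h).attempts).1 =
        (D.memory h.attempts).1 := by
      rw [hmem, Plan.update]; simp [hf]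
    rw [hlab]
    refine ⟨hs.idem, fun e he => ?_, fun v x hvx => (hs.reachable v x hvx).mono
      (breakerGraph_mono hsub)⟩
    rcases (mem_maker_makerStep σ h e).1 he with ⟨_, h2⟩ | he
    · exact absurd h2 hf
    · exact hs.of_mem e he

lemma labelsSound_recordAfter (D : Plan n) (σ : MakerStrategy n) (β : BreakerStrategy n b) (j : ℕ) :
    LabelsSound (recordAfter a σ β j) (D.memory (recordAfter a σ β j).attempts).1 := by
  induction j with
  | zero => exact labelsSound_start
  | succ j ih =>
    rw [recordAfter]
    split_ifs
    · exact ⟨ih.makerStep.idem, ih.makerStep.of_mem, ih.makerStep.reachable⟩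
    · exact ih.makerStep

lemma exists_spanningTree_subset (hn : 0 < n) (M : Finset (Edge n))
    (h : ∀ u v, (breakerGraph M).Reachable u v) : ∃ F ∈ spanningTrees n, F ⊆ M := by
  have : Nonempty (Fin n) := ⟨⟨0, hn⟩⟩
  have hc : (breakerGraph M).Connected := ⟨h⟩
  obtain ⟨T, hT, htree⟩ := hc.exists_isTree_le
  have hmem : ∀ e : Edge n, (e : Sym2 (Fin n)) ∈ T.edgeSet → e ∈ M := by
    intro e he
    have := SimpleGraph.edgeSet_mono hT he
    rw [edgeSet_breakerGraph] at this
    simpa [edge_not_isDiag] using this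
  refine ⟨Finset.univ.filter fun e : Edge n => (e : Sym2 (Fin n)) ∈ T.edgeSet, ?_, ?_⟩
  · have : SimpleGraph.fromEdgeSet ((fun e : Edge n => (e : Sym2 (Fin n))) ''
        ((Finset.univ.filter fun e : Edge n => (e : Sym2 (Fin n)) ∈ T.edgeSet :
          Finset (Edge n)) : Set (Edge n))) = T := by
      rw [← SimpleGraph.edgeSet_inj]
      change (breakerGraph _).edgeSet = _
      rw [edgeSet_breakerGraph]
      ext e
      simp only [Finset.coe_filter, Finset.mem_univ, true_and, Set.mem_image, Set.mem_ofPred_eq]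
      constructor
      · rintro ⟨f, hf, rfl⟩; exact hf
      · intro he
        exact ⟨⟨e, SimpleGraph.edgeSet_mono le_top he⟩, he, rfl⟩
    rw [spanningTrees, Set.mem_ofPred_eq, this]
    exact htree
  · intro e he
    exact hmem e (by simpa using he)

end Record

/-- A vertex labelling with at least two different labels. -/
def Unfinished {n : ℕ} (lab : Fin n → Fin n) : Prop := ∃ u v, lab u ≠ lab v

/-! ### The one-step inequality along a play -/

section Value
variable {n a b : ℕ}

/-- The one-step inequality for a value function: whatever PhantomBreaker answers, the average of
the value over the next random attempt does not decrease. -/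
def Drift (a b : ℕ) (D : Plan n)
    (val : (Fin n → Fin n) → Finset (Fin n) → SimpleGraph (Fin n) → ℕ → ℝ) : Prop :=
  ∀ lab P G t, (∀ v, lab (lab v) = lab v) → Unfinished lab → a * edgeCount G ≤ b * t →
    ∀ G' : Fin n × Fin n → SimpleGraph (Fin n),
      (∀ p, G ≤ G' p ∧ edgeCount (G' p) ≤ edgeCount G + b ∧ a * edgeCount (G' p) ≤ b * (t + 1)) →
      (D.moves lab P).card * val lab P G t ≤ ∑ p ∈ D.moves lab P,
        if G.Adj p.1 p.2 then val lab (D.onFail lab P s(p.1, p.2)) (G' p) (t + 1)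
        else val (mergeAlong lab s(p.1, p.2)) P (G' p) (t + 1)

/-- The value of a record; it is `1` when Maker has connected all vertices. -/
noncomputable def recordValue (D : Plan n)
    (val : (Fin n → Fin n) → Finset (Fin n) → SimpleGraph (Fin n) → ℕ → ℝ) (h : History n) : ℝ :=
  if Unfinished (D.memory h.attempts).1 then
    val (D.memory h.attempts).1 (D.memory h.attempts).2 (breakerGraph h.breaker) h.attempts.length
  else 1

lemma not_unfinished_mergeAlong {lab : Fin n → Fin n} (h : ¬ Unfinished lab) (e : Sym2 (Fin n)) :
    ¬ Unfinished (mergeAlong lab e) := by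
  rintro ⟨u, v, huv⟩
  exact h ⟨u, v, fun h' => huv (mergeAlong_eq_of_eq lab e h')⟩

/-- Resampling only the number with index `j` averages over the next draw. The factorial of `n * n`
is divisible by the size of every nonempty set of pairs, so one alphabet gives exactly uniform draws
at all times. Once all vertices are connected, both sides are constant. -/
lemma sum_range_recordValue (D : Plan n) (e₀ : Edge n)
    (val : (Fin n → Fin n) → Finset (Fin n) → SimpleGraph (Fin n) → ℕ → ℝ)
    (hmoves : ∀ lab P, (∀ v, lab (lab v) = lab v) → Unfinished lab →
      (D.moves lab P).Nonempty ∧ ∀ p ∈ D.moves lab P, lab p.1 ≠ lab p.2)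
    (hle : ∀ lab P G t, (∀ v, lab (lab v) = lab v) → ¬ Unfinished lab → val lab P G t ≤ 1)
    (hdrift : Drift a b D val)
    (β : BreakerStrategy n b) (ω : ℕ → ℕ) (j : ℕ) :
    ((n * n).factorial : ℝ) * recordValue D val (recordAfter a (D.strategy e₀ ω) β j) ≤
      ∑ c ∈ Finset.range (n * n).factorial, recordValue D val
        (recordAfter a (D.strategy e₀ (Function.update ω j c)) β (j + 1)) := by
  set h := recordAfter a (D.strategy e₀ ω) β j with hh
  have hlen : h.attempts.length = j := recordAfter_attempts_length _ _ _
  have hprev : ∀ c, recordAfter a (D.strategy e₀ (Function.update ω j c)) β j = h := by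
    intro c
    refine recordAfter_congr _ _ _ _ fun l hl => ?_
    simp only [Plan.strategy]
    rw [Function.update_of_ne (by omega)]
  have hsound := labelsSound_recordAfter (a := a) D (D.strategy e₀ ω) β j
  rw [← hh] at hsound
  set m := D.memory h.attempts with hm
  set Q := D.moves m.1 m.2 with hQ
  have hcard : a * edgeCount (breakerGraph h.breaker) ≤ b * j := by
    rw [edgeCount_breakerGraph]
    have h1 := breaker_card_recordAfter (a := a) (D.strategy e₀ ω) β j
    rw [← hh] at h1
    calc a * h.breaker.card ≤ a * (b * (j / a)) := Nat.mul_le_mul_left _ h1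
      _ = b * (a * (j / a)) := by ring
      _ ≤ b * j := Nat.mul_le_mul_left _ (Nat.mul_div_le _ _)
  by_cases hu : Unfinished m.1
  · obtain ⟨hne, hlabne⟩ := hmoves m.1 m.2 hsound.idem hu
    let next : Fin n × Fin n → History n := fun p =>
      if a ∣ j + 1 then breakerStep β ⟨(toEdge e₀ p, decide (toEdge e₀ p ∈ h.free)) :: h.attempts,
        h.replies⟩ else ⟨(toEdge e₀ p, decide (toEdge e₀ p ∈ h.free)) :: h.attempts, h.replies⟩
    have hnext : ∀ c, recordAfter a (D.strategy e₀ (Function.update ω j c)) β (j + 1) =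
        next (pick ((e₀ : Sym2 (Fin n)).out) Q c) := by
      intro c
      rw [recordAfter, hprev]
      have hσ : D.strategy e₀ (Function.update ω j c) h.attempts =
          toEdge e₀ (pick ((e₀ : Sym2 (Fin n)).out) Q c) := by
        simp [Plan.strategy, hlen, hQ, hm]
      simp only [makerStep, hσ, next]
    simp only [hnext]
    have hdvd : Q.card ∣ (n * n).factorial := by
      refine Nat.dvd_factorial hne.card_pos ?_
      simpa using Finset.card_le_univ Q
    obtain ⟨M, hM⟩ := hdvd
    rw [hM, sum_pick _ Q hne (fun p => recordValue D val (next p)) M]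
    push_cast
    have hkey : (Q.card : ℝ) * recordValue D val h ≤ ∑ p ∈ Q, recordValue D val (next p) := by
      have hG : ∀ p, breakerGraph h.breaker ≤ breakerGraph (next p).breaker ∧
          edgeCount (breakerGraph (next p).breaker) ≤ edgeCount (breakerGraph h.breaker) + b ∧
          a * edgeCount (breakerGraph (next p).breaker) ≤ b * (j + 1) := by
        intro p
        by_cases hd : a ∣ j + 1
        · have e1 : (next p).breaker = β.1 ⟨(toEdge e₀ p, decide (toEdge e₀ p ∈ h.free)) ::
              h.attempts, h.replies⟩ ∪ h.breaker := by
            simp only [next, if_pos hd]; rfl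
          have e2 : (next p).breaker.card ≤ b + h.breaker.card := by
            rw [e1]
            refine (Finset.card_union_le _ _).trans (Nat.add_le_add_right ?_ _)
            rw [(β.2 _).2]; exact min_le_left _ _
          refine ⟨breakerGraph_mono (by rw [e1]; exact Finset.subset_union_right), ?_, ?_⟩
          · rw [edgeCount_breakerGraph, edgeCount_breakerGraph]; omega
          · rw [edgeCount_breakerGraph]
            have h1 := breaker_card_recordAfter (a := a) (D.strategy e₀ ω) β j
            rw [← hh] at h1
            calc a * (next p).breaker.card ≤ a * (b + b * (j / a)) := by
                  apply Nat.mul_le_mul_left; omega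
              _ = b * (a * (j / a + 1)) := by ring
              _ = b * (a * ((j + 1) / a)) := by rw [Nat.succ_div, if_pos hd]
              _ ≤ b * (j + 1) := Nat.mul_le_mul_left _ (Nat.mul_div_le _ _)
        · have e1 : (next p).breaker = h.breaker := by
            simp only [next, if_neg hd]; rfl
          rw [e1]
          refine ⟨le_rfl, by omega, hcard.trans (Nat.mul_le_mul_left _ (by omega))⟩
      have := hdrift m.1 m.2 (breakerGraph h.breaker) j hsound.idem hu hcard
        (fun p => breakerGraph (next p).breaker) hG
      have hv : recordValue D val h = val m.1 m.2 (breakerGraph h.breaker) j := by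
        rw [recordValue, ← hm, if_pos hu, hlen]
      rw [hv]
      refine this.trans (Finset.sum_le_sum fun p hp => ?_)
      have hp' : p.1 ≠ p.2 := fun h' => hlabne p hp (by rw [h'])
      have hcoe := coe_toEdge e₀ p hp'
      have hatt : (next p).attempts = (toEdge e₀ p, decide (toEdge e₀ p ∈ h.free)) ::
          h.attempts := by
        simp only [next]; split_ifs <;> rfl
      -- A drawn pair joins different labels, so it is never one of Maker's own edges; failing means
      -- exactly being adjacent in PhantomBreaker's graph.
      have hfree : toEdge e₀ p ∈ h.free ↔ ¬ (breakerGraph h.breaker).Adj p.1 p.2 := by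
        rw [← mem_breaker_iff_adj _ _ _ _ hcoe]
        have : toEdge e₀ p ∉ h.maker := fun hmk => hlabne p hp (hsound.of_mem _ hmk _ _ hcoe)
        simp [History.free, this]
      have hmem : D.memory (next p).attempts =
          D.update m s(p.1, p.2) (decide (toEdge e₀ p ∈ h.free)) := by
        rw [hatt, Plan.memory, hcoe]
      have hlen' : (next p).attempts.length = j + 1 := by rw [hatt, List.length_cons, hlen]
      have hval : val (D.memory (next p).attempts).1 (D.memory (next p).attempts).2
          (breakerGraph (next p).breaker) (j + 1) ≤ recordValue D val (next p) := by
        rw [recordValue, hlen']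
        split_ifs
        · exact le_rfl
        · rename_i hfin
          refine hle _ _ _ _ ?_ hfin
          rw [hmem, Plan.update]
          split_ifs
          · exact mergeAlong_idem _ hsound.idem _
          · exact hsound.idem
      refine le_trans (le_of_eq ?_) hval
      rw [hmem, Plan.update]
      split_ifs with h1 h2 h2
      · simp [hfree, h1] at h2
      · rfl
      · rfl
      · simp [hfree, h1] at h2
    calc (Q.card : ℝ) * M * recordValue D val h = M * (Q.card * recordValue D val h) := by ring
      _ ≤ _ := mul_le_mul_of_nonneg_left hkey (Nat.cast_nonneg _)
  · have h1 : ∀ c, recordValue D val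
        (recordAfter a (D.strategy e₀ (Function.update ω j c)) β (j + 1)) = 1 := by
      intro c
      rw [recordValue, if_neg]
      set σ := D.strategy e₀ (Function.update ω j c)
      have : (D.memory (recordAfter a σ β (j + 1)).attempts) =
          D.update m (σ h.attempts) (decide (σ h.attempts ∈ h.free)) := by
        rw [recordAfter, hprev]
        split_ifs <;> rfl
      rw [this, Plan.update]
      split_ifs
      · exact not_unfinished_mergeAlong hu _
      · exact hu
    have h2 : recordValue D val h = 1 := by rw [recordValue, if_neg hu]
    simp [h1, h2]

end Value

/-! ### From potentials to randomized strategies -/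

section Mixed
variable {n a b : ℕ}

/-- Extends a finite sequence of numbers by zeros. -/
def extendSeq {T L : ℕ} (ω : Fin T → Fin L) (i : ℕ) : ℕ := if h : i < T then ω ⟨i, h⟩ else 0

lemma extendSeq_snoc {T L : ℕ} (ω : Fin T → Fin L) (c : Fin L) :
    extendSeq (Fin.snoc (α := fun _ => Fin L) ω c) = Function.update (extendSeq ω) T c := by
  funext i
  rcases lt_trichotomy i T with h | rfl | h
  · rw [Function.update_of_ne h.ne]
    simp [extendSeq, h, Fin.snoc, Nat.lt_succ_of_lt h]
  · simp [extendSeq, Fin.snoc]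
  · rw [Function.update_of_ne h.ne']
    simp [extendSeq, not_lt.2 h.le, not_lt.2 (Nat.succ_le_of_lt h)]

lemma sum_recordValue (D : Plan n) (e₀ : Edge n)
    (val : (Fin n → Fin n) → Finset (Fin n) → SimpleGraph (Fin n) → ℕ → ℝ)
    (hmoves : ∀ lab P, (∀ v, lab (lab v) = lab v) → Unfinished lab →
      (D.moves lab P).Nonempty ∧ ∀ p ∈ D.moves lab P, lab p.1 ≠ lab p.2)
    (hle : ∀ lab P G t, (∀ v, lab (lab v) = lab v) → ¬ Unfinished lab → val lab P G t ≤ 1)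
    (hdrift : Drift a b D val)
    (β : BreakerStrategy n b) (j : ℕ) :
    ((n * n).factorial : ℝ) ^ j * recordValue D val (History.start n) ≤
      ∑ ω : Fin j → Fin (n * n).factorial, recordValue D val
        (recordAfter a (D.strategy e₀ (extendSeq ω)) β j) := by
  induction j with
  | zero => simp [recordAfter]
  | succ j ih =>
    rw [← (Fin.snocEquiv fun _ => Fin (n * n).factorial).sum_comp, Fintype.sum_prod_type_right]
    calc ((n * n).factorial : ℝ) ^ (j + 1) * recordValue D val (History.start n)
        = (n * n).factorial * (((n * n).factorial : ℝ) ^ j *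
          recordValue D val (History.start n)) := by ring
      _ ≤ _ := mul_le_mul_of_nonneg_left ih (Nat.cast_nonneg _)
      _ = ∑ ω : Fin j → Fin (n * n).factorial, ((n * n).factorial : ℝ) * recordValue D val
        (recordAfter a (D.strategy e₀ (extendSeq ω)) β j) := Finset.mul_sum _ _ _
      _ ≤ _ := Finset.sum_le_sum fun ω _ => ?_
    refine (sum_range_recordValue D e₀ val hmoves hle hdrift β (extendSeq ω) j).trans
      (le_of_eq ?_)
    rw [Finset.sum_range]
    refine Finset.sum_congr rfl fun c _ => ?_
    simp only [Fin.snocEquiv, Equiv.coe_fn_mk, extendSeq_snoc]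

/-- The two random choices are independent and can be exchanged, so a bound against every
deterministic opponent survives averaging over the opponents. -/
lemma winProb_ge (𝓕 : Set (Finset (Edge n))) (μ : PMF (MakerStrategy n)) (c : ℝ)
    (h : ∀ β : BreakerStrategy n b,
      ENNReal.ofReal c ≤ μ.toOuterMeasure {σ | MakerWins a 𝓕 σ β})
    (ν : PMF (BreakerStrategy n b)) : c ≤ winProb a 𝓕 μ ν := by
  have hswap : (μ.bind fun σ => ν.map fun β => (σ, β)) =
      ν.bind fun β => μ.map fun σ => (σ, β) := by
    simp only [← PMF.bind_pure_comp]
    exact PMF.bind_comm _ _ _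
  have hlow : ENNReal.ofReal c ≤ (μ.bind fun σ => ν.map fun β => (σ, β)).toOuterMeasure
      {p | MakerWins a 𝓕 p.1 p.2} := by
    rw [hswap, PMF.toOuterMeasure_bind_apply]
    calc ENNReal.ofReal c = ∑' β, ν β * ENNReal.ofReal c := by
          rw [ENNReal.tsum_mul_right, ν.tsum_coe, one_mul]
      _ ≤ _ := ENNReal.tsum_le_tsum fun β => by
          gcongr
          rw [PMF.toOuterMeasure_map_apply]
          exact h β
  rw [winProb]
  refine (ENNReal.ofReal_le_iff_le_toReal ?_).1 hlow
  refine ne_top_of_le_ne_top ENNReal.one_ne_top ?_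
  rw [PMF.toOuterMeasure_apply]
  exact (ENNReal.tsum_le_tsum fun p => Set.indicator_le_self _ _ p).trans (PMF.tsum_coe _).le

/-- A plan with a value function satisfying the one-step inequality yields a randomized strategy of
Maker that wins with at least the initial value as probability. -/
theorem exists_mixed (hn : 2 ≤ n) (ha : 0 < a) (D : Plan n)
    (val : (Fin n → Fin n) → Finset (Fin n) → SimpleGraph (Fin n) → ℕ → ℝ) (T : ℕ)
    (hmoves : ∀ lab P, (∀ v, lab (lab v) = lab v) → Unfinished lab →
      (D.moves lab P).Nonempty ∧ ∀ p ∈ D.moves lab P, lab p.1 ≠ lab p.2)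
    (hle : ∀ lab P G t, (∀ v, lab (lab v) = lab v) → ¬ Unfinished lab → val lab P G t ≤ 1)
    (hT : ∀ lab P G t, T ≤ t → (∀ v, lab (lab v) = lab v) → Unfinished lab →
      val lab P G t ≤ 0)
    (hdrift : Drift a b D val) :
    ∃ μ : PMF (MakerStrategy n), ∀ ν : PMF (BreakerStrategy n b),
      val id ∅ ⊥ 0 ≤ winProb a (spanningTrees n) μ ν := by
  have h01 : (⟨0, by omega⟩ : Fin n) ≠ ⟨1, by omega⟩ := by simp
  let e₀ : Edge n := ⟨s(⟨0, by omega⟩, ⟨1, by omega⟩), by simp⟩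
  have hL : 0 < (n * n).factorial := Nat.factorial_pos _
  have : Nonempty (Fin (n * n).factorial) := ⟨⟨0, hL⟩⟩
  -- `T` rounds contain `a * T` attempts, and since `a` is positive this reaches the horizon `T`,
  -- which is counted in attempts.
  refine ⟨(PMF.uniformOfFintype (Fin (a * T) → Fin (n * n).factorial)).map
    fun ω => D.strategy e₀ (extendSeq ω), winProb_ge _ _ _ fun β => ?_⟩
  rw [PMF.toOuterMeasure_map_apply, PMF.toOuterMeasure_uniformOfFintype_apply]
  set S := (fun ω : Fin (a * T) → Fin (n * n).factorial => D.strategy e₀ (extendSeq ω)) ⁻¹'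
    {σ | MakerWins a (spanningTrees n) σ β} with hS
  have hstart : recordValue D val (History.start n) = val id ∅ ⊥ 0 := by
    rw [recordValue, if_pos]
    · change val id ∅ (breakerGraph ∅) 0 = _
      rw [breakerGraph_empty]
    · exact ⟨_, _, h01⟩
  have hsum := sum_recordValue D e₀ val hmoves hle hdrift β (a * T)
  rw [hstart] at hsum
  have hbound : ∀ ω : Fin (a * T) → Fin (n * n).factorial, recordValue D val
      (recordAfter a (D.strategy e₀ (extendSeq ω)) β (a * T)) ≤ if ω ∈ S then 1 else 0 := by
    intro ω
    set h := recordAfter a (D.strategy e₀ (extendSeq ω)) β (a * T) with hh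
    have hlen : h.attempts.length = a * T := recordAfter_attempts_length _ _ _
    have hsound := labelsSound_recordAfter (a := a) D (D.strategy e₀ (extendSeq ω)) β (a * T)
    rw [← hh] at hsound
    by_cases hu : Unfinished (D.memory h.attempts).1
    · have : recordValue D val h ≤ 0 := by
        rw [recordValue, if_pos hu, hlen]
        exact hT _ _ _ _ (Nat.le_mul_of_pos_left _ ha) hsound.idem hu
      exact this.trans (by split_ifs <;> norm_num)
    · have hw : ω ∈ S := by
        obtain ⟨F, hF, hsub⟩ := exists_spanningTree_subset (by omega : 0 < n) h.maker fun u v =>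
          hsound.reachable u v (by
            by_contra hne; exact hu ⟨u, v, hne⟩)
        exact ⟨T, F, hF, by rw [play_eq_recordAfter ha]; exact hsub⟩
      rw [if_pos hw, recordValue, if_neg hu]
  have hcard : ((n * n).factorial : ℝ) ^ (a * T) * val id ∅ ⊥ 0 ≤ (Fintype.card S : ℝ) := by
    refine (hsum.trans (Finset.sum_le_sum fun ω _ => hbound ω)).trans (le_of_eq ?_)
    rw [Finset.sum_boole, Fintype.card_subtype]
  have hpos : (0 : ℝ) < ((n * n).factorial : ℝ) ^ (a * T) := by positivity
  have hc2 : (Fintype.card (Fin (a * T) → Fin (n * n).factorial) : ℝ) =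
      ((n * n).factorial : ℝ) ^ (a * T) := by simp
  have hfin : ENNReal.ofReal (val id ∅ ⊥ 0) ≤ ENNReal.ofReal ((Fintype.card S : ℝ) /
      (Fintype.card (Fin (a * T) → Fin (n * n).factorial) : ℝ)) := by
    apply ENNReal.ofReal_le_ofReal
    rw [hc2, le_div_iff₀ hpos]
    linarith
  refine hfin.trans (le_of_eq ?_)
  rw [ENNReal.ofReal_div_of_pos (by rw [hc2]; exact hpos), ENNReal.ofReal_natCast,
    ENNReal.ofReal_natCast]

end Mixed

/-! ## Components and degrees -/

section Components
variable {n : ℕ}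

/-- The component with label `c`. -/
noncomputable def comp (lab : Fin n → Fin n) (c : Fin n) : Finset (Fin n) :=
  Finset.univ.filter fun u => lab u = c

/-- The number of vertices of the component with label `c`. -/
noncomputable def compSize (lab : Fin n → Fin n) (c : Fin n) : ℕ := (comp lab c).card

/-- The labels of the components with fewer than `k` vertices. -/
noncomputable def smallRoots (lab : Fin n → Fin n) (k : ℕ) : Finset (Fin n) :=
  Finset.univ.filter fun c => lab c = c ∧ compSize lab c < k

/-- The labels of all components. -/
noncomputable def roots (lab : Fin n → Fin n) : Finset (Fin n) :=
  Finset.univ.filter fun c => lab c = c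

/-- The labelling `lab'` arises from `lab` by merging the component `c₂` into `c₁`. -/
structure IsMerge (lab lab' : Fin n → Fin n) (c₁ c₂ : Fin n) : Prop where
  ne : c₁ ≠ c₂
  root₁ : lab c₁ = c₁
  root₂ : lab c₂ = c₂
  eq : ∀ u, lab' u = if lab u = c₂ then c₁ else lab u

lemma exists_isMerge {lab : Fin n → Fin n} (hl : ∀ v, lab (lab v) = lab v) {v x : Fin n}
    (h : lab v ≠ lab x) : ∃ c₁ c₂, IsMerge lab (mergeAlong lab s(v, x)) c₁ c₂ ∧
      ((c₁ = lab v ∧ c₂ = lab x) ∨ (c₁ = lab x ∧ c₂ = lab v)) := by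
  rcases le_total (lab v) (lab x) with h' | h'
  · refine ⟨lab v, lab x, ⟨h, hl _, hl _, fun u => ?_⟩, Or.inl ⟨rfl, rfl⟩⟩
    rw [mergeAlong_mk, max_eq_right h', min_eq_left h']
  · refine ⟨lab x, lab v, ⟨h.symm, hl _, hl _, fun u => ?_⟩, Or.inr ⟨rfl, rfl⟩⟩
    rw [mergeAlong_mk, max_eq_left h', min_eq_right h']

lemma mem_comp {lab : Fin n → Fin n} {c u : Fin n} : u ∈ comp lab c ↔ lab u = c := by
  simp [comp]

lemma compSize_pos {lab : Fin n → Fin n} {c : Fin n} (h : lab c = c) : 0 < compSize lab c :=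
  Finset.card_pos.2 ⟨c, mem_comp.2 h⟩

lemma compSize_eq_zero {lab : Fin n → Fin n} (hl : ∀ v, lab (lab v) = lab v) {c : Fin n}
    (h : lab c ≠ c) : compSize lab c = 0 := by
  rw [compSize, Finset.card_eq_zero, Finset.eq_empty_iff_forall_notMem]
  intro u hu
  rw [mem_comp] at hu
  exact h (by rw [← hu, hl])

lemma mem_roots {lab : Fin n → Fin n} {c : Fin n} : c ∈ roots lab ↔ lab c = c := by simp [roots]

lemma mem_smallRoots {lab : Fin n → Fin n} {k : ℕ} {c : Fin n} :
    c ∈ smallRoots lab k ↔ lab c = c ∧ compSize lab c < k := by simp [smallRoots]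

lemma sum_roots_compSize {lab : Fin n → Fin n} (hl : ∀ v, lab (lab v) = lab v) :
    ∑ c ∈ roots lab, compSize lab c = n := by
  have := Finset.card_eq_sum_card_fiberwise (s := (Finset.univ : Finset (Fin n)))
    (t := roots lab) (f := lab) (fun u _ => by simpa [roots] using hl u)
  rw [Finset.card_univ, Fintype.card_fin] at this
  exact this.symm

lemma IsMerge.comp_left {lab lab' : Fin n → Fin n} {c₁ c₂ : Fin n} (h : IsMerge lab lab' c₁ c₂) :
    comp lab' c₁ = comp lab c₁ ∪ comp lab c₂ := by
  ext u
  rw [Finset.mem_union, mem_comp, mem_comp, mem_comp, h.eq]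
  split_ifs with h2
  · simp [h2]
  · simp [h2]

lemma disjoint_comp {lab : Fin n → Fin n} {c₁ c₂ : Fin n} (h : c₁ ≠ c₂) :
    Disjoint (comp lab c₁) (comp lab c₂) := by
  rw [Finset.disjoint_left]
  intro u h1 h2
  rw [mem_comp] at h1 h2
  exact h (h1.symm.trans h2)

lemma IsMerge.comp_right {lab lab' : Fin n → Fin n} {c₁ c₂ : Fin n} (h : IsMerge lab lab' c₁ c₂) :
    comp lab' c₂ = ∅ := by
  rw [Finset.eq_empty_iff_forall_notMem]
  intro u hu
  rw [mem_comp, h.eq] at hu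
  split_ifs at hu with h2
  · exact h.ne hu
  · exact h2 hu

lemma IsMerge.comp_other {lab lab' : Fin n → Fin n} {c₁ c₂ c : Fin n}
    (h : IsMerge lab lab' c₁ c₂) (h1 : c ≠ c₁) (h2 : c ≠ c₂) : comp lab' c = comp lab c := by
  ext u
  rw [mem_comp, mem_comp, h.eq]
  split_ifs with h3
  · rw [h3]; exact ⟨fun h' => absurd h'.symm h1, fun h' => absurd h'.symm h2⟩
  · rfl

lemma IsMerge.compSize_left {lab lab' : Fin n → Fin n} {c₁ c₂ : Fin n}
    (h : IsMerge lab lab' c₁ c₂) : compSize lab' c₁ = compSize lab c₁ + compSize lab c₂ := by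
  rw [compSize, h.comp_left, Finset.card_union_of_disjoint (disjoint_comp h.ne)]; rfl

lemma IsMerge.compSize_other {lab lab' : Fin n → Fin n} {c₁ c₂ c : Fin n}
    (h : IsMerge lab lab' c₁ c₂) (h1 : c ≠ c₁) (h2 : c ≠ c₂) :
    compSize lab' c = compSize lab c := by
  rw [compSize, h.comp_other h1 h2]; rfl

lemma IsMerge.root_iff {lab lab' : Fin n → Fin n} {c₁ c₂ : Fin n}
    (h : IsMerge lab lab' c₁ c₂) (c : Fin n) : lab' c = c ↔ lab c = c ∧ c ≠ c₂ := by
  rw [h.eq]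
  split_ifs with h2
  · constructor
    · rintro rfl; exact absurd (h.root₁.symm.trans h2) h.ne
    · rintro ⟨h3, h4⟩; exact absurd (h3.symm.trans h2) h4
  · constructor
    · intro h3; exact ⟨h3, fun h4 => h2 (h3.trans h4)⟩
    · exact fun h3 => h3.1

lemma IsMerge.roots_eq {lab lab' : Fin n → Fin n} {c₁ c₂ : Fin n}
    (h : IsMerge lab lab' c₁ c₂) : roots lab' = (roots lab).erase c₂ := by
  ext c
  rw [Finset.mem_erase, mem_roots, mem_roots, h.root_iff, and_comm]

lemma IsMerge.card_roots {lab lab' : Fin n → Fin n} {c₁ c₂ : Fin n}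
    (h : IsMerge lab lab' c₁ c₂) : (roots lab').card + 1 = (roots lab).card := by
  rw [h.roots_eq, Finset.card_erase_add_one (mem_roots.2 h.root₂)]

lemma IsMerge.smallRoots_subset {lab lab' : Fin n → Fin n} {c₁ c₂ : Fin n}
    (h : IsMerge lab lab' c₁ c₂) (k : ℕ) : smallRoots lab' k ⊆ (smallRoots lab k).erase c₂ := by
  intro c hc
  rw [mem_smallRoots, h.root_iff] at hc
  rw [Finset.mem_erase, mem_smallRoots]
  refine ⟨hc.1.2, hc.1.1, ?_⟩
  by_cases h1 : c = c₁
  · subst h1; rw [h.compSize_left] at hc; omega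
  · rw [← h.compSize_other h1 hc.1.2]; exact hc.2

lemma IsMerge.smallRoots_subset_left {lab lab' : Fin n → Fin n} {c₁ c₂ : Fin n}
    (h : IsMerge lab lab' c₁ c₂) (k : ℕ) (hk : k ≤ compSize lab c₁ + compSize lab c₂) :
    smallRoots lab' k ⊆ ((smallRoots lab k).erase c₂).erase c₁ := by
  intro c hc
  rw [Finset.mem_erase]
  refine ⟨?_, h.smallRoots_subset k hc⟩
  rintro rfl
  rw [mem_smallRoots, h.compSize_left] at hc
  omega

lemma IsMerge.erase_erase_subset {lab lab' : Fin n → Fin n} {c₁ c₂ : Fin n}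
    (h : IsMerge lab lab' c₁ c₂) (k : ℕ) :
    ((smallRoots lab k).erase c₂).erase c₁ ⊆ smallRoots lab' k := by
  intro c hc
  rw [Finset.mem_erase, Finset.mem_erase, mem_smallRoots] at hc
  rw [mem_smallRoots, h.root_iff, h.compSize_other hc.1 hc.2.1]
  exact ⟨⟨hc.2.2.1, hc.2.1⟩, hc.2.2.2⟩

lemma IsMerge.card_smallRoots_le {lab lab' : Fin n → Fin n} {c₁ c₂ : Fin n}
    (h : IsMerge lab lab' c₁ c₂) (k : ℕ) : (smallRoots lab' k).card ≤ (smallRoots lab k).card :=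
  Finset.card_le_card ((h.smallRoots_subset k).trans (Finset.erase_subset _ _))

lemma IsMerge.card_smallRoots_ge {lab lab' : Fin n → Fin n} {c₁ c₂ : Fin n}
    (h : IsMerge lab lab' c₁ c₂) (k : ℕ) :
    (smallRoots lab k).card ≤ (smallRoots lab' k).card + 2 := by
  have h1 := Finset.card_le_card (h.erase_erase_subset k)
  have h2 := Finset.pred_card_le_card_erase (s := smallRoots lab k) (a := c₂)
  have h3 := Finset.pred_card_le_card_erase (s := (smallRoots lab k).erase c₂) (a := c₁)
  omega

lemma IsMerge.card_smallRoots_lt {lab lab' : Fin n → Fin n} {c₁ c₂ : Fin n}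
    (h : IsMerge lab lab' c₁ c₂) (k : ℕ) (hk : c₁ ∈ smallRoots lab k ∨ c₂ ∈ smallRoots lab k) :
    (smallRoots lab' k).card + 1 ≤ (smallRoots lab k).card := by
  by_cases h2 : c₂ ∈ smallRoots lab k
  · have := Finset.card_le_card (h.smallRoots_subset k)
    rw [← Finset.card_erase_add_one h2]; omega
  · have h1 : c₁ ∈ smallRoots lab k := hk.resolve_right h2
    have hc : k ≤ compSize lab c₂ := by
      by_contra hlt
      exact h2 (mem_smallRoots.2 ⟨h.root₂, not_le.1 hlt⟩)
    have := Finset.card_le_card (h.smallRoots_subset_left k (by omega))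
    rw [Finset.erase_eq_of_notMem h2] at this
    rw [← Finset.card_erase_add_one h1]; omega

/-- The merged component is no longer small, so both labels leave the count. This is why pairing
small components costs only half an attempt per component. -/
lemma IsMerge.card_smallRoots_pair {lab lab' : Fin n → Fin n} {c₁ c₂ : Fin n}
    (h : IsMerge lab lab' c₁ c₂) (k : ℕ) (h1 : c₁ ∈ smallRoots lab k) (h2 : c₂ ∈ smallRoots lab k)
    (hk : k ≤ compSize lab c₁ + compSize lab c₂) :
    (smallRoots lab' k).card + 2 ≤ (smallRoots lab k).card := by
  have := Finset.card_le_card (h.smallRoots_subset_left k hk)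
  rw [← Finset.card_erase_add_one h2,
    ← Finset.card_erase_add_one (Finset.mem_erase.2 ⟨h.ne, h1⟩)]
  omega

/-- The label of a smallest component. -/
def IsMinRoot (lab : Fin n → Fin n) (c : Fin n) : Prop :=
  lab c = c ∧ ∀ c', lab c' = c' → compSize lab c ≤ compSize lab c'

lemma exists_isMinRoot {lab : Fin n → Fin n} (hl : ∀ v, lab (lab v) = lab v)
    (hu : Unfinished lab) : ∃ c, IsMinRoot lab c := by
  obtain ⟨u, v, huv⟩ := hu
  obtain ⟨c, hc, hmin⟩ := Finset.exists_min_image (roots lab) (compSize lab)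
    ⟨lab u, mem_roots.2 (hl u)⟩
  exact ⟨c, mem_roots.1 hc, fun c' hc' => hmin c' (mem_roots.2 hc')⟩

lemma IsMinRoot.two_mul_le {lab : Fin n → Fin n} {c : Fin n} (h : IsMinRoot lab c)
    (hl : ∀ v, lab (lab v) = lab v) (hu : Unfinished lab) : 2 * compSize lab c ≤ n := by
  obtain ⟨c', hc', hne⟩ : ∃ c', lab c' = c' ∧ c' ≠ c := by
    obtain ⟨u, v, huv⟩ := hu
    by_cases h1 : lab u = c
    · exact ⟨lab v, hl v, fun h2 => huv (h1.trans h2.symm)⟩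
    · exact ⟨lab u, hl u, h1⟩
  have h1 := h.2 c' hc'
  have h2 : ∑ d ∈ {c, c'}, compSize lab d ≤ ∑ d ∈ roots lab, compSize lab d :=
    Finset.sum_le_sum_of_subset (by
      intro d hd
      rw [Finset.mem_insert, Finset.mem_singleton] at hd
      rcases hd with rfl | rfl
      · exact mem_roots.2 h.1
      · exact mem_roots.2 hc')
  rw [sum_roots_compSize hl, Finset.sum_pair hne.symm] at h2
  omega

/-- The ordered pairs of vertices leading out of the component `c`. -/
noncomputable def cutPairs (lab : Fin n → Fin n) (c : Fin n) : Finset (Fin n × Fin n) :=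
  comp lab c ×ˢ (comp lab c)ᶜ

lemma mem_cutPairs {lab : Fin n → Fin n} {c : Fin n} {p : Fin n × Fin n} :
    p ∈ cutPairs lab c ↔ lab p.1 = c ∧ lab p.2 ≠ c := by
  simp [cutPairs, mem_comp]

lemma card_cutPairs (lab : Fin n → Fin n) (c : Fin n) :
    (cutPairs lab c).card = compSize lab c * (n - compSize lab c) := by
  rw [cutPairs, Finset.card_product, Finset.card_compl, Fintype.card_fin]; rfl

lemma compSize_le (lab : Fin n → Fin n) (c : Fin n) : compSize lab c ≤ n := by
  simpa [compSize] using Finset.card_le_univ (comp lab c)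

lemma compSize_lt {lab : Fin n → Fin n} (hu : Unfinished lab) (c : Fin n) :
    compSize lab c < n := by
  obtain ⟨u, v, huv⟩ := hu
  have : ∃ w, lab w ≠ c := by
    by_cases h : lab u = c
    · exact ⟨v, fun h' => huv (h.trans h'.symm)⟩
    · exact ⟨u, h⟩
  obtain ⟨w, hw⟩ := this
  have h1 : comp lab c ⊂ Finset.univ := by
    rw [Finset.ssubset_univ_iff]
    intro h
    exact hw (mem_comp.1 (h ▸ Finset.mem_univ w))
  simpa [compSize] using Finset.card_lt_card h1

end Components

/-! ### Counting PhantomBreaker's edges in cuts and at vertices -/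

section Degrees
variable {n : ℕ}

/-- The degree of a vertex. -/
noncomputable def deg (G : SimpleGraph (Fin n)) (v : Fin n) : ℕ :=
  (Finset.univ.filter fun x => G.Adj v x).card

lemma deg_eq_degree (G : SimpleGraph (Fin n)) (v : Fin n) : deg G v = G.degree v := by
  rw [deg, SimpleGraph.degree]
  congr 1
  ext x; simp

lemma edgeCount_eq_card (G : SimpleGraph (Fin n)) : edgeCount G = G.edgeFinset.card := by
  rw [edgeCount, ← SimpleGraph.coe_edgeFinset, Set.ncard_coe_finset]

lemma sum_deg (G : SimpleGraph (Fin n)) : ∑ v, deg G v = 2 * edgeCount G := by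
  rw [edgeCount_eq_card, ← SimpleGraph.sum_degrees_eq_twice_card_edges]
  exact Finset.sum_congr rfl fun v _ => deg_eq_degree G v

lemma deg_mono {G G' : SimpleGraph (Fin n)} (h : G ≤ G') (v : Fin n) : deg G v ≤ deg G' v :=
  Finset.card_le_card fun x hx => by
    simp only [Finset.mem_filter, Finset.mem_univ, true_and] at hx ⊢
    exact h hx

lemma deg_le_deg_add {G G' : SimpleGraph (Fin n)} (h : G ≤ G') {b : ℕ}
    (hb : edgeCount G' ≤ edgeCount G + b) (v : Fin n) : deg G' v ≤ deg G v + b := by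
  have h1 : (Finset.univ.filter fun x => G'.Adj v x ∧ ¬ G.Adj v x).card ≤ b := by
    have h2 : (Finset.univ.filter fun x => G'.Adj v x ∧ ¬ G.Adj v x).card ≤
        (G'.edgeFinset \ G.edgeFinset).card := by
      refine Finset.card_le_card_of_injOn (fun x => s(v, x)) (fun x hx => ?_)
        (fun x _ y _ h => ?_)
      · simp only [Finset.coe_filter, Finset.mem_univ, true_and, Set.mem_ofPred_eq] at hx
        simp only [Finset.coe_sdiff, SimpleGraph.coe_edgeFinset, Set.mem_sdiff,
          SimpleGraph.mem_edgeSet]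
        exact hx
      · exact Sym2.congr_right.1 h
    rw [Finset.card_sdiff_of_subset (SimpleGraph.edgeFinset_mono h), ← edgeCount_eq_card,
      ← edgeCount_eq_card] at h2
    omega
  have h3 : (Finset.univ.filter fun x => G'.Adj v x) ⊆
      (Finset.univ.filter fun x => G.Adj v x) ∪
        (Finset.univ.filter fun x => G'.Adj v x ∧ ¬ G.Adj v x) := by
    intro x hx
    simp only [Finset.mem_filter, Finset.mem_univ, true_and, Finset.mem_union] at hx ⊢
    by_cases hG : G.Adj v x
    · exact Or.inl hG
    · exact Or.inr ⟨hx, hG⟩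
  have h4 := (Finset.card_le_card h3).trans (Finset.card_union_le _ _)
  rw [deg, deg]
  omega

/-- Pairs of a cut are oriented outwards, so each edge is counted at most once; among all ordered
pairs of a set it is counted twice, as in `card_adj_offDiag_le`. -/
lemma card_adj_cutPairs_le (G : SimpleGraph (Fin n)) (lab : Fin n → Fin n) (c : Fin n) :
    ((cutPairs lab c).filter fun p => G.Adj p.1 p.2).card ≤ edgeCount G := by
  rw [edgeCount_eq_card]
  refine Finset.card_le_card_of_injOn (fun p => s(p.1, p.2)) (fun p hp => ?_)
    (fun p hp q hq h => ?_)
  · simp only [Finset.coe_filter, Set.mem_ofPred_eq] at hp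
    simpa using hp.2
  · simp only [Finset.coe_filter, Set.mem_ofPred_eq, mem_cutPairs] at hp hq
    simp only [Sym2.eq_iff] at h
    rcases h with ⟨h1, h2⟩ | ⟨h1, h2⟩
    · exact Prod.ext h1 h2
    · exact absurd (h1 ▸ hp.1.1) hq.1.2

lemma card_adj_le_sum_deg (G : SimpleGraph (Fin n)) (S : Finset (Fin n))
    (Q : Finset (Fin n × Fin n)) (hQ : ∀ p ∈ Q, p.1 ∈ S) :
    (Q.filter fun p => G.Adj p.1 p.2).card ≤ ∑ v ∈ S, deg G v := by
  have : (Q.filter fun p => G.Adj p.1 p.2) ⊆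
      (S.sigma fun v => Finset.univ.filter fun x => G.Adj v x).map
        (Equiv.sigmaEquivProd (Fin n) (Fin n)).toEmbedding := by
    intro p hp
    rw [Finset.mem_filter] at hp
    simp only [Finset.mem_map, Finset.mem_sigma, Finset.mem_filter, Finset.mem_univ, true_and]
    exact ⟨⟨p.1, p.2⟩, ⟨hQ p hp.1, hp.2⟩, rfl⟩
  refine (Finset.card_le_card this).trans ?_
  rw [Finset.card_map, Finset.card_sigma]
  rfl

lemma card_adj_offDiag_le (G : SimpleGraph (Fin n)) (R : Finset (Fin n)) :
    (R.offDiag.filter fun p => G.Adj p.1 p.2).card ≤ 2 * edgeCount G := by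
  refine (card_adj_le_sum_deg G Finset.univ _ fun _ _ => Finset.mem_univ _).trans ?_
  rw [sum_deg]

lemma sum_deg_le (G : SimpleGraph (Fin n)) (R : Finset (Fin n)) :
    ∑ v ∈ R, deg G v ≤ 2 * edgeCount G := by
  rw [← sum_deg]
  exact Finset.sum_le_sum_of_subset (Finset.subset_univ _)

lemma sum_deg_le_sum_deg_add {G G' : SimpleGraph (Fin n)} (h : G ≤ G') {b : ℕ}
    (hb : edgeCount G' ≤ edgeCount G + b) (R : Finset (Fin n)) :
    ∑ v ∈ R, deg G' v ≤ ∑ v ∈ R, deg G v + 2 * b := by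
  have h1 := Finset.sum_add_sum_compl R (deg G)
  have h2 := Finset.sum_add_sum_compl R (deg G')
  rw [sum_deg] at h1 h2
  have h3 : ∑ v ∈ Rᶜ, deg G v ≤ ∑ v ∈ Rᶜ, deg G' v := Finset.sum_le_sum fun v _ => deg_mono h v
  omega

/-- The sum of the degrees over a component. -/
noncomputable def compDeg (G : SimpleGraph (Fin n)) (lab : Fin n → Fin n) (c : Fin n) : ℕ :=
  ∑ v ∈ comp lab c, deg G v

lemma IsMerge.compDeg_left {lab lab' : Fin n → Fin n} {c₁ c₂ : Fin n}
    (h : IsMerge lab lab' c₁ c₂) (G : SimpleGraph (Fin n)) :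
    compDeg G lab' c₁ = compDeg G lab c₁ + compDeg G lab c₂ := by
  rw [compDeg, h.comp_left, Finset.sum_union (disjoint_comp h.ne)]; rfl

lemma IsMerge.compDeg_right {lab lab' : Fin n → Fin n} {c₁ c₂ : Fin n}
    (h : IsMerge lab lab' c₁ c₂) (G : SimpleGraph (Fin n)) : compDeg G lab' c₂ = 0 := by
  rw [compDeg, h.comp_right, Finset.sum_empty]

lemma IsMerge.compDeg_other {lab lab' : Fin n → Fin n} {c₁ c₂ c : Fin n}
    (h : IsMerge lab lab' c₁ c₂) (h1 : c ≠ c₁) (h2 : c ≠ c₂) (G : SimpleGraph (Fin n)) :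
    compDeg G lab' c = compDeg G lab c := by
  rw [compDeg, h.comp_other h1 h2]; rfl

lemma sum_compDeg (G : SimpleGraph (Fin n)) (lab : Fin n → Fin n) :
    ∑ c, compDeg G lab c = 2 * edgeCount G := by
  rw [← sum_deg]
  exact Finset.sum_fiberwise _ lab (deg G)

lemma compDeg_mono {G G' : SimpleGraph (Fin n)} (h : G ≤ G') (lab : Fin n → Fin n) (c : Fin n) :
    compDeg G lab c ≤ compDeg G' lab c := Finset.sum_le_sum fun v _ => deg_mono h v

end Degrees

/-! ## A strategy that wins with positive probability for every bias -/

section Weight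
variable {n : ℕ}

/-- The relative distance of the degree sum of a component from the critical value. -/
noncomputable def slack (G : SimpleGraph (Fin n)) (lab : Fin n → Fin n) (c : Fin n) : ℝ :=
  max 0 (1 - 4 * compDeg G lab c / (n * compSize lab c))

/-- The product of powers of the slacks of the components with fewer than `s` vertices. -/
noncomputable def weight (s : ℕ) (G : SimpleGraph (Fin n)) (lab : Fin n → Fin n) : ℝ :=
  ∏ c, slack G lab c ^ (2 * (s - compSize lab c))

lemma slack_nonneg (G : SimpleGraph (Fin n)) (lab : Fin n → Fin n) (c : Fin n) :
    0 ≤ slack G lab c := le_max_left _ _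

lemma slack_le_one (G : SimpleGraph (Fin n)) (lab : Fin n → Fin n) (c : Fin n) :
    slack G lab c ≤ 1 := by
  refine max_le zero_le_one ?_
  have : (0 : ℝ) ≤ 4 * compDeg G lab c / (n * compSize lab c) := by positivity
  linarith

lemma weight_nonneg (s : ℕ) (G : SimpleGraph (Fin n)) (lab : Fin n → Fin n) :
    0 ≤ weight s G lab := Finset.prod_nonneg fun c _ => pow_nonneg (slack_nonneg G lab c) _

lemma weight_le_one (s : ℕ) (G : SimpleGraph (Fin n)) (lab : Fin n → Fin n) :
    weight s G lab ≤ 1 := Finset.prod_le_one (fun c _ => pow_nonneg (slack_nonneg G lab c) _)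
      fun c _ => pow_le_one₀ (slack_nonneg G lab c) (slack_le_one G lab c)

/-- The ratio of degree sum to size for a union is a mediant of the two ratios, hence at most the
larger one. -/
lemma IsMerge.min_slack_le {lab lab' : Fin n → Fin n} {c₁ c₂ : Fin n}
    (h : IsMerge lab lab' c₁ c₂) (G : SimpleGraph (Fin n)) :
    min (slack G lab c₁) (slack G lab c₂) ≤ slack G lab' c₁ := by
  have hn : (0 : ℝ) < n := by exact_mod_cast Fin.pos c₁
  have h1 : (0 : ℝ) < compSize lab c₁ := by exact_mod_cast compSize_pos h.root₁
  have h2 : (0 : ℝ) < compSize lab c₂ := by exact_mod_cast compSize_pos h.root₂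
  rw [slack, slack, slack, ← max_min_distrib_left]
  refine max_le_max le_rfl ?_
  rw [h.compDeg_left, h.compSize_left]
  push_cast
  set d₁ : ℝ := (compDeg G lab c₁ : ℝ)
  set d₂ : ℝ := (compDeg G lab c₂ : ℝ)
  set s₁ : ℝ := (compSize lab c₁ : ℝ)
  set s₂ : ℝ := (compSize lab c₂ : ℝ)
  set m := min (1 - 4 * d₁ / (n * s₁)) (1 - 4 * d₂ / (n * s₂)) with hm
  have e1 : 4 * d₁ ≤ (1 - m) * (n * s₁) := by
    rw [← div_le_iff₀ (by positivity)]; linarith [min_le_left (1 - 4 * d₁ / (n * s₁)) (1 - 4 * d₂ / (n * s₂))]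
  have e2 : 4 * d₂ ≤ (1 - m) * (n * s₂) := by
    rw [← div_le_iff₀ (by positivity)]; linarith [min_le_right (1 - 4 * d₁ / (n * s₁)) (1 - 4 * d₂ / (n * s₂))]
  have e3 : 4 * (d₁ + d₂) / (n * (s₁ + s₂)) ≤ 1 - m := by
    rw [div_le_iff₀ (by positivity)]; linarith
  linarith

/-- Sizes are positive, so the exponent of a small component exceeds the merged exponent by at least
2. The factor whose base is at most `z` becomes the merged factor, and its two spare powers give `z₁
^ 2`: if that base is `z₂`, then it is also below `z₁`. If `s₂` is at least `s`, the merged exponent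
is 0. -/
lemma pow_mul_pow_le_of_min_le {z₁ z₂ z : ℝ} (h1 : 0 ≤ z₁) (h1' : z₁ ≤ 1) (h2 : 0 ≤ z₂)
    (h2' : z₂ ≤ 1) (hz : 0 ≤ z) (hz' : z ≤ 1) (hmin : min z₁ z₂ ≤ z) {s s₁ s₂ : ℕ}
    (hs₁ : 0 < s₁) (hs₂ : 0 < s₂) (hs : s₁ < s) :
    z₁ ^ (2 * (s - s₁)) * z₂ ^ (2 * (s - s₂)) ≤ z₁ ^ 2 * z ^ (2 * (s - (s₁ + s₂))) := by
  by_cases hcase : z₁ ≤ z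
  · calc z₁ ^ (2 * (s - s₁)) * z₂ ^ (2 * (s - s₂)) ≤ z₁ ^ (2 * (s - s₁)) * 1 := by
          gcongr; exact pow_le_one₀ h2 h2'
      _ = z₁ ^ 2 * z₁ ^ (2 * (s - s₁) - 2) := by rw [mul_one, ← pow_add]; congr 1; omega
      _ ≤ z₁ ^ 2 * z ^ (2 * (s - s₁) - 2) := by gcongr
      _ ≤ z₁ ^ 2 * z ^ (2 * (s - (s₁ + s₂))) := by
          gcongr 1
          exact pow_le_pow_of_le_one hz hz' (by omega)
  · have hz2 : z₂ ≤ z := by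
      rcases min_le_iff.1 hmin with h | h
      · exact absurd h hcase
      · exact h
    push Not at hcase
    by_cases hs' : s₂ < s
    · calc z₁ ^ (2 * (s - s₁)) * z₂ ^ (2 * (s - s₂)) ≤ 1 * z₂ ^ (2 * (s - s₂)) := by
            gcongr; exact pow_le_one₀ h1 h1'
        _ = z₂ ^ 2 * z₂ ^ (2 * (s - s₂) - 2) := by rw [one_mul, ← pow_add]; congr 1; omega
        _ ≤ z₁ ^ 2 * z ^ (2 * (s - s₂) - 2) := by gcongr; linarith
        _ ≤ z₁ ^ 2 * z ^ (2 * (s - (s₁ + s₂))) := by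
            gcongr 1
            exact pow_le_pow_of_le_one hz hz' (by omega)
    · have e1 : s - s₂ = 0 := by omega
      have e2 : s - (s₁ + s₂) = 0 := by omega
      rw [e1, e2, mul_zero, pow_zero, pow_zero, mul_one, mul_one]
      exact pow_le_pow_of_le_one h1 h1' (by omega)

/-- The exponents of the weight are chosen for this: a merge at a small component gains at least the
inverse square of its slack. The label that disappears contributes the factor 1. -/
lemma IsMerge.weight_le {lab lab' : Fin n → Fin n} {c₁ c₂ : Fin n}
    (h : IsMerge lab lab' c₁ c₂) (G : SimpleGraph (Fin n)) (s : ℕ) (c : Fin n)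
    (hc : c = c₁ ∨ c = c₂) (hs : compSize lab c < s) :
    weight s G lab ≤ slack G lab c ^ 2 * weight s G lab' := by
  have hrest : ∏ d ∈ (Finset.univ.erase c₁).erase c₂, slack G lab' d ^ (2 * (s - compSize lab' d))
      = ∏ d ∈ (Finset.univ.erase c₁).erase c₂, slack G lab d ^ (2 * (s - compSize lab d)) := by
    refine Finset.prod_congr rfl fun d hd => ?_
    rw [Finset.mem_erase, Finset.mem_erase] at hd
    rw [slack, slack, h.compSize_other hd.2.1 hd.1, h.compDeg_other hd.2.1 hd.1]
  have hsplit : ∀ l : Fin n → Fin n, weight s G l = slack G l c₁ ^ (2 * (s - compSize l c₁)) *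
      (slack G l c₂ ^ (2 * (s - compSize l c₂)) *
      ∏ d ∈ (Finset.univ.erase c₁).erase c₂, slack G l d ^ (2 * (s - compSize l d))) := by
    intro l
    rw [Finset.mul_prod_erase _ (fun d => slack G l d ^ (2 * (s - compSize l d)))
      (Finset.mem_erase.2 ⟨h.ne.symm, Finset.mem_univ _⟩),
      Finset.mul_prod_erase _ (fun d => slack G l d ^ (2 * (s - compSize l d)))
      (Finset.mem_univ _)]
    rfl
  rw [hsplit lab, hsplit lab', hrest]
  have hone : slack G lab' c₂ = 1 := by
    rw [slack, h.compDeg_right]; simp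
  rw [hone, one_pow, one_mul, ← mul_assoc, ← mul_assoc]
  refine mul_le_mul_of_nonneg_right ?_
    (Finset.prod_nonneg fun d _ => pow_nonneg (slack_nonneg G lab d) _)
  rw [h.compSize_left]
  have hp1 := compSize_pos h.root₁
  have hp2 := compSize_pos h.root₂
  rcases hc with rfl | rfl
  · exact pow_mul_pow_le_of_min_le (slack_nonneg _ _ _) (slack_le_one _ _ _) (slack_nonneg _ _ _)
      (slack_le_one _ _ _) (slack_nonneg _ _ _) (slack_le_one _ _ _) (h.min_slack_le G) hp1 hp2 hs
  · rw [mul_comm, add_comm]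
    exact pow_mul_pow_le_of_min_le (slack_nonneg _ _ _) (slack_le_one _ _ _) (slack_nonneg _ _ _)
      (slack_le_one _ _ _) (slack_nonneg _ _ _) (slack_le_one _ _ _)
      (by rw [min_comm]; exact h.min_slack_le G) hp2 hp1 hs

lemma one_sub_sum_le_prod {ι : Type*} (S : Finset ι) (f : ι → ℝ) (h0 : ∀ i ∈ S, 0 ≤ f i)
    (h1 : ∀ i ∈ S, f i ≤ 1) : 1 - ∑ i ∈ S, f i ≤ ∏ i ∈ S, (1 - f i) := by
  induction S using Finset.induction_on with
  | empty => simp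
  | insert i S hi ih =>
    rw [Finset.sum_insert hi, Finset.prod_insert hi]
    have hI := ih (fun j hj => h0 j (Finset.mem_insert_of_mem hj))
      fun j hj => h1 j (Finset.mem_insert_of_mem hj)
    have hsum : 0 ≤ ∑ j ∈ S, f j := Finset.sum_nonneg fun j hj => h0 j (Finset.mem_insert_of_mem hj)
    have a0 := h0 i (Finset.mem_insert_self _ _)
    have a1 := h1 i (Finset.mem_insert_self _ _)
    nlinarith [mul_le_mul_of_nonneg_left hI (sub_nonneg.2 a1), mul_nonneg a0 hsum]

/-- The Weierstrass product inequality for relative losses. If the total loss exceeds 1, the left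
side is nonpositive, so no bound on the single losses is needed. -/
lemma prod_mul_one_sub_sum_le {ι : Type*} (S : Finset ι) (w w' f : ι → ℝ)
    (hw : ∀ i ∈ S, 0 ≤ w i) (hw' : ∀ i ∈ S, 0 ≤ w' i) (hf : ∀ i ∈ S, 0 ≤ f i)
    (h : ∀ i ∈ S, w i * (1 - f i) ≤ w' i) :
    (∏ i ∈ S, w i) * (1 - ∑ i ∈ S, f i) ≤ ∏ i ∈ S, w' i := by
  by_cases hs : ∑ i ∈ S, f i ≤ 1
  · have hle : ∀ i ∈ S, f i ≤ 1 := fun i hi => (Finset.single_le_sum hf hi).trans hs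
    calc (∏ i ∈ S, w i) * (1 - ∑ i ∈ S, f i) ≤ (∏ i ∈ S, w i) * ∏ i ∈ S, (1 - f i) :=
          mul_le_mul_of_nonneg_left (one_sub_sum_le_prod S f hf hle) (Finset.prod_nonneg hw)
      _ = ∏ i ∈ S, w i * (1 - f i) := Finset.prod_mul_distrib.symm
      _ ≤ _ := Finset.prod_le_prod (fun i hi => mul_nonneg (hw i hi) (by linarith [hle i hi])) h
  · push Not at hs
    refine le_trans ?_ (Finset.prod_nonneg hw')
    exact mul_nonpos_of_nonneg_of_nonpos (Finset.prod_nonneg hw) (by linarith)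

/-- At most `b` new edges raise the degree sums by at most `2 * b` in total. A rise `k` at a
component with slack `y` lowers `y` by at most `4 * k / n`, a relative loss `4 * k / (n * y)`, which
Bernoulli's inequality magnifies by the exponent, at most `2 * s`. -/
lemma weight_mul_le {lab : Fin n → Fin n} (hl : ∀ v, lab (lab v) = lab v)
    {G G' : SimpleGraph (Fin n)} (hG : G ≤ G') {b : ℕ} (hb : edgeCount G' ≤ edgeCount G + b)
    (s : ℕ) {z : ℝ} (hz : 0 < z) (hslack : ∀ c ∈ smallRoots lab s, z ≤ slack G lab c) :
    weight s G lab * (1 - 16 * b * s / (n * z)) ≤ weight s G' lab := by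
  rcases Nat.eq_zero_or_pos n with rfl | hn
  · simp [weight]
  have hn' : (0 : ℝ) < n := by exact_mod_cast hn
  have hsum : ∑ c, 8 * (s : ℝ) * ((compDeg G' lab c : ℝ) - compDeg G lab c) / (n * z) ≤
      16 * b * s / (n * z) := by
    rw [← Finset.sum_div, ← Finset.mul_sum, Finset.sum_sub_distrib]
    have e1 : ∑ c, (compDeg G' lab c : ℝ) = 2 * edgeCount G' := by exact_mod_cast sum_compDeg G' lab
    have e2 : ∑ c, (compDeg G lab c : ℝ) = 2 * edgeCount G := by exact_mod_cast sum_compDeg G lab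
    have e3 : (edgeCount G' : ℝ) ≤ edgeCount G + b := by exact_mod_cast hb
    rw [e1, e2]
    apply div_le_div_of_nonneg_right _ (by positivity)
    nlinarith [Nat.cast_nonneg (α := ℝ) s]
  have hmain := prod_mul_one_sub_sum_le Finset.univ
    (fun c => slack G lab c ^ (2 * (s - compSize lab c)))
    (fun c => slack G' lab c ^ (2 * (s - compSize lab c)))
    (fun c => 8 * (s : ℝ) * ((compDeg G' lab c : ℝ) - compDeg G lab c) / (n * z))
    (fun c _ => pow_nonneg (slack_nonneg _ _ _) _) (fun c _ => pow_nonneg (slack_nonneg _ _ _) _)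
    (fun c _ => by
      have : (compDeg G lab c : ℝ) ≤ compDeg G' lab c := by exact_mod_cast compDeg_mono hG lab c
      have h2 : (0 : ℝ) ≤ (compDeg G' lab c : ℝ) - compDeg G lab c := by linarith
      positivity)
    (fun c _ => by
      have hk : (compDeg G lab c : ℝ) ≤ compDeg G' lab c := by exact_mod_cast compDeg_mono hG lab c
      set k : ℝ := (compDeg G' lab c : ℝ) - compDeg G lab c with hkdef
      have hk0 : 0 ≤ k := by linarith
      have hf0 : 0 ≤ 8 * (s : ℝ) * k / (n * z) := by positivity
      by_cases hroot : lab c = c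
      · by_cases hsz : compSize lab c < s
        · have hzc := hslack c (mem_smallRoots.2 ⟨hroot, hsz⟩)
          have hsp : (1 : ℝ) ≤ compSize lab c := by exact_mod_cast compSize_pos hroot
          set y := slack G lab c with hy
          have hy0 : 0 < y := hz.trans_le hzc
          have hyeq : y = 1 - 4 * compDeg G lab c / (n * compSize lab c) := by
            rcases max_choice 0 (1 - 4 * compDeg G lab c / (n * compSize lab c) : ℝ) with h | h
            · rw [hy, slack, h] at hy0; exact absurd hy0 (lt_irrefl _)
            · rw [hy, slack, h]
          have hy' : y - 4 * k / n ≤ slack G' lab c := by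
            refine le_trans ?_ (le_max_right _ _)
            have e1 : 4 * (compDeg G' lab c : ℝ) / (n * compSize lab c) =
                4 * compDeg G lab c / (n * compSize lab c) + 4 * k / (n * compSize lab c) := by
              rw [hkdef]; ring
            have e2 : 4 * k / (n * compSize lab c) ≤ 4 * k / n := by
              apply div_le_div_of_nonneg_left (by positivity) hn'
              nlinarith
            rw [e1, hyeq]; linarith
          set q := 2 * (s - compSize lab c) with hq
          have hqs : (q : ℝ) ≤ 2 * s := by
            rw [hq]; push_cast
            have : ((s - compSize lab c : ℕ) : ℝ) ≤ s := by exact_mod_cast Nat.sub_le _ _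
            linarith
          set x := 4 * k / (n * y) with hx
          have hx0 : 0 ≤ x := by positivity
          have hfx : q * x ≤ 8 * (s : ℝ) * k / (n * z) := by
            calc q * x ≤ 2 * s * (4 * k / (n * z)) := by
                  rw [hx]; gcongr
              _ = _ := by ring
          by_cases hx1 : x ≤ 1
          · have hber := one_add_mul_le_pow (show (-2 : ℝ) ≤ -x by linarith) q
            calc y ^ q * (1 - 8 * (s : ℝ) * k / (n * z)) ≤ y ^ q * (1 + q * -x) := by
                  gcongr; linarith
              _ ≤ y ^ q * (1 + -x) ^ q := by gcongr
              _ = (y - 4 * k / n) ^ q := by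
                  rw [← mul_pow]; congr 1; rw [hx]; field_simp; ring
              _ ≤ slack G' lab c ^ q := by
                  apply pow_le_pow_left₀ _ hy'
                  have : 4 * k / n = y * x := by rw [hx]; field_simp
                  rw [this]; nlinarith
          -- Here the permitted relative loss already exceeds 1.
          · push Not at hx1
            have hq1 : (1 : ℝ) ≤ q := by
              have : 1 ≤ q := by omega
              exact_mod_cast this
            refine le_trans ?_ (pow_nonneg (slack_nonneg _ _ _) _)
            exact mul_nonpos_of_nonneg_of_nonpos (by positivity) (by nlinarith)
        · have e0 : 2 * (s - compSize lab c) = 0 := by omega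
          simp only [e0, pow_zero]; linarith
      · have hd : ∀ H : SimpleGraph (Fin n), compDeg H lab c = 0 := by
          intro H
          have : comp lab c = ∅ := Finset.card_eq_zero.1 (compSize_eq_zero hl hroot)
          rw [compDeg, this, Finset.sum_empty]
        have : slack G' lab c = slack G lab c := by rw [slack, slack, hd, hd]
        rw [this]
        have h0 := pow_nonneg (slack_nonneg G lab c) (2 * (s - compSize lab c))
        nlinarith)
  refine le_trans ?_ hmain
  apply mul_le_mul_of_nonneg_left _ (weight_nonneg s G lab)
  linarith

end Weight

/-! ### The growing strategy and its potential -/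

section Positive
variable {n : ℕ}

/-- The pairs leading out of the smallest component. -/
noncomputable def minCut (lab : Fin n → Fin n) : Finset (Fin n × Fin n) :=
  if h : ∃ c, IsMinRoot lab c then cutPairs lab h.choose else ∅

lemma exists_minCut_eq {lab : Fin n → Fin n} (hl : ∀ v, lab (lab v) = lab v)
    (hu : Unfinished lab) : ∃ c, IsMinRoot lab c ∧ minCut lab = cutPairs lab c := by
  have h := exists_isMinRoot hl hu
  exact ⟨h.choose, h.choose_spec, by rw [minCut, dif_pos h]⟩

lemma cutPairs_nonempty {lab : Fin n → Fin n} (hu : Unfinished lab) {c : Fin n} (hc : lab c = c) :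
    (cutPairs lab c).Nonempty := by
  rw [← Finset.card_pos, card_cutPairs]
  exact Nat.mul_pos (compSize_pos hc) (Nat.sub_pos_of_lt (compSize_lt hu c))

lemma minCut_moves {lab : Fin n → Fin n} (hl : ∀ v, lab (lab v) = lab v) (hu : Unfinished lab) :
    (minCut lab).Nonempty ∧ ∀ p ∈ minCut lab, lab p.1 ≠ lab p.2 := by
  obtain ⟨c, hc, heq⟩ := exists_minCut_eq hl hu
  rw [heq]
  refine ⟨cutPairs_nonempty hu hc.1, fun p hp => ?_⟩
  rw [mem_cutPairs] at hp
  rw [hp.1]; exact hp.2.symm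

/-- The pairs leading out of the components with fewer than `s` vertices. -/
noncomputable def smallCut (s : ℕ) (lab : Fin n → Fin n) : Finset (Fin n × Fin n) :=
  Finset.univ.filter fun p => compSize lab (lab p.1) < s ∧ lab p.1 ≠ lab p.2

/-- Maker first draws from the pairs leaving small components, then from those leaving a smallest
component. -/
noncomputable def growPlan (n s : ℕ) : Plan n where
  moves lab _ := if (smallRoots lab s).Nonempty then smallCut s lab else minCut lab
  onFail _ _ _ := ∅

lemma filter_smallCut_eq (s : ℕ) (lab : Fin n → Fin n) {c : Fin n} (hc : c ∈ smallRoots lab s) :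
    (smallCut s lab).filter (fun p => lab p.1 = c) = cutPairs lab c := by
  rw [mem_smallRoots] at hc
  ext p
  rw [Finset.mem_filter, mem_cutPairs, smallCut, Finset.mem_filter]
  constructor
  · rintro ⟨⟨-, -, h1⟩, rfl⟩; exact ⟨rfl, h1.symm⟩
  · rintro ⟨h1, h2⟩
    refine ⟨⟨Finset.mem_univ _, by rw [h1]; exact hc.2, by rw [h1]; exact h2.symm⟩, h1⟩

lemma growPlan_moves (s : ℕ) (lab : Fin n → Fin n) (P : Finset (Fin n))
    (hl : ∀ v, lab (lab v) = lab v) (hu : Unfinished lab) :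
    ((growPlan n s).moves lab P).Nonempty ∧
      ∀ p ∈ (growPlan n s).moves lab P, lab p.1 ≠ lab p.2 := by
  simp only [growPlan]
  split_ifs with h
  · obtain ⟨c, hc⟩ := h
    refine ⟨?_, fun p hp => ?_⟩
    · have h1 := cutPairs_nonempty hu (mem_smallRoots.1 hc).1
      rw [← filter_smallCut_eq s lab hc] at h1
      exact h1.mono (Finset.filter_subset _ _)
    · rw [smallCut, Finset.mem_filter] at hp; exact hp.2.2
  · exact minCut_moves hl hu

lemma card_adj_cutPairs_le_compDeg (G : SimpleGraph (Fin n)) (lab : Fin n → Fin n) (c : Fin n) :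
    ((cutPairs lab c).filter fun p => G.Adj p.1 p.2).card ≤ compDeg G lab c :=
  card_adj_le_sum_deg G _ _ fun p hp => by
    rw [mem_cutPairs] at hp; exact mem_comp.2 hp.1

lemma four_mul_compDeg_lt {G : SimpleGraph (Fin n)} {lab : Fin n → Fin n} {c : Fin n}
    (hc : lab c = c) (h : 0 < slack G lab c) : 4 * compDeg G lab c < n * compSize lab c := by
  have hn : (0 : ℝ) < n := by exact_mod_cast Fin.pos c
  have h1 : (0 : ℝ) < compSize lab c := by exact_mod_cast compSize_pos hc
  rw [slack, lt_max_iff] at h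
  have h2 : (4 * compDeg G lab c / (n * compSize lab c) : ℝ) < 1 := by
    rcases h with h | h
    · exact absurd h (lt_irrefl _)
    · linarith
  rw [div_lt_one (by positivity)] at h2
  exact_mod_cast h2

/-- The draw set splits into the cuts of the small components. Each cut has at least half of `n`
times the size as pairs, and positive slack keeps the blocked ones below a quarter of `n` times the
size. -/
lemma two_mul_card_adj_smallCut_le {s : ℕ} (hs : 4 * s ≤ n) {lab : Fin n → Fin n}
    (hl : ∀ v, lab (lab v) = lab v) (G : SimpleGraph (Fin n))
    (hslack : ∀ c ∈ smallRoots lab s, 0 < slack G lab c) :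
    2 * ((smallCut s lab).filter fun p => G.Adj p.1 p.2).card ≤ (smallCut s lab).card := by
  have hmaps : ∀ p ∈ smallCut s lab, lab p.1 ∈ smallRoots lab s := by
    intro p hp
    rw [smallCut, Finset.mem_filter] at hp
    exact mem_smallRoots.2 ⟨hl _, hp.2.1⟩
  rw [Finset.card_eq_sum_card_fiberwise (s := smallCut s lab) (t := smallRoots lab s)
      (f := fun p : Fin n × Fin n => lab p.1) (fun p hp => hmaps p hp),
    Finset.card_eq_sum_card_fiberwise (f := fun p : Fin n × Fin n => lab p.1) (t := smallRoots lab s)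
      (fun p hp => hmaps p (Finset.mem_filter.1 hp).1), Finset.mul_sum]
  refine Finset.sum_le_sum fun c hc => ?_
  rw [Finset.filter_comm, filter_smallCut_eq s lab hc, card_cutPairs]
  have h1 := card_adj_cutPairs_le_compDeg G lab c
  have h2 := four_mul_compDeg_lt (mem_smallRoots.1 hc).1 (hslack c hc)
  have h3 := (mem_smallRoots.1 hc).2
  have h4 : compSize lab c * n ≤ compSize lab c * (2 * (n - compSize lab c)) :=
    Nat.mul_le_mul_left _ (by omega)
  nlinarith

/-- All components have at least `12 * b` vertices, so the smallest one, having at most half of the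
vertices, has a cut of at least `6 * b * n` pairs: twice what PhantomBreaker can own. -/
lemma two_mul_card_adj_minCut_le {s b : ℕ} (hs : 12 * b ≤ s) {lab : Fin n → Fin n}
    (hl : ∀ v, lab (lab v) = lab v) (hu : Unfinished lab) (G : SimpleGraph (Fin n))
    (hE : edgeCount G ≤ 3 * b * n) (hsmall : ¬ (smallRoots lab s).Nonempty) :
    2 * ((minCut lab).filter fun p => G.Adj p.1 p.2).card ≤ (minCut lab).card := by
  obtain ⟨c, hc, heq⟩ := exists_minCut_eq hl hu
  have h1 := card_adj_cutPairs_le G lab c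
  have h2 := hc.two_mul_le hl hu
  have h3 : s ≤ compSize lab c := by
    by_contra h
    exact hsmall ⟨c, mem_smallRoots.2 ⟨hc.1, not_le.1 h⟩⟩
  rw [heq, card_cutPairs]
  have h4 : s * n ≤ compSize lab c * (2 * (n - compSize lab c)) :=
    Nat.mul_le_mul h3 (by omega)
  nlinarith [Nat.mul_le_mul_right n hs]

/-- The free pairs of one small cut number at least `n / 2`. Among at most `n * n` drawable pairs
this gives the worst component a chance of `1 / (2 * n)` to be hit. -/
lemma half_le_card_cutPairs_sdiff {s : ℕ} (hs : 4 * s ≤ n) {lab : Fin n → Fin n}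
    (G : SimpleGraph (Fin n)) {c : Fin n} (hc : c ∈ smallRoots lab s)
    (hslack : 0 < slack G lab c) :
    n ≤ 2 * ((cutPairs lab c).filter fun p => ¬ G.Adj p.1 p.2).card := by
  have h0 := Finset.card_filter_add_card_filter_not (s := cutPairs lab c)
    (fun p => G.Adj p.1 p.2)
  rw [card_cutPairs] at h0
  have h1 := card_adj_cutPairs_le_compDeg G lab c
  have h2 := four_mul_compDeg_lt (mem_smallRoots.1 hc).1 hslack
  have h3 := (mem_smallRoots.1 hc).2
  have h4 := compSize_pos (mem_smallRoots.1 hc).1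
  have h5 : compSize lab c * (3 * n) ≤ compSize lab c * (4 * (n - compSize lab c)) :=
    Nat.mul_le_mul_left _ (by omega)
  nlinarith

/-- The value function of the growing strategy. -/
noncomputable def growVal (n s : ℕ) (A : ℝ) (lab : Fin n → Fin n) (_ : Finset (Fin n))
    (G : SimpleGraph (Fin n)) (t : ℕ) : ℝ :=
  -- The weight is discounted by the number of components; the second term bounds the risk of
  -- running out of `3 * n` attempts; the third is an allowance, per remaining attempt, for
  -- positions whose least slack is `O(1 / n)`.
  max 0 (weight s G lab * Real.exp (-((1 + 4 * A ^ 2) * (roots lab).card / n)) -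
    4 ^ (roots lab).card * (8 / 5) ^ t * (5 / 8) ^ (3 * n) -
    4 * A ^ 2 / n ^ 2 * ((3 * n - t : ℕ) : ℝ))

lemma one_le_mul_of_three_mul_le {t : ℕ} (N : ℕ) (h : 3 * n ≤ t) :
    (1 : ℝ) ≤ 4 ^ N * (8 / 5) ^ t * (5 / 8) ^ (3 * n) := by
  have h1 : (1 : ℝ) ≤ 4 ^ N := one_le_pow₀ (by norm_num)
  have h2 : (1 : ℝ) ≤ (8 / 5) ^ t * (5 / 8) ^ (3 * n) := by
    calc (1 : ℝ) = (8 / 5) ^ (3 * n) * (5 / 8) ^ (3 * n) := by rw [← mul_pow]; norm_num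
      _ ≤ _ := by gcongr; norm_num
  rw [mul_assoc]
  nlinarith

lemma growVal_le_one (n s : ℕ) (A : ℝ) (lab P G) (t : ℕ) : growVal n s A lab P G t ≤ 1 := by
  refine max_le zero_le_one ?_
  have h1 := weight_le_one s G lab
  have h2 : Real.exp (-((1 + 4 * A ^ 2) * (roots lab).card / n)) ≤ 1 := by
    rw [Real.exp_le_one_iff, neg_nonpos]; positivity
  have h3 : weight s G lab * Real.exp (-((1 + 4 * A ^ 2) * (roots lab).card / n)) ≤ 1 :=
    mul_le_one₀ h1 (Real.exp_pos _).le h2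
  have h4 : (0 : ℝ) ≤ 4 ^ (roots lab).card * (8 / 5) ^ t * (5 / 8) ^ (3 * n) := by positivity
  have h5 : (0 : ℝ) ≤ 4 * A ^ 2 / n ^ 2 * ((3 * n - t : ℕ) : ℝ) := by positivity
  linarith

lemma growVal_nonpos (n s : ℕ) (A : ℝ) (lab P G) {t : ℕ} (ht : 3 * n ≤ t) :
    growVal n s A lab P G t ≤ 0 := by
  refine max_le le_rfl ?_
  have h1 := weight_le_one s G lab
  have h2 : Real.exp (-((1 + 4 * A ^ 2) * (roots lab).card / n)) ≤ 1 := by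
    rw [Real.exp_le_one_iff, neg_nonpos]; positivity
  have h3 : weight s G lab * Real.exp (-((1 + 4 * A ^ 2) * (roots lab).card / n)) ≤ 1 :=
    mul_le_one₀ h1 (Real.exp_pos _).le h2
  have h4 := one_le_mul_of_three_mul_le (roots lab).card ht
  have h5 : (0 : ℝ) ≤ 4 * A ^ 2 / n ^ 2 * ((3 * n - t : ℕ) : ℝ) := by positivity
  linarith

/-- Here `Y` is the inverse of the least slack, `m` the number of drawable pairs, `F` the blocked
ones and `q` the free ones at the worst component. The two gains add up to a relative `(4 * A ^ 2 +
Y ^ 2) / (2 * N)`, which by AM-GM is at least twice the loss `u = A * Y / N`; and `(1 - u) * (1 + 2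
* u) ≥ 1` as long as `u ≤ 1 / 2`. -/
lemma growth_step {A Y N q F m : ℝ} (hA : 0 ≤ A) (hN : 0 < N) (hu : A * Y / N ≤ 1 / 2)
    (hm : 0 ≤ m) (hF : 2 * F ≤ m) (hq : m ≤ 2 * N * q) (hY : 1 ≤ Y) :
    m ≤ (1 - A * Y / N) * (m + (m - F) * ((1 + 4 * A ^ 2) / N) + q * (Y ^ 2 - 1)) := by
  have hKN : 0 ≤ (1 + 4 * A ^ 2) / N := by positivity
  have h1 : m / 2 * ((1 + 4 * A ^ 2) / N) ≤ (m - F) * ((1 + 4 * A ^ 2) / N) :=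
    mul_le_mul_of_nonneg_right (by linarith) hKN
  have hq' : m / (2 * N) ≤ q := by rw [div_le_iff₀ (by positivity)]; linarith
  have h2 : m / (2 * N) * (Y ^ 2 - 1) ≤ q * (Y ^ 2 - 1) :=
    mul_le_mul_of_nonneg_right hq' (by nlinarith)
  set u := A * Y / N with hu'
  have hu0 : 0 ≤ u := by positivity
  have hv : 2 * u ≤ (4 * A ^ 2 + Y ^ 2) / (2 * N) := by
    rw [hu', ← mul_div_assoc, div_le_div_iff₀ hN (by positivity)]
    have : 4 * A * Y ≤ 4 * A ^ 2 + Y ^ 2 := by nlinarith [sq_nonneg (2 * A - Y)]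
    nlinarith
  have h3 : m * (1 + (4 * A ^ 2 + Y ^ 2) / (2 * N)) ≤
      m + (m - F) * ((1 + 4 * A ^ 2) / N) + q * (Y ^ 2 - 1) := by
    have : m * (1 + (4 * A ^ 2 + Y ^ 2) / (2 * N)) =
        m + m / 2 * ((1 + 4 * A ^ 2) / N) + m / (2 * N) * (Y ^ 2 - 1) := by
      field_simp; ring
    linarith
  calc m ≤ (1 - u) * (m * (1 + (4 * A ^ 2 + Y ^ 2) / (2 * N))) := by
        set v := (4 * A ^ 2 + Y ^ 2) / (2 * N)
        have : 1 ≤ (1 - u) * (1 + v) := by nlinarith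
        nlinarith
    _ ≤ _ := mul_le_mul_of_nonneg_left h3 (by linarith)

end Positive

/-! ### The drift of the growing strategy -/

section PositiveDrift
variable {n : ℕ}

lemma weight_eq_one {s : ℕ} {lab : Fin n → Fin n} (hl : ∀ v, lab (lab v) = lab v)
    (G : SimpleGraph (Fin n)) (h : ¬ (smallRoots lab s).Nonempty) : weight s G lab = 1 := by
  refine Finset.prod_eq_one fun c _ => ?_
  by_cases hc : lab c = c
  · have : s ≤ compSize lab c := by
      by_contra h'
      exact h ⟨c, mem_smallRoots.2 ⟨hc, not_le.1 h'⟩⟩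
    rw [Nat.sub_eq_zero_of_le this, mul_zero, pow_zero]
  · have : comp lab c = ∅ := Finset.card_eq_zero.1 (compSize_eq_zero hl hc)
    rw [slack, compDeg, this]; simp

lemma IsMerge.smallRoots_empty {lab lab' : Fin n → Fin n} {c₁ c₂ : Fin n}
    (h : IsMerge lab lab' c₁ c₂) {s : ℕ} (hs : ¬ (smallRoots lab s).Nonempty) :
    ¬ (smallRoots lab' s).Nonempty := fun h' =>
  hs ((h'.mono (h.smallRoots_subset s)).mono (Finset.erase_subset _ _))

lemma weight_le_sq {s : ℕ} {lab : Fin n → Fin n} (G : SimpleGraph (Fin n)) {c : Fin n}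
    (hc : c ∈ smallRoots lab s) : weight s G lab ≤ slack G lab c ^ 2 := by
  have h1 : weight s G lab ≤ slack G lab c ^ (2 * (s - compSize lab c)) := by
    rw [weight, ← Finset.mul_prod_erase _ _ (Finset.mem_univ c)]
    refine mul_le_of_le_one_right (pow_nonneg (slack_nonneg _ _ _) _)
      (Finset.prod_le_one (fun d _ => pow_nonneg (slack_nonneg G lab d) _)
        fun d _ => pow_le_one₀ (slack_nonneg G lab d) (slack_le_one G lab d))
  refine h1.trans (pow_le_pow_of_le_one (slack_nonneg _ _ _) (slack_le_one _ _ _) ?_)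
  have := (mem_smallRoots.1 hc).2
  omega

lemma IsMerge.le_slack {lab lab' : Fin n → Fin n} {c₁ c₂ : Fin n}
    (h : IsMerge lab lab' c₁ c₂) (G : SimpleGraph (Fin n)) {s : ℕ} {z : ℝ}
    (hz : ∀ c ∈ smallRoots lab s, z ≤ slack G lab c) :
    ∀ c ∈ smallRoots lab' s, z ≤ slack G lab' c := by
  intro c hc
  by_cases h1 : c = c₁
  · subst h1
    rw [mem_smallRoots, h.compSize_left] at hc
    refine le_trans (le_min (hz c ?_) (hz c₂ ?_)) (h.min_slack_le G)
    · exact mem_smallRoots.2 ⟨h.root₁, by omega⟩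
    · exact mem_smallRoots.2 ⟨h.root₂, by omega⟩
  · have h2 := h.smallRoots_subset s hc
    rw [Finset.mem_erase] at h2
    have h3 := hz c h2.2
    rwa [slack, h.compSize_other h1 h2.1, h.compDeg_other h1 h2.1]

lemma card_smallCut_le (s : ℕ) (lab : Fin n → Fin n) : (smallCut s lab).card ≤ n * n := by
  simpa using Finset.card_le_univ (smallCut s lab)

/-- Every success gains `1 + K / n` from the discount, a success at the component with least slack
`z` gains `z⁻¹ ^ 2` in addition, and all outcomes suffer the same loss `1 - u`; `growth_step`
balances them. -/
lemma sum_weight_smallCut {s b : ℕ} (hs : 4 * s ≤ n) {lab : Fin n → Fin n}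
    (hl : ∀ v, lab (lab v) = lab v) (G : SimpleGraph (Fin n))
    (hne : (smallRoots lab s).Nonempty) (hpos : 0 < weight s G lab)
    (G' : Fin n × Fin n → SimpleGraph (Fin n))
    (hG' : ∀ p, G ≤ G' p ∧ edgeCount (G' p) ≤ edgeCount G + b) {A K : ℝ}
    (hA : A = 16 * b * s) (hK : K = 1 + 4 * A ^ 2) :
    (smallCut s lab).card * (weight s G lab * Real.exp (-(K * (roots lab).card / n)) -
      4 * A ^ 2 / n ^ 2) ≤ ∑ p ∈ smallCut s lab,
        if G.Adj p.1 p.2 then weight s (G' p) lab * Real.exp (-(K * (roots lab).card / n))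
        else weight s (G' p) (mergeAlong lab s(p.1, p.2)) *
          Real.exp (-(K * (roots (mergeAlong lab s(p.1, p.2))).card / n)) := by
  set Q := smallCut s lab with hQ
  set W := weight s G lab with hW
  set E := Real.exp (-(K * (roots lab).card / n)) with hE
  have hE0 : 0 < E := Real.exp_pos _
  have hA0 : 0 ≤ A := by rw [hA]; positivity
  have hK1 : 0 ≤ K := by rw [hK]; positivity
  have hE1 : E ≤ 1 := by
    rw [hE, Real.exp_le_one_iff, neg_nonpos]; positivity
  obtain ⟨c, hc, hmin⟩ := Finset.exists_min_image (smallRoots lab s) (slack G lab) hne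
  have hn : (0 : ℝ) < n := by exact_mod_cast Fin.pos c
  set z := slack G lab c with hz
  have hWz : W ≤ z ^ 2 := weight_le_sq G hc
  have hz0 : 0 < z := by
    rcases (slack_nonneg G lab c).lt_or_eq with h | h
    · exact h
    · rw [hz, ← h] at hWz; norm_num at hWz; exact absurd hpos (not_lt.2 hWz)
  have hz1 : z ≤ 1 := slack_le_one _ _ _
  have hY1 : 1 ≤ z⁻¹ := (one_le_inv₀ hz0).2 hz1
  by_cases hu : A * z⁻¹ / n ≤ 1 / 2
  swap
  -- The least slack is below `2 * A / n`, so the weight, at most its square, is covered by the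
  -- allowance.
  · push Not at hu
    have h1 : W * E - 4 * A ^ 2 / n ^ 2 ≤ 0 := by
      have h2 : z ≤ 2 * A / n := by
        rw [le_div_iff₀ hn]
        rw [← div_eq_mul_inv, div_div, lt_div_iff₀ (by positivity)] at hu
        linarith
      have h3 : z ^ 2 ≤ (2 * A / n) ^ 2 := by gcongr
      have h4 : (2 * A / n) ^ 2 = 4 * A ^ 2 / n ^ 2 := by rw [div_pow]; ring
      nlinarith
    refine le_trans (mul_nonpos_of_nonneg_of_nonpos (Nat.cast_nonneg _) h1)
      (Finset.sum_nonneg fun p _ => ?_)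
    split_ifs
    · exact mul_nonneg (weight_nonneg _ _ _) hE0.le
    · exact mul_nonneg (weight_nonneg _ _ _) (Real.exp_pos _).le
  have hAu : ∀ H : SimpleGraph (Fin n), ∀ l : Fin n → Fin n,
      16 * (b : ℝ) * s / (n * z) = A * z⁻¹ / n := by
    intro _ _; rw [hA]; field_simp
  set u := A * z⁻¹ / n with hu'
  set F := (Q.filter fun p => G.Adj p.1 p.2).card with hF
  set q := ((cutPairs lab c).filter fun p => ¬ G.Adj p.1 p.2).card with hq
  have hF2 : 2 * F ≤ Q.card := two_mul_card_adj_smallCut_le hs hl G fun d hd =>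
    hz0.trans_le (hmin d hd)
  have hq2 : n ≤ 2 * q := half_le_card_cutPairs_sdiff hs G hc hz0
  have hQn : Q.card ≤ n * n := card_smallCut_le s lab
  -- A lower bound for the gain of each draw: the cross term of the two gains is dropped, so that
  -- the sum over the draws is linear in the counts.
  let θ : Fin n × Fin n → ℝ := fun p => 1 + (if G.Adj p.1 p.2 then 0 else K / n) +
    if lab p.1 = c ∧ ¬ G.Adj p.1 p.2 then (z⁻¹ ^ 2 - 1) else 0
  have hterm : ∀ p ∈ Q, W * E * (1 - u) * θ p ≤
      if G.Adj p.1 p.2 then weight s (G' p) lab * E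
        else weight s (G' p) (mergeAlong lab s(p.1, p.2)) *
          Real.exp (-(K * (roots (mergeAlong lab s(p.1, p.2))).card / n)) := by
    intro p hp
    rw [hQ, smallCut, Finset.mem_filter] at hp
    by_cases hadj : G.Adj p.1 p.2
    · have h1 := weight_mul_le hl (hG' p).1 (hG' p).2 s hz0 hmin
      rw [hAu G lab] at h1
      simp only [θ, hadj, if_true, not_true_eq_false, and_false, if_false, add_zero, mul_one]
      calc W * E * (1 - u) = W * (1 - u) * E := by ring
        _ ≤ _ := mul_le_mul_of_nonneg_right h1 hE0.le
    · obtain ⟨c₁, c₂, hM, hcc⟩ := exists_isMerge hl hp.2.2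
      set lab' := mergeAlong lab s(p.1, p.2) with hlab'
      have hl' : ∀ v, lab' (lab' v) = lab' v := mergeAlong_idem lab hl _
      have h1 := weight_mul_le hl' (hG' p).1 (hG' p).2 s hz0 (hM.le_slack G hmin)
      rw [hAu G lab] at h1
      have hcard := hM.card_roots
      have hexp : E * (1 + K / n) ≤ Real.exp (-(K * (roots lab').card / n)) := by
        have : -(K * (roots lab').card / n : ℝ) = -(K * (roots lab).card / n) + K / n := by
          rw [← hcard]; push_cast; ring
        rw [this, Real.exp_add]
        gcongr
        linarith [Real.add_one_le_exp (K / n)]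
      have hsm : compSize lab (lab p.1) < s := hp.2.1
      have hw := hM.weight_le G s (lab p.1) (by
        rcases hcc with h | h
        · exact Or.inl h.1.symm
        · exact Or.inr h.2.symm) hsm
      have hρ : W * (1 + if lab p.1 = c then z⁻¹ ^ 2 - 1 else 0) ≤ weight s G lab' := by
        split_ifs with hpc
        · rw [hpc] at hw
          have : W * z⁻¹ ^ 2 ≤ weight s G lab' := by
            rw [inv_pow, ← div_eq_mul_inv, div_le_iff₀ (by positivity), mul_comm]
            exact hw
          linarith
        · have h2 : slack G lab (lab p.1) ^ 2 ≤ 1 :=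
            pow_le_one₀ (slack_nonneg _ _ _) (slack_le_one _ _ _)
          have h3 := weight_nonneg s G lab'
          nlinarith
      simp only [θ, hadj, if_false, not_false_eq_true, and_true]
      set ρ : ℝ := if lab p.1 = c then z⁻¹ ^ 2 - 1 else 0 with hρ'
      have hρ0 : 0 ≤ ρ := by
        rw [hρ']; split_ifs
        · nlinarith
        · exact le_rfl
      have hkn : 0 ≤ K / n := by positivity
      have hu1 : 0 ≤ 1 - u := by linarith
      calc W * E * (1 - u) * (1 + K / n + ρ) ≤ W * E * (1 - u) * ((1 + K / n) * (1 + ρ)) := by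
            gcongr; nlinarith [mul_nonneg hkn hρ0]
        _ = W * (1 + ρ) * (1 - u) * (E * (1 + K / n)) := by ring
        _ ≤ weight s G lab' * (1 - u) * (E * (1 + K / n)) := by gcongr
        _ ≤ weight s (G' p) lab' * Real.exp (-(K * (roots lab').card / n)) := by
            gcongr
            exact weight_nonneg _ _ _
  refine le_trans ?_ (Finset.sum_le_sum hterm)
  rw [← Finset.mul_sum]
  have hθ : ∑ p ∈ Q, θ p = Q.card + ((Q.card : ℝ) - F) * (K / n) + q * (z⁻¹ ^ 2 - 1) := by
    simp only [θ, Finset.sum_add_distrib]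
    congr 1
    · congr 1
      · simp
      · have h0 := Finset.card_filter_add_card_filter_not (s := Q) (fun p => G.Adj p.1 p.2)
        have h1 : ((Q.card : ℝ) - F) = (Q.filter fun p => ¬ G.Adj p.1 p.2).card := by
          rw [← h0, hF]; push_cast; ring
        rw [h1, ← nsmul_eq_mul, ← Finset.sum_const, Finset.sum_filter]
        refine Finset.sum_congr rfl fun p _ => ?_
        by_cases h : G.Adj p.1 p.2 <;> simp [h]
    · rw [hq, ← filter_smallCut_eq s lab hc, ← nsmul_eq_mul, ← Finset.sum_const,
        Finset.filter_filter, Finset.sum_filter]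
  have hgrow := growth_step hA0 hn hu (Nat.cast_nonneg Q.card)
    (show 2 * (F : ℝ) ≤ Q.card by exact_mod_cast hF2)
    (show (Q.card : ℝ) ≤ 2 * n * q by
      have : Q.card ≤ 2 * n * q := by nlinarith
      exact_mod_cast this) hY1
  rw [← hK, ← hθ] at hgrow
  calc (Q.card : ℝ) * (W * E - 4 * A ^ 2 / n ^ 2) ≤ Q.card * (W * E) := by
        gcongr
        have : 0 ≤ 4 * A ^ 2 / (n : ℝ) ^ 2 := by positivity
        linarith
    _ = W * E * Q.card := by ring
    _ ≤ W * E * ((1 - u) * ∑ p ∈ Q, θ p) := by gcongr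
    _ = _ := by ring

/-- Truncation at 0 reduces to positive values, where time is below `3 * n` and all slacks of small
components are positive. The three terms are then treated separately. -/
lemma growPlan_drift {a b s : ℕ} (ha : 0 < a) (hs : 12 * b ≤ s) (hn : 4 * s ≤ n) :
    Drift a b (growPlan n s) (growVal n s (16 * b * s)) := by
  intro lab P G t hl hu hE G' hG'
  set A : ℝ := 16 * b * s with hA
  set K : ℝ := 1 + 4 * A ^ 2 with hK
  have hn0 : 0 < n := by obtain ⟨u, _⟩ := hu; exact Fin.pos u
  have hnR : (0 : ℝ) < n := by exact_mod_cast hn0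
  set Q := (growPlan n s).moves lab P with hQ
  have hnonneg : ∀ l P' H t', 0 ≤ growVal n s A l P' H t' := fun _ _ _ _ => le_max_left _ _
  by_cases hv : growVal n s A lab P G t ≤ 0
  · refine (mul_nonpos_of_nonneg_of_nonpos (Nat.cast_nonneg _) hv).trans
      (Finset.sum_nonneg fun p _ => ?_)
    split_ifs <;> exact hnonneg _ _ _ _
  push Not at hv
  have ht : t < 3 * n := by
    by_contra h
    exact absurd (growVal_nonpos n s A lab P G (not_lt.1 h)) (not_le.2 hv)
  have hEG : edgeCount G ≤ 3 * b * n := by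
    have h1 : edgeCount G ≤ a * edgeCount G := Nat.le_mul_of_pos_left _ ha
    nlinarith
  set N := (roots lab).card with hN
  set Z : ℝ := 4 ^ N * (8 / 5) ^ t * (5 / 8) ^ (3 * n) with hZ
  have hZ0 : 0 ≤ Z := by positivity
  set err : ℝ := 4 * A ^ 2 / n ^ 2 with herr
  have herr0 : 0 ≤ err := by positivity
  set W := weight s G lab with hW
  set E := Real.exp (-(K * N / n)) with hEdef
  have hveq : growVal n s A lab P G t = W * E - Z - err * ((3 * n - t : ℕ) : ℝ) := by
    rcases max_choice (0 : ℝ) (W * E - Z - err * ((3 * n - t : ℕ) : ℝ)) with h | h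
    · rw [growVal, h] at hv; exact absurd hv (lt_irrefl _)
    · rw [growVal, h]
  have hsub : ((3 * n - t : ℕ) : ℝ) = ((3 * n - (t + 1) : ℕ) : ℝ) + 1 := by
    have : 3 * n - t = (3 * n - (t + 1)) + 1 := by omega
    rw [this]; push_cast; ring
  have hWpos : 0 < W := by
    have h0 : 0 ≤ err * ((3 * n - t : ℕ) : ℝ) := by positivity
    have h1 : 0 < W * E := by linarith
    exact pos_of_mul_pos_left h1 (Real.exp_pos _).le
  have hne : ∀ p ∈ Q, lab p.1 ≠ lab p.2 := (growPlan_moves s lab P hl hu).2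
  set F := (Q.filter fun p => G.Adj p.1 p.2).card with hF
  have hF2 : 2 * F ≤ Q.card := by
    rw [hF, hQ]
    simp only [growPlan]
    split_ifs with h
    · refine two_mul_card_adj_smallCut_le hn hl G fun c hc => ?_
      rcases (slack_nonneg G lab c).lt_or_eq with h1 | h1
      · exact h1
      · have := weight_le_sq G hc
        rw [← h1] at this; norm_num at this
        exact absurd hWpos (not_lt.2 this)
    · exact two_mul_card_adj_minCut_le hs hl hu G hEG h
  have hsumW : (Q.card : ℝ) * (W * E - err) ≤ ∑ p ∈ Q,
        if G.Adj p.1 p.2 then weight s (G' p) lab * E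
        else weight s (G' p) (mergeAlong lab s(p.1, p.2)) *
          Real.exp (-(K * (roots (mergeAlong lab s(p.1, p.2))).card / n)) := by
    by_cases h : (smallRoots lab s).Nonempty
    · have hQ' : Q = smallCut s lab := by rw [hQ]; simp only [growPlan, if_pos h]
      rw [hQ']
      exact sum_weight_smallCut hn hl G h hWpos G' (fun p => ⟨(hG' p).1, (hG' p).2.1⟩) hA hK
    · rw [← nsmul_eq_mul, ← Finset.sum_const]
      refine Finset.sum_le_sum fun p hp => ?_
      have hW1 : W = 1 := weight_eq_one hl G h
      split_ifs with hadj
      · rw [hW1, weight_eq_one hl _ h]; linarith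
      · obtain ⟨c₁, c₂, hM, -⟩ := exists_isMerge hl (hne p hp)
        rw [hW1, weight_eq_one (mergeAlong_idem lab hl _) _ (hM.smallRoots_empty h)]
        have hcard := hM.card_roots
        have : E ≤ Real.exp (-(K * (roots (mergeAlong lab s(p.1, p.2))).card / n)) := by
          rw [hEdef, Real.exp_le_exp, neg_le_neg_iff]
          have : ((roots (mergeAlong lab s(p.1, p.2))).card : ℝ) ≤ N := by
            rw [hN, ← hcard]; push_cast; linarith
          gcongr
        linarith
  -- A failure multiplies this term by `8 / 5` and a success by `8 / 5 * (1 / 4) = 2 / 5`; with at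
  -- most half of the pairs blocked the mean factor is at most 1.
  have hsumZ : ∑ p ∈ Q, (if G.Adj p.1 p.2 then Z * (8 / 5) else Z * (2 / 5)) ≤ Q.card * Z := by
    rw [Finset.sum_ite, Finset.sum_const, Finset.sum_const, nsmul_eq_mul, nsmul_eq_mul]
    have h0 := Finset.card_filter_add_card_filter_not (s := Q) (fun p => G.Adj p.1 p.2)
    have h1 : ((Q.filter fun p => ¬ G.Adj p.1 p.2).card : ℝ) = Q.card - F := by
      rw [← h0, hF]; push_cast; ring
    have h2 : 2 * (F : ℝ) ≤ Q.card := by exact_mod_cast hF2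
    rw [h1]
    nlinarith
  have hterm : ∀ p ∈ Q, ((if G.Adj p.1 p.2 then weight s (G' p) lab * E
        else weight s (G' p) (mergeAlong lab s(p.1, p.2)) *
          Real.exp (-(K * (roots (mergeAlong lab s(p.1, p.2))).card / n))) -
        (if G.Adj p.1 p.2 then Z * (8 / 5) else Z * (2 / 5))) -
        err * ((3 * n - (t + 1) : ℕ) : ℝ) ≤
      if G.Adj p.1 p.2 then growVal n s A lab ((growPlan n s).onFail lab P s(p.1, p.2))
        (G' p) (t + 1) else growVal n s A (mergeAlong lab s(p.1, p.2)) P (G' p) (t + 1) := by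
    intro p hp
    split_ifs with hadj
    · refine le_trans (le_of_eq ?_) (le_max_right _ _)
      simp only [hEdef, hK, hZ, herr, hN, pow_succ]
      ring
    · refine le_trans (le_of_eq ?_) (le_max_right _ _)
      obtain ⟨c₁, c₂, hM, -⟩ := exists_isMerge hl (hne p hp)
      have hcard := hM.card_roots
      simp only [hK, hZ, herr, hN, ← hcard, pow_succ]
      ring
  refine le_trans ?_ (Finset.sum_le_sum hterm)
  rw [Finset.sum_sub_distrib, Finset.sum_sub_distrib, Finset.sum_const, nsmul_eq_mul, hveq, hsub]
  linarith

end PositiveDrift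

/-! ### The initial value for an arbitrary bias -/

section PositiveStart
variable {n : ℕ}

lemma card_roots_id : (roots (id : Fin n → Fin n)).card = n := by
  simp [roots]

lemma deg_bot (v : Fin n) : deg (⊥ : SimpleGraph (Fin n)) v = 0 := by simp [deg]

lemma weight_bot (s : ℕ) (lab : Fin n → Fin n) : weight s ⊥ lab = 1 := by
  refine Finset.prod_eq_one fun c _ => ?_
  have : compDeg ⊥ lab c = 0 := Finset.sum_eq_zero fun v _ => deg_bot v
  rw [slack, this]; simp

/-- With `n` components and no edges the weight is 1, the discount no longer depends on `n`, and `4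
* (5 / 8) ^ 3 = 125 / 128` makes the time correction decay exponentially. -/
lemma le_growVal_start (s : ℕ) (A : ℝ) (hn : 0 < n) :
    Real.exp (-(1 + 4 * A ^ 2)) - (125 / 128) ^ n - 12 * A ^ 2 / n ≤
      growVal n s A id ∅ ⊥ 0 := by
  have hnR : (0 : ℝ) < n := by exact_mod_cast hn
  refine le_trans (le_of_eq ?_) (le_max_right _ _)
  rw [weight_bot, card_roots_id, one_mul, pow_zero, mul_one, Nat.sub_zero, pow_mul, ← mul_pow]
  congr 1
  · congr 1
    · congr 1; field_simp
    · congr 1; norm_num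
  · push_cast; field_simp; ring

/-- For every bias Maker wins with probability bounded away from zero. -/
theorem exists_pos_winProb (a b : ℕ) (ha : 0 < a) (hb : 0 < b) :
    ∃ c : ℝ, 0 < c ∧ ∀ᶠ n : ℕ in atTop, ∃ μ : PMF (MakerStrategy n),
      ∀ ν : PMF (BreakerStrategy n b), c ≤ winProb a (spanningTrees n) μ ν := by
  set s := 12 * b with hs
  set A : ℝ := 16 * b * s with hA
  have hlim : Tendsto (fun n : ℕ => Real.exp (-(1 + 4 * A ^ 2)) - (125 / 128 : ℝ) ^ n -
      12 * A ^ 2 / n) atTop (𝓝 (Real.exp (-(1 + 4 * A ^ 2)) - 0 - 0)) :=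
    (tendsto_const_nhds.sub (tendsto_pow_atTop_nhds_zero_of_lt_one (by norm_num)
      (by norm_num))).sub (tendsto_const_div_atTop_nhds_zero_nat _)
  have hE : 0 < Real.exp (-(1 + 4 * A ^ 2)) := Real.exp_pos _
  refine ⟨Real.exp (-(1 + 4 * A ^ 2)) / 2, by positivity, ?_⟩
  filter_upwards [hlim.eventually (lt_mem_nhds (show Real.exp (-(1 + 4 * A ^ 2)) / 2 <
    Real.exp (-(1 + 4 * A ^ 2)) - 0 - 0 by linarith)), eventually_ge_atTop (4 * s + 2)]
    with n hn1 hn2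
  obtain ⟨μ, hμ⟩ := exists_mixed (n := n) (b := b) (by omega) ha (growPlan n s) (growVal n s A)
    (3 * n) (growPlan_moves s) (fun lab P G t _ _ => growVal_le_one n s A lab P G t)
    (fun lab P G t ht _ _ => growVal_nonpos n s A lab P G ht)
    (growPlan_drift ha le_rfl (by omega))
  exact ⟨μ, fun ν => (hn1.le.trans (le_growVal_start s A (by omega))).trans (hμ ν)⟩

end PositiveStart

/-! ## A strategy that wins almost surely when the bias is at most twice Maker's -/

section PairPlan
variable {n : ℕ}

/-- The isolated vertices that were involved in a failed attempt. -/
noncomputable def pendSet (lab : Fin n → Fin n) (P : Finset (Fin n)) : Finset (Fin n) :=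
  smallRoots lab 2 ∩ P

/-- The other isolated vertices. -/
noncomputable def liveSet (lab : Fin n → Fin n) (P : Finset (Fin n)) : Finset (Fin n) :=
  smallRoots lab 2 \ P

/-- As long as at least `E` components with fewer than `k` vertices exist, Maker joins random pairs
of them; afterwards she joins a smallest component to a random vertex. -/
noncomputable def levelMoves (E k : ℕ) (lab : Fin n → Fin n) : Finset (Fin n × Fin n) :=
  if E ≤ (smallRoots lab k).card then (smallRoots lab k).offDiag else minCut lab

/-- Maker removes first the isolated vertices, then the components with fewer than four vertices,
and then joins all components. While many isolated vertices are left, the endpoints of a failed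
attempt are served at once. -/
noncomputable def pairPlan (n E : ℕ) : Plan n where
  moves lab P :=
    if h : (pendSet lab P).Nonempty then cutPairs lab h.choose
    else if (smallRoots lab 2).Nonempty then levelMoves E 2 lab
    else if (smallRoots lab 4).Nonempty then levelMoves E 4 lab
    else levelMoves E (n + 1) lab
  onFail lab P e :=
    if ¬ (pendSet lab P).Nonempty ∧ E ≤ (smallRoots lab 2).card then e.toFinset else P

lemma levelMoves_spec {E : ℕ} (hE : 2 ≤ E) (k : ℕ) {lab : Fin n → Fin n}
    (hl : ∀ v, lab (lab v) = lab v) (hu : Unfinished lab) :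
    (levelMoves E k lab).Nonempty ∧ ∀ p ∈ levelMoves E k lab, lab p.1 ≠ lab p.2 := by
  rw [levelMoves]
  split_ifs with h
  · refine ⟨?_, fun p hp => ?_⟩
    · obtain ⟨c, hc, d, hd, hne⟩ := Finset.one_lt_card.1 (by omega : 1 < (smallRoots lab k).card)
      exact ⟨(c, d), Finset.mem_offDiag.2 ⟨hc, hd, hne⟩⟩
    · rw [Finset.mem_offDiag] at hp
      rw [(mem_smallRoots.1 hp.1).1, (mem_smallRoots.1 hp.2.1).1]
      exact hp.2.2
  · exact minCut_moves hl hu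

lemma pairPlan_moves {E : ℕ} (hE : 2 ≤ E) (lab : Fin n → Fin n) (P : Finset (Fin n))
    (hl : ∀ v, lab (lab v) = lab v) (hu : Unfinished lab) :
    ((pairPlan n E).moves lab P).Nonempty ∧
      ∀ p ∈ (pairPlan n E).moves lab P, lab p.1 ≠ lab p.2 := by
  simp only [pairPlan]
  split_ifs with h
  · have h1 := mem_smallRoots.1 (Finset.mem_inter.1 h.choose_spec).1
    refine ⟨cutPairs_nonempty hu h1.1, fun p hp => ?_⟩
    rw [mem_cutPairs] at hp
    rw [hp.1]; exact hp.2.symm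
  all_goals exact levelMoves_spec hE _ hl hu

lemma mul_card_roots_le {k : ℕ} {lab : Fin n → Fin n} (hl : ∀ v, lab (lab v) = lab v)
    (h : ¬ (smallRoots lab k).Nonempty) : k * (roots lab).card ≤ n := by
  calc k * (roots lab).card = ∑ c ∈ roots lab, k := by
        rw [Finset.sum_const, smul_eq_mul, mul_comm]
    _ ≤ ∑ c ∈ roots lab, compSize lab c := Finset.sum_le_sum fun c hc => by
        by_contra h'
        exact h ⟨c, mem_smallRoots.2 ⟨mem_roots.1 hc, not_le.1 h'⟩⟩
    _ = n := sum_roots_compSize hl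

lemma two_mul_card_roots_le {lab : Fin n → Fin n} (hl : ∀ v, lab (lab v) = lab v) :
    2 * (roots lab).card ≤ n + (smallRoots lab 2).card := by
  have h1 : smallRoots lab 2 = (roots lab).filter fun c => compSize lab c < 2 := by
    ext c; simp [smallRoots, roots]
  rw [h1, Finset.card_filter]
  calc 2 * (roots lab).card = ∑ c ∈ roots lab, 2 := by
        rw [Finset.sum_const, smul_eq_mul, mul_comm]
    _ ≤ ∑ c ∈ roots lab, (compSize lab c + if compSize lab c < 2 then 1 else 0) :=
        Finset.sum_le_sum fun c hc => by
          have := compSize_pos (mem_roots.1 hc)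
          split_ifs <;> omega
    _ = _ := by rw [Finset.sum_add_distrib, sum_roots_compSize hl]

lemma smallRoots_subset_roots (lab : Fin n → Fin n) (k : ℕ) : smallRoots lab k ⊆ roots lab :=
  fun _ hc => mem_roots.2 (mem_smallRoots.1 hc).1

lemma smallRoots_succ_eq (lab : Fin n → Fin n) : smallRoots lab (n + 1) = roots lab := by
  ext c
  rw [mem_smallRoots, mem_roots]
  exact ⟨fun h => h.1, fun h => ⟨h, Nat.lt_succ_of_le (compSize_le _ _)⟩⟩

lemma IsMinRoot.mem_smallRoots {lab : Fin n → Fin n} {c : Fin n} (h : IsMinRoot lab c) {k : ℕ}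
    (hk : (smallRoots lab k).Nonempty) : c ∈ smallRoots lab k := by
  obtain ⟨d, hd⟩ := hk
  rw [MakerPhantomBreaker.mem_smallRoots] at hd ⊢
  exact ⟨h.1, (h.2 d hd.1).trans_lt hd.2⟩

/-- The number of attempts plus the weighted number of components still to be removed. -/
noncomputable def levelNum (θ g E : ℝ) (m t : ℕ) : ℝ := t + θ * m + g * m + 16 * min (m : ℝ) E

/-- A supermartingale criterion: a rise `u` on blocked pairs is compensated by a fall `v` on free
ones. -/
lemma sum_ite_le_card_mul {α : Type*} (Q : Finset α) (adj : α → Prop) (x y : α → ℝ) {z u v : ℝ}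
    (hx : ∀ p ∈ Q, adj p → x p ≤ z + u) (hy : ∀ p ∈ Q, ¬ adj p → y p ≤ z - v)
    (h : (Q.filter adj).card * u ≤ ((Q.card : ℝ) - (Q.filter adj).card) * v) :
    ∑ p ∈ Q, (if adj p then x p else y p) ≤ Q.card * z := by
  have h0 := Finset.card_filter_add_card_filter_not (s := Q) adj
  have h1 : ((Q.filter fun p => ¬ adj p).card : ℝ) = Q.card - (Q.filter adj).card := by
    rw [← h0]; push_cast; ring
  calc ∑ p ∈ Q, (if adj p then x p else y p) ≤ ∑ p ∈ Q, (if adj p then z + u else z - v) :=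
        Finset.sum_le_sum fun p hp => by
          split_ifs with h'
          · exact hx p hp h'
          · exact hy p hp h'
    _ ≤ _ := by
        rw [Finset.sum_ite, Finset.sum_const, Finset.sum_const, nsmul_eq_mul, nsmul_eq_mul, h1]
        nlinarith

lemma levelNum_fail (θ g E : ℝ) (m t : ℕ) : levelNum θ g E m (t + 1) = levelNum θ g E m t + 1 := by
  simp only [levelNum]; push_cast; ring

/-- Removing `ρ` components pays for the attempt itself through `θ * ρ ≥ 1`, which leaves `g` to pay
for failures. -/
lemma levelNum_pair {θ g E : ℝ} (hθ : 0 ≤ θ) (hg : 0 ≤ g) {m m' : ℕ} (t : ℕ) {ρ : ℕ}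
    (hρ : 1 ≤ θ * ρ) (hρ' : 1 ≤ ρ) (h : m' + ρ ≤ m) :
    levelNum θ g E m' (t + 1) ≤ levelNum θ g E m t - g := by
  have h1 : (m' : ℝ) + ρ ≤ m := by exact_mod_cast h
  have h2 : (1 : ℝ) ≤ ρ := by exact_mod_cast hρ'
  have h3 : min (m' : ℝ) E ≤ min (m : ℝ) E := min_le_min_right _ (by linarith)
  simp only [levelNum]; push_cast
  nlinarith [mul_le_mul_of_nonneg_left h1 hθ, mul_le_mul_of_nonneg_left h1 hg,
    mul_le_mul_of_nonneg_left h2 hg]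

/-- Once at most `E` components are counted, the term with the minimum falls by 16 while the attempt
costs 1; the remainder 15 covers a success chance as low as `1 / 16`. -/
lemma levelNum_single {θ g E : ℝ} (hθ : 0 ≤ θ) (hg : 0 ≤ g) {m m' : ℕ} (t : ℕ)
    (hm : (m : ℝ) ≤ E) (h : m' + 1 ≤ m) :
    levelNum θ g E m' (t + 1) ≤ levelNum θ g E m t - 15 := by
  have h1 : (m' : ℝ) + 1 ≤ m := by exact_mod_cast h
  simp only [levelNum]; push_cast
  rw [min_eq_left hm, min_eq_left (by linarith : (m' : ℝ) ≤ E)]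
  nlinarith [mul_le_mul_of_nonneg_left h1 hθ, mul_le_mul_of_nonneg_left h1 hg]

/-- The constants of the pairing strategy. -/
structure PairParams (n b E : ℕ) (η : ℝ) : Prop where
  hb : 1 ≤ b
  hE : 16 ≤ E
  hbE : 16 * (b * E) ≤ n
  hη : 0 ≤ η
  -- `dense` keeps `rate` at most 1; `cost` bounds the overhead of a level by `η`, in units of the
  -- time allowance `n / (16 * b)`; `start` bounds the initial risk of the matching stage by `η`.
  dense : 10 * n ≤ E * (E - 1)
  cost : 10 * n / (E * (E - 1) : ℝ) * n + 17 * E ≤ η * (n / (16 * b))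
  start : (n * (8 / E + 2 * ((160 + 64 * b) * n / E ^ 2)) / (E * (E - 1)) : ℝ) * n +
    8 * b * E / n * Real.log (2 * n / E) ≤ η

variable {b E : ℕ} {η : ℝ}

/-- The cost rate of failed attempts to join two random small components. -/
noncomputable def rate (n E : ℕ) : ℝ := 10 * n / (E * (E - 1))

lemma PairParams.E_pos (h : PairParams n b E η) : (16 : ℝ) ≤ E := by exact_mod_cast h.hE

lemma PairParams.E_le (h : PairParams n b E η) : 16 * (b * (E : ℝ)) ≤ n := by exact_mod_cast h.hbE

lemma PairParams.E_le' (h : PairParams n b E η) : 16 * (E : ℝ) ≤ n := by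
  have h1 : (1 : ℝ) ≤ b := by exact_mod_cast h.hb
  nlinarith [h.E_le, h.E_pos]

lemma PairParams.dense' (h : PairParams n b E η) : 10 * (n : ℝ) ≤ E * (E - 1) := by
  have h1 := h.dense
  have h2 := h.hE
  have h3 : ((E - 1 : ℕ) : ℝ) = (E : ℝ) - 1 := by
    rw [Nat.cast_sub (by omega)]; simp
  rw [← h3]
  exact_mod_cast h1

lemma PairParams.rate_nonneg (h : PairParams n b E η) : 0 ≤ rate n E := by
  have := h.E_pos
  exact div_nonneg (by positivity) (mul_nonneg (by positivity) (by linarith))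

/-- The value of a position at one of the three levels. -/
noncomputable def levelVal (n b E : ℕ) (off θ c : ℝ) (m t : ℕ) : ℝ :=
  1 - off - (levelNum θ (rate n E) E m t - c) / (n / (16 * b))

/-- When the ideal part `θ * m - c` does not grow at a change of level, the two clocks differ by at
most `rate n E * n + 16 * E`, for which one `η` pays. -/
lemma PairParams.offset_le (h : PairParams n b E η) {off θ c c' θ' : ℝ} {m m' t : ℕ}
    (hle : θ' * m' - c' ≤ θ * m - c) (hm' : (m' : ℝ) ≤ n) :
    levelVal n b E (off + η) θ c m t ≤ levelVal n b E off θ' c' m' t := by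
  have hb : (1 : ℝ) ≤ b := by exact_mod_cast h.hb
  have hn : (0 : ℝ) < n := by linarith [h.E_pos, h.E_le']
  have hD : (0 : ℝ) < n / (16 * b) := by positivity
  have hr := h.rate_nonneg
  have h1 : (levelNum θ' (rate n E) E m' t - c') - (levelNum θ (rate n E) E m t - c) ≤
      η * (n / (16 * b)) := by
    refine le_trans ?_ h.cost
    have h2 : min (m' : ℝ) E ≤ E := min_le_right _ _
    have h3 : 0 ≤ min (m : ℝ) E := le_min (Nat.cast_nonneg _) (Nat.cast_nonneg _)
    have h4 : rate n E * m' ≤ rate n E * n := mul_le_mul_of_nonneg_left hm' hr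
    have h5 : 0 ≤ rate n E * m := mul_nonneg hr (Nat.cast_nonneg _)
    have h6 : 10 * n / (E * (E - 1) : ℝ) * n = rate n E * n := rfl
    have h7 := h.E_pos
    rw [h6]
    simp only [levelNum]
    linarith
  rw [levelVal, levelVal]
  have h8 : (levelNum θ' (rate n E) E m' t - c') / (n / (16 * b)) ≤
      (levelNum θ (rate n E) E m t - c) / (n / (16 * b)) + η := by
    rw [← sub_le_iff_le_add', ← sub_div, div_le_iff₀ hD]
    exact h1
  linarith

/-- With at least `E` counted components there are at least `E * (E - 1)` ordered pairs of labels,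
of which at most `5 * n` are blocked; the gain `rate`, which is at most 1, compensates the failures.
With fewer, the smallest component is itself counted, and its cut succeeds with chance at least `1 /
16`. -/
lemma PairParams.sum_levelVal (h : PairParams n b E η) {lab : Fin n → Fin n}
    (hl : ∀ v, lab (lab v) = lab v) (hu : Unfinished lab) (G : SimpleGraph (Fin n)) (t k ρ : ℕ)
    (off θ c : ℝ) (hθ : 0 ≤ θ) (hρ : 1 ≤ θ * ρ) (hρ' : 1 ≤ ρ)
    (hne : (smallRoots lab k).Nonempty)
    (hpair : E ≤ (smallRoots lab k).card → 2 * edgeCount G ≤ 5 * n ∧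
      ∀ c₁ c₂ lab', IsMerge lab lab' c₁ c₂ → c₁ ∈ smallRoots lab k → c₂ ∈ smallRoots lab k →
        (smallRoots lab' k).card + ρ ≤ (smallRoots lab k).card)
    (hsingle : (smallRoots lab k).card < E → ∀ d, IsMinRoot lab d →
      16 * ((cutPairs lab d).filter fun p => G.Adj p.1 p.2).card ≤ 15 * (cutPairs lab d).card) :
    (levelMoves E k lab).card * levelVal n b E off θ c (smallRoots lab k).card t ≤
      ∑ p ∈ levelMoves E k lab, if G.Adj p.1 p.2
        then levelVal n b E off θ c (smallRoots lab k).card (t + 1)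
        else levelVal n b E off θ c (smallRoots (mergeAlong lab s(p.1, p.2)) k).card (t + 1) := by
  set Q := levelMoves E k lab with hQ
  set m := (smallRoots lab k).card with hm
  have hb : (1 : ℝ) ≤ b := by exact_mod_cast h.hb
  have hn : (0 : ℝ) < n := by linarith [h.E_pos, h.E_le']
  have hD : (0 : ℝ) < n / (16 * b) := by positivity
  have hr := h.rate_nonneg
  have hE1 := h.E_pos
  have hspec := levelMoves_spec (E := E) (by linarith [h.hE]) k hl hu
  have key : ∑ p ∈ Q, (if G.Adj p.1 p.2 then levelNum θ (rate n E) E m (t + 1)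
      else levelNum θ (rate n E) E (smallRoots (mergeAlong lab s(p.1, p.2)) k).card (t + 1)) ≤
      Q.card * levelNum θ (rate n E) E m t := by
    by_cases hc : E ≤ m
    · have hQ' : Q = (smallRoots lab k).offDiag := by rw [hQ, levelMoves, if_pos hc]
      refine sum_ite_le_card_mul Q (fun p => G.Adj p.1 p.2) _ _ (u := 1) (v := rate n E)
        (fun p _ _ => (levelNum_fail _ _ _ _ _).le) (fun p hp _ => ?_) ?_
      · obtain ⟨c₁, c₂, hM, hcc⟩ := exists_isMerge hl (hspec.2 p hp)
        rw [hQ', Finset.mem_offDiag] at hp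
        have e1 : lab p.1 ∈ smallRoots lab k := by
          rw [(mem_smallRoots.1 hp.1).1]; exact hp.1
        have e2 : lab p.2 ∈ smallRoots lab k := by
          rw [(mem_smallRoots.1 hp.2.1).1]; exact hp.2.1
        refine levelNum_pair hθ hr t hρ hρ' ((hpair hc).2 c₁ c₂ _ hM ?_ ?_)
        · rcases hcc with ⟨h1, h2⟩ | ⟨h1, h2⟩ <;> rw [h1] <;> assumption
        · rcases hcc with ⟨h1, h2⟩ | ⟨h1, h2⟩ <;> rw [h2] <;> assumption
      · have hF : ((Q.filter fun p => G.Adj p.1 p.2).card : ℝ) ≤ 5 * n := by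
          rw [hQ']
          exact_mod_cast (card_adj_offDiag_le G _).trans (hpair hc).1
        have hQc : (E : ℝ) * (E - 1) ≤ Q.card := by
          rw [hQ', Finset.offDiag_card, Nat.cast_sub (Nat.le_mul_self _)]
          push_cast
          have : (E : ℝ) ≤ m := by exact_mod_cast hc
          nlinarith
        have hEE : (0 : ℝ) < E * (E - 1) := mul_pos (by linarith) (by linarith)
        have hd := h.dense'
        have h1 : (5 : ℝ) * n ≤ rate n E * (E * (E - 1) - 5 * n) := by
          have : rate n E * (E * (E - 1)) = 10 * n := by rw [rate, div_mul_cancel₀ _ hEE.ne']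
          have h2 : rate n E ≤ 1 := by rw [rate, div_le_one hEE]; exact hd
          nlinarith
        calc ((Q.filter fun p => G.Adj p.1 p.2).card : ℝ) * 1 ≤ 5 * n := by linarith
          _ ≤ rate n E * (E * (E - 1) - 5 * n) := h1
          _ ≤ rate n E * (Q.card - (Q.filter fun p => G.Adj p.1 p.2).card) := by
              apply mul_le_mul_of_nonneg_left _ hr; linarith
          _ = _ := mul_comm _ _
    · have hQ' : Q = minCut lab := by rw [hQ, levelMoves, if_neg hc]
      obtain ⟨d, hd, heq⟩ := exists_minCut_eq hl hu
      have hmE : (m : ℝ) ≤ E := by exact_mod_cast (not_le.1 hc).le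
      refine sum_ite_le_card_mul Q (fun p => G.Adj p.1 p.2) _ _ (u := 1) (v := 15)
        (fun p _ _ => (levelNum_fail _ _ _ _ _).le) (fun p hp _ => ?_) ?_
      · obtain ⟨c₁, c₂, hM, hcc⟩ := exists_isMerge hl (hspec.2 p hp)
        refine levelNum_single hθ hr t hmE (hM.card_smallRoots_lt k ?_)
        rw [hQ', heq, mem_cutPairs] at hp
        have := hd.mem_smallRoots hne
        rw [← hp.1] at this
        rcases hcc with ⟨h1, _⟩ | ⟨_, h1⟩
        · left; rw [h1]; exact this
        · right; rw [h1]; exact this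
      · have h1 := hsingle (not_le.1 hc) d hd
        rw [← heq, ← hQ'] at h1
        have h2 : 16 * ((Q.filter fun p => G.Adj p.1 p.2).card : ℝ) ≤ 15 * Q.card := by
          exact_mod_cast h1
        linarith
  have hval : ∀ m' t', levelVal n b E off θ c m' t' = (1 - off + c / (n / (16 * b))) -
      levelNum θ (rate n E) E m' t' / (n / (16 * b)) := by
    intro m' t'; rw [levelVal]; ring
  simp only [hval]
  have hsum : ∑ p ∈ Q, (if G.Adj p.1 p.2
      then (1 - off + c / (n / (16 * b))) -
        levelNum θ (rate n E) E m (t + 1) / (n / (16 * b))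
      else (1 - off + c / (n / (16 * b))) -
        levelNum θ (rate n E) E (smallRoots (mergeAlong lab s(p.1, p.2)) k).card (t + 1) /
          (n / (16 * b))) =
      Q.card * (1 - off + c / (n / (16 * b))) - (∑ p ∈ Q, (if G.Adj p.1 p.2
        then levelNum θ (rate n E) E m (t + 1)
        else levelNum θ (rate n E) E (smallRoots (mergeAlong lab s(p.1, p.2)) k).card (t + 1))) /
          (n / (16 * b)) := by
    rw [Finset.sum_div, ← nsmul_eq_mul, ← Finset.sum_const, ← Finset.sum_sub_distrib]
    refine Finset.sum_congr rfl fun p _ => ?_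
    split_ifs <;> rfl
  rw [hsum, mul_sub, ← mul_div_assoc]
  apply sub_le_sub_left
  exact div_le_div_of_nonneg_right key hD.le

end PairPlan

/-! ### The potential of the pairing strategy -/

section PairValue
variable {n b E : ℕ} {η : ℝ}

/-- The cost of a vertex with a failed attempt. -/
noncomputable def pendCost (n b E : ℕ) : ℝ := (160 + 64 * b) * n / E ^ 2

/-- The cost rate of failed attempts to match two random isolated vertices. -/
noncomputable def matchRate (n b E : ℕ) : ℝ :=
  n * (8 / E + 2 * pendCost n b E) / (E * (E - 1))

/-- The excess of the number of attempts over a perfect matching process. -/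
noncomputable def excess (lab : Fin n → Fin n) (t : ℕ) : ℝ :=
  t - (n - (smallRoots lab 2).card) / 2

/-- The expected final degrees into the set of live vertices when `r` of them remain and the degree
sum is `d`. -/
noncomputable def degPot (b E : ℕ) (r d : ℝ) : ℝ :=
  d / r + 2 * b * (Real.log r - Real.log (E / 2))

/-- The risk of a position of the matching stage. -/
noncomputable def startNum (n b E : ℕ) (lab : Fin n → Fin n) (P : Finset (Fin n))
    (G : SimpleGraph (Fin n)) (t : ℕ) : ℝ :=
  8 / E * excess lab t + pendCost n b E * (pendSet lab P).card +
    matchRate n b E * (liveSet lab P).card +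
    4 * E / n * degPot b E (liveSet lab P).card ((∑ v ∈ liveSet lab P, deg G v : ℕ) : ℝ)

/-- The value function of the pairing strategy. -/
noncomputable def pairVal (n b E : ℕ) (η : ℝ) (lab : Fin n → Fin n) (P : Finset (Fin n))
    (G : SimpleGraph (Fin n)) (t : ℕ) : ℝ :=
  -- An attempt merges at most two components, so this guard is an invariant; it makes `excess`
  -- nonnegative. The next guard is one too: a failed draw creates two pending vertices while at
  -- least `E` are isolated, and serving one uses up at most two isolated vertices. The centres `n /
  -- 2`, `3 * n / 4` and `n` are the ideal times at which the levels end.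
  if n ≤ t + (roots lab).card then
    if (pendSet lab P).Nonempty ∨ E ≤ (smallRoots lab 2).card then
      if (pendSet lab P).card ≤ 2 ∧ E + 2 * (pendSet lab P).card ≤ (smallRoots lab 2).card + 4 then
        max 0 (1 - 3 * η - startNum n b E lab P G t)
      else 0
    else if (smallRoots lab 2).Nonempty then
      if ∀ v ∈ smallRoots lab 2, (deg G v : ℝ) ≤ n / 4 + b * (t + E - n / 2) then
        max 0 (levelVal n b E (η + η) (1 / 2) (n / 2) (smallRoots lab 2).card t)
      else 0
    else if (smallRoots lab 4).Nonempty then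
      max 0 (levelVal n b E (0 + η) (1 / 2) (3 * n / 4) (smallRoots lab 4).card t)
    else max 0 (levelVal n b E 0 1 n (smallRoots lab (n + 1)).card t)
  else 0

lemma pairVal_nonneg (lab : Fin n → Fin n) (P : Finset (Fin n)) (G : SimpleGraph (Fin n)) (t : ℕ) :
    0 ≤ pairVal n b E η lab P G t := by
  rw [pairVal]
  split_ifs <;> first | exact le_rfl | exact le_max_left _ _

lemma pendSet_empty {lab : Fin n → Fin n} (h : ¬ (smallRoots lab 2).Nonempty)
    (P : Finset (Fin n)) : ¬ (pendSet lab P).Nonempty := fun h' =>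
  h (h'.mono Finset.inter_subset_left)

lemma PairParams.card_lt (hp : PairParams n b E η) {lab : Fin n → Fin n}
    (h : ¬ (smallRoots lab 2).Nonempty) : ¬ E ≤ (smallRoots lab 2).card := by
  rw [Finset.not_nonempty_iff_eq_empty.1 h, Finset.card_empty]
  have := hp.hE; omega

lemma PairParams.le_pairVal_all (hp : PairParams n b E η) {lab : Fin n → Fin n}
    (P : Finset (Fin n)) (G : SimpleGraph (Fin n)) {t : ℕ} (ht : n ≤ t + (roots lab).card)
    (h2 : ¬ (smallRoots lab 2).Nonempty) (h4 : ¬ (smallRoots lab 4).Nonempty) :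
    levelVal n b E 0 1 n (smallRoots lab (n + 1)).card t ≤ pairVal n b E η lab P G t := by
  rw [pairVal, if_pos ht, if_neg (by simp [pendSet_empty h2, hp.card_lt h2]), if_neg h2, if_neg h4]
  exact le_max_right _ _

/-- When the last component with fewer than four vertices disappears, at most `n / 4` components
remain, one attempt each: the centre moves from `3 * n / 4` to `n`. -/
lemma PairParams.le_pairVal_four (hp : PairParams n b E η) {lab : Fin n → Fin n}
    (hl : ∀ v, lab (lab v) = lab v)
    (P : Finset (Fin n)) (G : SimpleGraph (Fin n)) {t : ℕ} (ht : n ≤ t + (roots lab).card)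
    (h2 : ¬ (smallRoots lab 2).Nonempty) :
    levelVal n b E (0 + η) (1 / 2) (3 * n / 4) (smallRoots lab 4).card t ≤
      pairVal n b E η lab P G t := by
  by_cases h4 : (smallRoots lab 4).Nonempty
  · rw [pairVal, if_pos ht, if_neg (by simp [pendSet_empty h2, hp.card_lt h2]), if_neg h2,
      if_pos h4]
    exact le_max_right _ _
  · refine (hp.offset_le ?_ ?_).trans (hp.le_pairVal_all P G ht h2 h4)
    · rw [Finset.not_nonempty_iff_eq_empty.1 h4, smallRoots_succ_eq, Finset.card_empty]
      have : (4 : ℝ) * (roots lab).card ≤ n := by exact_mod_cast mul_card_roots_le hl h4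
      push_cast; linarith
    · exact_mod_cast (Finset.card_le_univ _).trans_eq (Fintype.card_fin n)

/-- When the last isolated vertex disappears, at most `n / 2` components remain, at half an attempt
each: the centre moves from `n / 2` to `3 * n / 4`. -/
lemma PairParams.le_pairVal_two (hp : PairParams n b E η) {lab : Fin n → Fin n}
    (hl : ∀ v, lab (lab v) = lab v)
    (P : Finset (Fin n)) (G : SimpleGraph (Fin n)) {t : ℕ} (ht : n ≤ t + (roots lab).card)
    (hpend : ¬ (pendSet lab P).Nonempty) (hlt : (smallRoots lab 2).card < E)
    (hdeg : ∀ v ∈ smallRoots lab 2, (deg G v : ℝ) ≤ n / 4 + b * (t + E - n / 2)) :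
    levelVal n b E (η + η) (1 / 2) (n / 2) (smallRoots lab 2).card t ≤
      pairVal n b E η lab P G t := by
  by_cases h2 : (smallRoots lab 2).Nonempty
  · rw [pairVal, if_pos ht, if_neg (by simp [hpend, hlt]), if_pos h2, if_pos hdeg]
    exact le_max_right _ _
  · refine le_trans ?_ (hp.le_pairVal_four hl P G ht h2)
    rw [zero_add]
    refine (hp.offset_le ?_ ?_).trans (le_of_eq rfl)
    · rw [Finset.not_nonempty_iff_eq_empty.1 h2, Finset.card_empty]
      have h3 : (2 : ℝ) * (roots lab).card ≤ n := by exact_mod_cast mul_card_roots_le hl h2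
      have h4 : ((smallRoots lab 4).card : ℝ) ≤ (roots lab).card := by
        exact_mod_cast Finset.card_le_card (smallRoots_subset_roots lab 4)
      push_cast; linarith
    · exact_mod_cast (Finset.card_le_univ _).trans_eq (Fintype.card_fin n)

lemma card_live_add_pend (lab : Fin n → Fin n) (P : Finset (Fin n)) :
    (liveSet lab P).card + (pendSet lab P).card = (smallRoots lab 2).card :=
  Finset.card_sdiff_add_card_inter _ _

lemma excess_nonneg {lab : Fin n → Fin n} (hl : ∀ v, lab (lab v) = lab v) {t : ℕ}
    (ht : n ≤ t + (roots lab).card) : 0 ≤ excess lab t := by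
  have h1 : (n : ℝ) ≤ t + (roots lab).card := by exact_mod_cast ht
  have h2 : (2 : ℝ) * (roots lab).card ≤ n + (smallRoots lab 2).card := by
    exact_mod_cast two_mul_card_roots_le hl
  rw [excess]; linarith

lemma PairParams.pendCost_nonneg (_ : PairParams n b E η) : 0 ≤ pendCost n b E := by
  rw [pendCost]; positivity

lemma PairParams.matchRate_nonneg (hp : PairParams n b E η) : 0 ≤ matchRate n b E := by
  have h1 := hp.E_pos
  have h2 := hp.pendCost_nonneg
  exact div_nonneg (by positivity) (mul_nonneg (by linarith) (by linarith))

lemma log_diff_nonneg {r x : ℝ} (hx : 0 < x) (h : x ≤ r) : 0 ≤ Real.log r - Real.log x :=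
  sub_nonneg.2 (Real.log_le_log hx h)

/-- In the matching stage every summand of the risk is nonnegative. -/
lemma PairParams.startNum_parts (hp : PairParams n b E η) {lab : Fin n → Fin n}
    (hl : ∀ v, lab (lab v) = lab v) (P : Finset (Fin n)) (G : SimpleGraph (Fin n)) {t : ℕ}
    (ht : n ≤ t + (roots lab).card)
    (hinv : E + 2 * (pendSet lab P).card ≤ (smallRoots lab 2).card + 4) :
    (E : ℝ) / 2 + 4 ≤ (liveSet lab P).card ∧ 0 ≤ excess lab t ∧
      8 / E * excess lab t ≤ startNum n b E lab P G t ∧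
      4 * E / n * (((∑ v ∈ liveSet lab P, deg G v : ℕ) : ℝ) / (liveSet lab P).card) ≤
        startNum n b E lab P G t := by
  have hE := hp.E_pos
  -- The invariant leaves at least `E - 4` live vertices, and `E` is at least 16.
  have hr : (E : ℝ) / 2 + 4 ≤ (liveSet lab P).card := by
    have h1 := card_live_add_pend lab P
    have h2 : E ≤ (liveSet lab P).card + 4 := by omega
    have h3 : (E : ℝ) ≤ (liveSet lab P).card + 4 := by exact_mod_cast h2
    linarith
  have hex := excess_nonneg hl ht
  have hlog := log_diff_nonneg (by linarith : (0 : ℝ) < E / 2)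
    (by linarith : (E : ℝ) / 2 ≤ (liveSet lab P).card)
  have a1 : 0 ≤ 8 / E * excess lab t := by positivity
  have a2 : 0 ≤ pendCost n b E * (pendSet lab P).card := mul_nonneg hp.pendCost_nonneg (by positivity)
  have a3 : 0 ≤ matchRate n b E * (liveSet lab P).card :=
    mul_nonneg hp.matchRate_nonneg (by positivity)
  have a4 : 0 ≤ 4 * E / n * (((∑ v ∈ liveSet lab P, deg G v : ℕ) : ℝ) / (liveSet lab P).card) := by
    positivity
  have a5 : 0 ≤ 4 * E / n * (2 * b * (Real.log (liveSet lab P).card - Real.log (E / 2))) := by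
    positivity
  refine ⟨hr, hex, ?_, ?_⟩ <;>
  · rw [startNum, degPot, mul_add]; linarith

/-- If the matching stage ends with risk below 1, the excess is at most `E` and the remaining
isolated vertices have total degree at most `n / 4`. So each of them satisfies the degree condition
of the next level, and one `η` pays for the clock there. -/
lemma PairParams.le_pairVal_start (hp : PairParams n b E η) {lab : Fin n → Fin n}
    (hl : ∀ v, lab (lab v) = lab v)
    (P : Finset (Fin n)) (G : SimpleGraph (Fin n)) {t : ℕ} (ht : n ≤ t + (roots lab).card)
    (hp2 : (pendSet lab P).card ≤ 2)
    (hinv : E + 2 * (pendSet lab P).card ≤ (smallRoots lab 2).card + 4) :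
    1 - 3 * η - startNum n b E lab P G t ≤ pairVal n b E η lab P G t := by
  by_cases hs : (pendSet lab P).Nonempty ∨ E ≤ (smallRoots lab 2).card
  · rw [pairVal, if_pos ht, if_pos hs, if_pos ⟨hp2, hinv⟩]
    exact le_max_right _ _
  · rcases le_or_gt (1 - 3 * η - startNum n b E lab P G t) 0 with h0 | h0
    · exact h0.trans (pairVal_nonneg _ _ _ _)
    · push Not at hs
      obtain ⟨hpend, hlt⟩ := hs
      have hE := hp.E_pos
      have hEn := hp.E_le'
      have hη := hp.hη
      have hn : (0 : ℝ) < n := by linarith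
      obtain ⟨hr, hex, h1, h2⟩ := hp.startNum_parts hl P G ht hinv
      have hU : startNum n b E lab P G t < 1 := by linarith
      have hlive : liveSet lab P = smallRoots lab 2 := by
        rw [liveSet, Finset.sdiff_eq_self_iff_disjoint, Finset.disjoint_iff_inter_eq_empty]
        exact hpend
      rw [hlive] at hr h2
      set σ : ℝ := ((smallRoots lab 2).card : ℝ) with hσ
      have hσE : σ ≤ E := by rw [hσ]; exact_mod_cast hlt.le
      have hw : excess lab t ≤ E := by
        have : 8 / E * excess lab t < 1 := h1.trans_lt hU
        rw [div_mul_eq_mul_div, div_lt_one (by linarith)] at this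
        linarith
      have hdsum : ((∑ v ∈ smallRoots lab 2, deg G v : ℕ) : ℝ) ≤ n / 4 := by
        have h3 := h2.trans_lt hU
        rw [div_mul_div_comm, div_lt_one (mul_pos hn (by linarith))] at h3
        set d : ℝ := ((∑ v ∈ smallRoots lab 2, deg G v : ℕ) : ℝ)
        have h4 : n * σ ≤ n * E := by gcongr
        have h5 : (E : ℝ) * (4 * d) < E * n := by linarith
        have := lt_of_mul_lt_mul_left h5 (by linarith)
        linarith
      have hexdef : excess lab t = t - (n - σ) / 2 := rfl
      have hmain := hp.le_pairVal_two hl P G ht (Finset.not_nonempty_iff_eq_empty.2 hpend) hlt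
        fun v hv => by
          have h3 : (deg G v : ℝ) ≤ ((∑ v ∈ smallRoots lab 2, deg G v : ℕ) : ℝ) := by
            exact_mod_cast Finset.single_le_sum (f := deg G) (fun _ _ => Nat.zero_le _) hv
          have h4 : (0 : ℝ) ≤ b * (t + E - n / 2) := by
            apply mul_nonneg (Nat.cast_nonneg _); linarith
          linarith
      refine le_trans ?_ hmain
      have hU0 : 0 ≤ startNum n b E lab P G t := le_trans (by positivity) h1
      have hb : (1 : ℝ) ≤ b := by exact_mod_cast hp.hb
      have hD : (0 : ℝ) < n / (16 * b) := by positivity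
      have hlev : (levelNum (1 / 2) (rate n E) E (smallRoots lab 2).card t - n / 2) /
          (n / (16 * b)) ≤ η := by
        rw [div_le_iff₀ hD]
        refine le_trans ?_ hp.cost
        have h3 : min σ (E : ℝ) ≤ E := min_le_right _ _
        have h4 : rate n E * σ ≤ rate n E * n :=
          mul_le_mul_of_nonneg_left (by linarith) hp.rate_nonneg
        have h5 : 10 * n / (E * (E - 1) : ℝ) * n = rate n E * n := rfl
        rw [h5]
        simp only [levelNum, ← hσ]
        linarith
      rw [levelVal]
      linarith

lemma pairVal_le_one_of_finished (hp : PairParams n b E η) {lab : Fin n → Fin n}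
    (hu : ¬ Unfinished lab) (P : Finset (Fin n))
    (G : SimpleGraph (Fin n)) (t : ℕ) : pairVal n b E η lab P G t ≤ 1 := by
  have hE := hp.E_pos
  have hEn := hp.E_le'
  have hn : 16 < n := by
    have : (16 : ℝ) < n := by linarith
    exact_mod_cast this
  have hsize : ∀ c, lab c = c → compSize lab c = n := by
    intro c hc
    have : comp lab c = Finset.univ := by
      ext u
      simp only [mem_comp, Finset.mem_univ, iff_true]
      by_contra h
      exact hu ⟨u, c, fun h' => h (h'.trans hc)⟩
    rw [compSize, this, Finset.card_univ, Fintype.card_fin]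
  have hempty : ∀ k, k ≤ n → ¬ (smallRoots lab k).Nonempty := by
    rintro k hk ⟨c, hc⟩
    rw [mem_smallRoots] at hc
    have := hsize c hc.1
    omega
  have h2 := hempty 2 (by omega)
  by_cases h1 : n ≤ t + (roots lab).card
  · rw [pairVal, if_pos h1, if_neg (by simp [pendSet_empty h2, hp.card_lt h2]), if_neg h2,
      if_neg (hempty 4 (by omega))]
    refine max_le zero_le_one ?_
    have hb : (1 : ℝ) ≤ b := by exact_mod_cast hp.hb
    have hn' : (0 : ℝ) < n := by linarith
    rw [levelVal]
    have h7 : (n : ℝ) ≤ t + (roots lab).card := by exact_mod_cast h1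
    have h8 : 0 ≤ (levelNum 1 (rate n E) E (smallRoots lab (n + 1)).card t - n) /
        (n / (16 * b)) := by
      apply div_nonneg _ (by positivity)
      rw [smallRoots_succ_eq, levelNum]
      have h9 : 0 ≤ rate n E * (roots lab).card := mul_nonneg hp.rate_nonneg (Nat.cast_nonneg _)
      have h10 : 0 ≤ min ((roots lab).card : ℝ) E := le_min (Nat.cast_nonneg _) (Nat.cast_nonneg _)
      linarith
    linarith
  · rw [pairVal, if_neg h1]
    exact zero_le_one

end PairValue

/-! ### Drift after the matching stage -/

section LevelDrift
variable {n b E : ℕ} {η : ℝ}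

lemma mul_sub_le_mul_sub {i j : ℕ} (h : j ≤ i) (hi : 2 * i ≤ n) : j * (n - j) ≤ i * (n - i) := by
  obtain ⟨m, rfl⟩ : ∃ m, n = i + m := ⟨n - i, by omega⟩
  obtain ⟨l, rfl⟩ : ∃ l, i = j + l := ⟨i - j, by omega⟩
  rw [Nat.add_sub_cancel_left, show j + l + m - j = l + m by omega]
  nlinarith [Nat.zero_le (l * (m - j)), Nat.mul_le_mul_left l (by omega : j ≤ m)]

lemma comp_eq_singleton {lab : Fin n → Fin n} {c : Fin n} (h : c ∈ smallRoots lab 2) :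
    comp lab c = {c} := by
  rw [mem_smallRoots] at h
  have h1 := compSize_pos h.1
  obtain ⟨d, hd⟩ := Finset.card_eq_one.1 (by change compSize lab c = 1; omega)
  have : c ∈ comp lab c := mem_comp.2 h.1
  rw [hd, Finset.mem_singleton] at this
  rw [hd, this]

lemma le_compSize_of_empty {lab : Fin n → Fin n} {k : ℕ} (h : ¬ (smallRoots lab k).Nonempty)
    {c : Fin n} (hc : lab c = c) : k ≤ compSize lab c := by
  by_contra h'
  exact h ⟨c, mem_smallRoots.2 ⟨hc, not_le.1 h'⟩⟩

/-- The other terms of the clock are nonnegative, so a positive value means that the time allowance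
beyond the centre `c` is not used up. -/
lemma PairParams.attempts_lt (hp : PairParams n b E η) {off θ c : ℝ} {m t : ℕ} (hoff : 0 ≤ off)
    (hθ : 0 ≤ θ) (h : 0 < levelVal n b E off θ c m t) : t < c + n / (16 * b) := by
  have hb : (1 : ℝ) ≤ b := by exact_mod_cast hp.hb
  have hn : (0 : ℝ) < n := by linarith [hp.E_pos, hp.E_le']
  have hD : (0 : ℝ) < n / (16 * b) := by positivity
  have h1 : (levelNum θ (rate n E) E m t - c) / (n / (16 * b)) < 1 := by
    rw [levelVal] at h; linarith
  rw [div_lt_one hD, levelNum] at h1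
  have h2 : 0 ≤ rate n E * m := mul_nonneg hp.rate_nonneg (Nat.cast_nonneg _)
  have h3 : 0 ≤ min (m : ℝ) E := le_min (Nat.cast_nonneg _) (Nat.cast_nonneg _)
  have h4 : 0 ≤ θ * m := mul_nonneg hθ (Nat.cast_nonneg _)
  linarith

lemma PairParams.attempts_lt' (hp : PairParams n b E η) {off θ c : ℝ} {m t : ℕ} (hoff : 0 ≤ off)
    (hθ : 0 ≤ θ) (h : 0 < levelVal n b E off θ c m t) : 16 * (t : ℝ) < 16 * c + n := by
  have h1 := hp.attempts_lt hoff hθ h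
  have hb : (1 : ℝ) ≤ b := by exact_mod_cast hp.hb
  have h2 : (n : ℝ) / (16 * b) ≤ n / 16 :=
    div_le_div_of_nonneg_left (Nat.cast_nonneg _) (by norm_num) (by linarith)
  linarith

lemma PairParams.n_ge (hp : PairParams n b E η) : 256 ≤ n := by
  have h1 := hp.E_pos
  have h2 := hp.E_le'
  have : (256 : ℝ) ≤ n := by linarith
  exact_mod_cast this

/-- If all components have at least `j` vertices and PhantomBreaker has few edges, then joining a
smallest component succeeds with constant probability. -/
lemma card_adj_minCut_le {lab : Fin n → Fin n} (hl : ∀ v, lab (lab v) = lab v)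
    (hu : Unfinished lab) (G : SimpleGraph (Fin n)) {j : ℕ} (hj : ¬ (smallRoots lab j).Nonempty)
    (hG : 16 * edgeCount G ≤ 15 * (j * (n - j))) {d : Fin n} (hd : IsMinRoot lab d) :
    16 * ((cutPairs lab d).filter fun p => G.Adj p.1 p.2).card ≤ 15 * (cutPairs lab d).card := by
  have h1 := card_adj_cutPairs_le G lab d
  have h2 := mul_sub_le_mul_sub (le_compSize_of_empty hj hd.1) (hd.two_mul_le hl hu)
  rw [card_cutPairs]
  omega

lemma succ_attempts {lab lab' : Fin n → Fin n} {c₁ c₂ : Fin n} (h : IsMerge lab lab' c₁ c₂)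
    {t : ℕ} (ht : n ≤ t + (roots lab).card) : n ≤ t + 1 + (roots lab').card := by
  have := h.card_roots; omega

/-- The sum of the values over the next attempt. -/
noncomputable def nextSum (n b E : ℕ) (η : ℝ) (lab : Fin n → Fin n) (P : Finset (Fin n))
    (G : SimpleGraph (Fin n)) (t : ℕ) (G' : Fin n × Fin n → SimpleGraph (Fin n)) : ℝ :=
  ∑ p ∈ (pairPlan n E).moves lab P,
    if G.Adj p.1 p.2
    then pairVal n b E η lab ((pairPlan n E).onFail lab P s(p.1, p.2)) (G' p) (t + 1)
    else pairVal n b E η (mergeAlong lab s(p.1, p.2)) P (G' p) (t + 1)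

lemma onFail_of_lt {lab : Fin n → Fin n} (h : (smallRoots lab 2).card < E) (P : Finset (Fin n))
    (e : Sym2 (Fin n)) : (pairPlan n E).onFail lab P e = P := by
  simp only [pairPlan]
  rw [if_neg (by omega)]

/-- Before time `17 * n / 16` PhantomBreaker has at most `17 * n / 8` edges, while the smallest
component, with at least four and at most half of the vertices, has a cut of at least `4 * (n - 4)`
pairs. -/
lemma PairParams.le_nextSum_all (hp : PairParams n b E η) {lab : Fin n → Fin n}
    (hl : ∀ v, lab (lab v) = lab v) (hu : Unfinished lab) (P : Finset (Fin n))
    (G : SimpleGraph (Fin n)) {t : ℕ} (G' : Fin n × Fin n → SimpleGraph (Fin n))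
    (hG : edgeCount G ≤ 2 * t) (ht : n ≤ t + (roots lab).card)
    (h2 : ¬ (smallRoots lab 2).Nonempty) (h4 : ¬ (smallRoots lab 4).Nonempty)
    (hpos : 0 < levelVal n b E 0 1 n (smallRoots lab (n + 1)).card t) :
    ((pairPlan n E).moves lab P).card * levelVal n b E 0 1 n (smallRoots lab (n + 1)).card t ≤
      nextSum n b E η lab P G t G' := by
  have hmoves : (pairPlan n E).moves lab P = levelMoves E (n + 1) lab := by
    simp only [pairPlan]
    rw [dif_neg (pendSet_empty h2 P), if_neg h2, if_neg h4]
  have hlt : (smallRoots lab 2).card < E := not_le.1 (hp.card_lt h2)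
  have htb : 16 * t < 16 * n + n := by
    exact_mod_cast hp.attempts_lt' le_rfl zero_le_one hpos
  have hn := hp.n_ge
  rw [nextSum, hmoves]
  have hspec := levelMoves_spec (E := E) (by linarith [hp.hE]) (n + 1) hl hu
  refine (hp.sum_levelVal hl hu G t (n + 1) 1 0 1 n zero_le_one (by norm_num) le_rfl ?_
    (fun _ => ⟨by omega, fun c₁ c₂ lab' hM _ h => hM.card_smallRoots_lt _ (Or.inr h)⟩)
    (fun _ d hd => card_adj_minCut_le hl hu G h4 (by omega) hd)).trans
    (Finset.sum_le_sum fun p hp' => ?_)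
  · rw [smallRoots_succ_eq]
    obtain ⟨u, _⟩ := hu
    exact ⟨lab u, mem_roots.2 (hl u)⟩
  · split_ifs with hadj
    · rw [onFail_of_lt hlt]
      exact hp.le_pairVal_all _ _ (by omega) h2 h4
    · obtain ⟨c₁, c₂, hM, -⟩ := exists_isMerge hl (hspec.2 p hp')
      exact hp.le_pairVal_all _ _ (succ_attempts hM ht) (hM.smallRoots_empty h2)
        (hM.smallRoots_empty h4)

/-- Two components with at least two vertices merge into one with at least four, so a success
removes both. Before time `13 * n / 16` there are at most `13 * n / 8` edges against cuts of at
least `2 * (n - 2)` pairs. -/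
lemma PairParams.le_nextSum_four (hp : PairParams n b E η) {lab : Fin n → Fin n}
    (hl : ∀ v, lab (lab v) = lab v) (hu : Unfinished lab) (P : Finset (Fin n))
    (G : SimpleGraph (Fin n)) {t : ℕ} (G' : Fin n × Fin n → SimpleGraph (Fin n))
    (hG : edgeCount G ≤ 2 * t) (ht : n ≤ t + (roots lab).card)
    (h2 : ¬ (smallRoots lab 2).Nonempty) (h4 : (smallRoots lab 4).Nonempty)
    (hpos : 0 < levelVal n b E (0 + η) (1 / 2) (3 * n / 4) (smallRoots lab 4).card t) :
    ((pairPlan n E).moves lab P).card *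
        levelVal n b E (0 + η) (1 / 2) (3 * n / 4) (smallRoots lab 4).card t ≤
      nextSum n b E η lab P G t G' := by
  have hmoves : (pairPlan n E).moves lab P = levelMoves E 4 lab := by
    simp only [pairPlan]
    rw [dif_neg (pendSet_empty h2 P), if_neg h2, if_pos h4]
  have hlt : (smallRoots lab 2).card < E := not_le.1 (hp.card_lt h2)
  have htb : 16 * t < 12 * n + n := by
    have h := hp.attempts_lt' (by linarith [hp.hη]) (by norm_num) hpos
    have : (16 * t : ℝ) < 12 * n + n := by linarith
    exact_mod_cast this
  have hn := hp.n_ge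
  rw [nextSum, hmoves]
  have hspec := levelMoves_spec (E := E) (by linarith [hp.hE]) 4 hl hu
  refine (hp.sum_levelVal hl hu G t 4 2 (0 + η) (1 / 2) (3 * n / 4) (by norm_num) (by norm_num)
    (by norm_num) h4 (fun _ => ⟨by omega, fun c₁ c₂ lab' hM h h' =>
      hM.card_smallRoots_pair 4 h h' ?_⟩)
    (fun _ d hd => card_adj_minCut_le hl hu G h2 (by omega) hd)).trans
    (Finset.sum_le_sum fun p hp' => ?_)
  · have e1 := le_compSize_of_empty h2 hM.root₁
    have e2 := le_compSize_of_empty h2 hM.root₂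
    omega
  · split_ifs with hadj
    · rw [onFail_of_lt hlt]
      exact hp.le_pairVal_four hl _ _ (by omega) h2
    · obtain ⟨c₁, c₂, hM, -⟩ := exists_isMerge hl (hspec.2 p hp')
      exact hp.le_pairVal_four (mergeAlong_idem _ hl _) _ _ (succ_attempts hM ht)
        (hM.smallRoots_empty h2)

lemma IsMerge.pendSet_empty {lab lab' : Fin n → Fin n} {c₁ c₂ : Fin n}
    (h : IsMerge lab lab' c₁ c₂) {P : Finset (Fin n)} (hpend : ¬ (pendSet lab P).Nonempty) :
    ¬ (pendSet lab' P).Nonempty := fun h' => hpend (h'.mono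
  (Finset.inter_subset_inter_right ((h.smallRoots_subset 2).trans (Finset.erase_subset _ _))))

/-- Counting all edges would not protect a single isolated vertex, so its degree is followed
instead. It grows by at most `b` per attempt, and `t < n / 2 + n / (16 * b)` with `16 * b * E ≤ n`
keeps it at most `n / 4 + n / 16 + n / 16 = 3 * n / 8`. -/
lemma PairParams.le_nextSum_two (hp : PairParams n b E η) {lab : Fin n → Fin n}
    (hl : ∀ v, lab (lab v) = lab v) (hu : Unfinished lab) (P : Finset (Fin n))
    (G : SimpleGraph (Fin n)) {t : ℕ} (G' : Fin n × Fin n → SimpleGraph (Fin n))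
    (hG' : ∀ p, G ≤ G' p ∧ edgeCount (G' p) ≤ edgeCount G + b)
    (ht : n ≤ t + (roots lab).card) (hpend : ¬ (pendSet lab P).Nonempty)
    (hlt : (smallRoots lab 2).card < E) (h2 : (smallRoots lab 2).Nonempty)
    (hdeg : ∀ v ∈ smallRoots lab 2, (deg G v : ℝ) ≤ n / 4 + b * (t + E - n / 2))
    (hpos : 0 < levelVal n b E (η + η) (1 / 2) (n / 2) (smallRoots lab 2).card t) :
    ((pairPlan n E).moves lab P).card *
        levelVal n b E (η + η) (1 / 2) (n / 2) (smallRoots lab 2).card t ≤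
      nextSum n b E η lab P G t G' := by
  have hmoves : (pairPlan n E).moves lab P = levelMoves E 2 lab := by
    simp only [pairPlan]
    rw [dif_neg hpend, if_pos h2]
  have htb := hp.attempts_lt (by linarith [hp.hη]) (by norm_num) hpos
  have hn := hp.n_ge
  have hdeg' : ∀ p, ∀ v ∈ smallRoots lab 2,
      (deg (G' p) v : ℝ) ≤ n / 4 + b * ((t + 1 : ℕ) + E - n / 2) := fun p v hv => by
    have h1 : (deg (G' p) v : ℝ) ≤ deg G v + b := by
      exact_mod_cast deg_le_deg_add (hG' p).1 (hG' p).2 v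
    have h3 := hdeg v hv
    push_cast
    linarith
  rw [nextSum, hmoves]
  have hspec := levelMoves_spec (E := E) (by linarith [hp.hE]) 2 hl hu
  refine (hp.sum_levelVal hl hu G t 2 2 (η + η) (1 / 2) (n / 2) (by norm_num) (by norm_num)
    (by norm_num) h2 (fun h => absurd h (by omega)) (fun _ d hd => ?_)).trans
    (Finset.sum_le_sum fun p hp' => ?_)
  · have hd2 := hd.mem_smallRoots h2
    have hcomp := comp_eq_singleton hd2
    have h1 := card_adj_cutPairs_le_compDeg G lab d
    rw [compDeg, hcomp, Finset.sum_singleton] at h1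
    rw [card_cutPairs, compSize, hcomp, Finset.card_singleton, one_mul]
    have hb : (1 : ℝ) ≤ b := by exact_mod_cast hp.hb
    have h3 : (b : ℝ) * (n / (16 * b)) = n / 16 := by field_simp
    have h4 : 8 * (deg G d : ℝ) ≤ 3 * n := by
      have := hdeg d hd2
      have h5 := hp.E_le
      have h6 : (b : ℝ) * (t + E - n / 2) ≤ b * (n / (16 * b) + E) :=
        mul_le_mul_of_nonneg_left (by linarith) (by linarith)
      rw [mul_add, h3] at h6
      linarith
    have h5 : 8 * deg G d ≤ 3 * n := by exact_mod_cast h4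
    omega
  · split_ifs with hadj
    · rw [onFail_of_lt hlt]
      exact hp.le_pairVal_two hl _ _ (by omega) hpend hlt (hdeg' p)
    · obtain ⟨c₁, c₂, hM, -⟩ := exists_isMerge hl (hspec.2 p hp')
      exact hp.le_pairVal_two (mergeAlong_idem _ hl _) _ _ (succ_attempts hM ht)
        (hM.pendSet_empty hpend) ((hM.card_smallRoots_le 2).trans_lt hlt) fun v hv =>
          hdeg' p v (Finset.mem_of_mem_erase (hM.smallRoots_subset 2 hv))

end LevelDrift

/-! ### Drift while a pending vertex is served -/

section MatchDrift
variable {n b E : ℕ} {η : ℝ}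

lemma card_mul_const_sub_le {α : Type*} (Q : Finset α) (adj : α → Prop) (x y : α → ℝ) {c u : ℝ}
    (h : ∑ p ∈ Q, (if adj p then x p else y p) ≤ Q.card * u) :
    Q.card * (c - u) ≤ ∑ p ∈ Q, if adj p then c - x p else c - y p := by
  have : ∑ p ∈ Q, (if adj p then c - x p else c - y p) =
      Q.card * c - ∑ p ∈ Q, (if adj p then x p else y p) := by
    rw [← nsmul_eq_mul, ← Finset.sum_const, ← Finset.sum_sub_distrib]
    refine Finset.sum_congr rfl fun p _ => ?_
    split_ifs <;> rfl
  rw [this]; linarith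

/-- The bounds that a small risk gives in the matching stage. -/
lemma PairParams.bounds_of_startNum_lt (hp : PairParams n b E η) {lab : Fin n → Fin n}
    (hl : ∀ v, lab (lab v) = lab v) (P : Finset (Fin n)) (G : SimpleGraph (Fin n)) {t : ℕ}
    (hG : edgeCount G ≤ 2 * t) (ht : n ≤ t + (roots lab).card)
    (hinv : E + 2 * (pendSet lab P).card ≤ (smallRoots lab 2).card + 4)
    (hU : startNum n b E lab P G t < 1) :
    (edgeCount G : ℝ) ≤ n - (smallRoots lab 2).card + E / 4 ∧ edgeCount G ≤ n ∧
      ((∑ v ∈ liveSet lab P, deg G v : ℕ) : ℝ) ≤ 2 * n := by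
  have hE := hp.E_pos
  obtain ⟨-, -, h1, -⟩ := hp.startNum_parts hl P G ht hinv
  have h2 : 8 / E * excess lab t < 1 := h1.trans_lt hU
  rw [div_mul_eq_mul_div, div_lt_one (by linarith)] at h2
  have h3 : excess lab t = t - (n - (smallRoots lab 2).card) / 2 := rfl
  have h4 : (edgeCount G : ℝ) ≤ 2 * t := by exact_mod_cast hG
  have h5 : (E : ℝ) ≤ (smallRoots lab 2).card + 4 := by
    exact_mod_cast (Nat.le_add_right _ _).trans hinv
  have h6 : (edgeCount G : ℝ) ≤ n := by linarith
  refine ⟨by linarith, by exact_mod_cast h6, ?_⟩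
  have h7 : ((∑ v ∈ liveSet lab P, deg G v : ℕ) : ℝ) ≤ 2 * edgeCount G := by
    exact_mod_cast sum_deg_le G (liveSet lab P)
  linarith

/-- A crude bound for serving attempts, where the removed live vertex is not uniformly random. At
most one of at least `E / 2` live vertices is lost, which raises the mean degree by `O(n / E ^ 2)`,
and the new edges add `O(b / E)`. -/
lemma PairParams.degPot_step (hp : PairParams n b E η) {r r' d d' : ℝ} (hr : (E : ℝ) / 2 + 4 ≤ r)
    (h1 : r' ≤ r) (h2 : r ≤ r' + 1) (hd2 : d ≤ 2 * n) (hd' : d' ≤ d + 2 * b) :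
    4 * E / n * degPot b E r' d' ≤ 4 * E / n * degPot b E r d + (32 + 16 * b) / E := by
  have hE := hp.E_pos
  have hn : (0 : ℝ) < n := by linarith [hp.E_le']
  have hEn : (E : ℝ) ≤ n := by linarith [hp.E_le']
  have hr' : (E : ℝ) / 2 ≤ r' := by linarith
  have hr0 : 0 < r' := by linarith
  have hlog : Real.log r' ≤ Real.log r := Real.log_le_log hr0 h1
  have hdiv : d' / r' ≤ d / r + 8 * n / E ^ 2 + 4 * b / E := by
    have e1 : d' / r' ≤ (d + 2 * b) / r' := div_le_div_of_nonneg_right hd' hr0.le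
    have e2 : 2 * b / r' ≤ 4 * b / (E : ℝ) := by
      rw [div_le_div_iff₀ hr0 (by linarith)]
      nlinarith [(Nat.cast_nonneg b : (0 : ℝ) ≤ b)]
    have e3 : d / r' ≤ d / r + 8 * n / E ^ 2 := by
      have e4 : d / r' - d / r = d * (r - r') / (r' * r) := by
        rw [div_sub_div _ _ hr0.ne' (by linarith)]; ring
      have e5 : d * (r - r') / (r' * r) ≤ 2 * n / (E / 2 * (E / 2)) := by
        apply div_le_div₀ (by positivity) _ (by positivity) _
        · nlinarith
        · exact mul_le_mul hr' (by linarith) (by positivity) hr0.le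
      have e6 : 2 * n / (E / 2 * (E / 2) : ℝ) = 8 * n / E ^ 2 := by field_simp; norm_num
      linarith
    rw [add_div] at e1
    linarith
  have hmain : degPot b E r' d' ≤ degPot b E r d + (8 * n / E ^ 2 + 4 * b / E) := by
    rw [degPot, degPot]
    nlinarith [mul_le_mul_of_nonneg_left hlog (by positivity : (0 : ℝ) ≤ 2 * b)]
  have hc : (0 : ℝ) ≤ 4 * E / n := by positivity
  refine (mul_le_mul_of_nonneg_left hmain hc).trans ?_
  rw [mul_add]
  have e7 : 4 * E / n * (8 * n / E ^ 2 + 4 * b / E : ℝ) = 32 / E + 16 * b / n := by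
    field_simp; ring
  have e8 : 16 * b / (n : ℝ) ≤ 16 * b / E :=
    div_le_div_of_nonneg_left (by positivity) (by linarith) hEn
  rw [e7, add_div]
  linarith

/-- The price of one serving attempt: `8 / E` for the clock and `(32 + 16 * b) / E` for the degrees.
-/
lemma PairParams.startNum_step (hp : PairParams n b E η) {lab lab' : Fin n → Fin n}
    {P P' : Finset (Fin n)} {G G' : SimpleGraph (Fin n)} {t : ℕ}
    (hr : (E : ℝ) / 2 + 4 ≤ (liveSet lab P).card)
    (hd : ((∑ v ∈ liveSet lab P, deg G v : ℕ) : ℝ) ≤ 2 * n)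
    (hGG : G ≤ G') (hGb : edgeCount G' ≤ edgeCount G + b)
    (hσ : (smallRoots lab' 2).card ≤ (smallRoots lab 2).card)
    (hlive : liveSet lab' P' ⊆ liveSet lab P)
    (hcard : (liveSet lab P).card ≤ (liveSet lab' P').card + 1) :
    startNum n b E lab' P' G' (t + 1) ≤ startNum n b E lab P G t + (40 + 16 * b) / E +
      (pendCost n b E * (pendSet lab' P').card - pendCost n b E * (pendSet lab P).card) := by
  have hE := hp.E_pos
  have h1 : ((liveSet lab' P').card : ℝ) ≤ (liveSet lab P).card := by
    exact_mod_cast Finset.card_le_card hlive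
  have h2 : ((liveSet lab P).card : ℝ) ≤ (liveSet lab' P').card + 1 := by exact_mod_cast hcard
  have h3 : ((∑ v ∈ liveSet lab' P', deg G' v : ℕ) : ℝ) ≤
      ((∑ v ∈ liveSet lab P, deg G v : ℕ) : ℝ) + 2 * b := by
    have := (sum_deg_le_sum_deg_add hGG hGb (liveSet lab' P')).trans (Nat.add_le_add_right
      (Finset.sum_le_sum_of_subset (f := deg G) hlive) _)
    exact_mod_cast this
  have h4 := hp.degPot_step hr h1 h2 hd h3
  have h5 : matchRate n b E * (liveSet lab' P').card ≤ matchRate n b E * (liveSet lab P).card :=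
    mul_le_mul_of_nonneg_left h1 hp.matchRate_nonneg
  have h6 : excess lab' (t + 1) ≤ excess lab t + 1 := by
    have : ((smallRoots lab' 2).card : ℝ) ≤ (smallRoots lab 2).card := by exact_mod_cast hσ
    rw [excess, excess]; push_cast; linarith
  have h7 : 8 / E * excess lab' (t + 1) ≤ 8 / E * excess lab t + 8 / E := by
    have := mul_le_mul_of_nonneg_left h6 (by positivity : (0 : ℝ) ≤ 8 / E)
    linarith
  have h8 : (40 + 16 * b : ℝ) / E = 8 / E + (32 + 16 * b) / E := by rw [← add_div]; ring
  rw [startNum, startNum, h8]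
  linarith

lemma IsMerge.smallRoots_two_subset {lab lab' : Fin n → Fin n} {c₁ c₂ : Fin n}
    (h : IsMerge lab lab' c₁ c₂) :
    smallRoots lab' 2 ⊆ ((smallRoots lab 2).erase c₂).erase c₁ :=
  h.smallRoots_subset_left 2 (by
    have := compSize_pos h.root₁
    have := compSize_pos h.root₂
    omega)

/-- PhantomBreaker has at most `n - σ + E / 4` edges, where the number `σ` of isolated vertices is
at least `E - 2`. Hence at least `E / 4` of the `n - 1` pairs at the pending vertex are free.
`pendCost` is the resulting bound `4 * n / E` on the mean waiting time, multiplied by the price of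
one serving attempt. -/
lemma PairParams.le_nextSum_pend (hp : PairParams n b E η) {lab : Fin n → Fin n}
    (hl : ∀ v, lab (lab v) = lab v) (P : Finset (Fin n))
    (G : SimpleGraph (Fin n)) {t : ℕ} (G' : Fin n × Fin n → SimpleGraph (Fin n))
    (hG : edgeCount G ≤ 2 * t) (hG' : ∀ p, G ≤ G' p ∧ edgeCount (G' p) ≤ edgeCount G + b)
    (ht : n ≤ t + (roots lab).card) (hpend : (pendSet lab P).Nonempty)
    (hp2 : (pendSet lab P).card ≤ 2)
    (hinv : E + 2 * (pendSet lab P).card ≤ (smallRoots lab 2).card + 4)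
    (hU : startNum n b E lab P G t < 1) :
    ((pairPlan n E).moves lab P).card * (1 - 3 * η - startNum n b E lab P G t) ≤
      nextSum n b E η lab P G t G' := by
  obtain ⟨v, hv, hmoves⟩ : ∃ v ∈ pendSet lab P, (pairPlan n E).moves lab P = cutPairs lab v := by
    refine ⟨hpend.choose, hpend.choose_spec, ?_⟩
    simp only [pairPlan]
    rw [dif_pos hpend]
  have hv2 := (Finset.mem_inter.1 hv).1
  have hvP := (Finset.mem_inter.1 hv).2
  have hvr := (mem_smallRoots.1 hv2).1
  obtain ⟨hr, -, -, -⟩ := hp.startNum_parts hl P G ht hinv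
  obtain ⟨hedge, -, hd⟩ := hp.bounds_of_startNum_lt hl P G hG ht hinv hU
  have hE := hp.E_pos
  have hn : (0 : ℝ) < n := by linarith [hp.E_le']
  have hfail : ∀ e, (pairPlan n E).onFail lab P e = P := fun e => by
    simp only [pairPlan]
    rw [if_neg (by simp [hpend])]
  have hmerge : ∀ p ∈ cutPairs lab v, ∃ c₁ c₂, IsMerge lab (mergeAlong lab s(p.1, p.2)) c₁ c₂ ∧
      (c₁ = v ∨ c₂ = v) := by
    intro p hp'
    rw [mem_cutPairs] at hp'
    obtain ⟨c₁, c₂, hM, hcc⟩ := exists_isMerge hl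
      (show lab p.1 ≠ lab p.2 by rw [hp'.1]; exact hp'.2.symm)
    rw [hp'.1] at hcc
    refine ⟨c₁, c₂, hM, ?_⟩
    rcases hcc with h | h
    · exact Or.inl h.1
    · exact Or.inr h.2
  have hpend' : ∀ {c₁ c₂ lab'}, IsMerge lab lab' c₁ c₂ → (c₁ = v ∨ c₂ = v) →
      (pendSet lab' P).card + 1 ≤ (pendSet lab P).card := by
    intro c₁ c₂ lab' hM hcv
    rw [← Finset.card_erase_add_one hv]
    refine Nat.add_le_add_right (Finset.card_le_card fun u hu' => ?_) 1
    rw [pendSet, Finset.mem_inter] at hu'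
    have h1 := hM.smallRoots_two_subset hu'.1
    rw [Finset.mem_erase, Finset.mem_erase] at h1
    rw [Finset.mem_erase, pendSet, Finset.mem_inter]
    refine ⟨?_, h1.2.2, hu'.2⟩
    rcases hcv with rfl | rfl
    · exact h1.1
    · exact h1.2.1
  have hlive : ∀ {c₁ c₂ lab'}, IsMerge lab lab' c₁ c₂ → (c₁ = v ∨ c₂ = v) →
      liveSet lab' P ⊆ liveSet lab P ∧ (liveSet lab P).card ≤ (liveSet lab' P).card + 1 := by
    intro c₁ c₂ lab' hM hcv
    refine ⟨Finset.sdiff_subset_sdiff ((hM.smallRoots_subset 2).trans (Finset.erase_subset _ _))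
      le_rfl, ?_⟩
    -- The pending vertex is not live, so at most the label of the other component leaves the live
    -- set.
    obtain ⟨w, hw⟩ : ∃ w, (liveSet lab P).erase w ⊆ liveSet lab' P := by
      rcases hcv with rfl | rfl
      · refine ⟨c₂, fun u hu' => ?_⟩
        rw [Finset.mem_erase, liveSet, Finset.mem_sdiff] at hu'
        rw [liveSet, Finset.mem_sdiff]
        refine ⟨hM.erase_erase_subset 2 ?_, hu'.2.2⟩
        rw [Finset.mem_erase, Finset.mem_erase]
        exact ⟨fun h => hu'.2.2 (h ▸ hvP), hu'.1, hu'.2.1⟩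
      · refine ⟨c₁, fun u hu' => ?_⟩
        rw [Finset.mem_erase, liveSet, Finset.mem_sdiff] at hu'
        rw [liveSet, Finset.mem_sdiff]
        refine ⟨hM.erase_erase_subset 2 ?_, hu'.2.2⟩
        rw [Finset.mem_erase, Finset.mem_erase]
        exact ⟨hu'.1, fun h => hu'.2.2 (h ▸ hvP), hu'.2.1⟩
    have h1 := Finset.card_le_card hw
    have h2 := Finset.pred_card_le_card_erase (s := liveSet lab P) (a := w)
    omega
  have hsum : ∑ p ∈ cutPairs lab v, (if G.Adj p.1 p.2
      then startNum n b E lab P (G' p) (t + 1)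
      else startNum n b E (mergeAlong lab s(p.1, p.2)) P (G' p) (t + 1)) ≤
      (cutPairs lab v).card * startNum n b E lab P G t := by
    refine sum_ite_le_card_mul _ (fun p : Fin n × Fin n => G.Adj p.1 p.2) _ _ (u := (40 + 16 * b) / E)
      (v := pendCost n b E - (40 + 16 * b) / E) (fun p _ _ => ?_) (fun p hp' _ => ?_) ?_
    · have := hp.startNum_step (t := t) hr hd (hG' p).1 (hG' p).2 le_rfl (Finset.Subset.refl _)
        (Nat.le_succ _)
      linarith
    · obtain ⟨c₁, c₂, hM, hcv⟩ := hmerge p hp'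
      have h1 := hp.startNum_step (t := t) hr hd (hG' p).1 (hG' p).2 (hM.card_smallRoots_le 2)
        (hlive hM hcv).1 (hlive hM hcv).2
      have h2 : ((pendSet (mergeAlong lab s(p.1, p.2)) P).card : ℝ) + 1 ≤
          (pendSet lab P).card := by exact_mod_cast hpend' hM hcv
      have h3 := mul_le_mul_of_nonneg_left h2 hp.pendCost_nonneg
      linarith
    · have hF : (((cutPairs lab v).filter fun p => G.Adj p.1 p.2).card : ℝ) ≤ edgeCount G := by
        exact_mod_cast card_adj_cutPairs_le G lab v
      have hQ : ((cutPairs lab v).card : ℝ) = n - 1 := by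
        rw [card_cutPairs, compSize, comp_eq_singleton hv2, Finset.card_singleton, one_mul,
          Nat.cast_sub (by linarith [hp.n_ge])]
        simp
      have hσ : (E : ℝ) + 2 ≤ (smallRoots lab 2).card + 4 := by
        have : 1 ≤ (pendSet lab P).card := hpend.card_pos
        exact_mod_cast (by omega : E + 2 ≤ (smallRoots lab 2).card + 4)
      set F : ℝ := (((cutPairs lab v).filter fun p => G.Adj p.1 p.2).card : ℝ)
      rw [hQ]
      set κ : ℝ := (40 + 16 * b) / E with hκ
      have hκ0 : 0 ≤ κ := by positivity
      have hpc : pendCost n b E = 4 * n / E * κ := by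
        rw [pendCost, hκ]; field_simp; ring
      have h1 : (E : ℝ) / 4 ≤ n - 1 - F := by linarith
      have h2 : (n : ℝ) ≤ (n - 1 - F) * (4 * n / E) := by
        have := mul_le_mul_of_nonneg_right h1 (by positivity : (0 : ℝ) ≤ 4 * n / E)
        have h3 : (E : ℝ) / 4 * (4 * n / E) = n := by field_simp
        linarith
      have h3 := mul_le_mul_of_nonneg_right h2 hκ0
      rw [hpc]
      linarith
  have h0 := card_mul_const_sub_le (cutPairs lab v) (fun p : Fin n × Fin n => G.Adj p.1 p.2) _ _
    (c := 1 - 3 * η) hsum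
  rw [nextSum, hmoves]
  refine h0.trans (Finset.sum_le_sum fun p hp' => ?_)
  split_ifs with hadj
  · rw [hfail]
    exact hp.le_pairVal_start hl _ _ (by omega) hp2 hinv
  · obtain ⟨c₁, c₂, hM, hcv⟩ := hmerge p hp'
    have h1 := hpend' hM hcv
    have h2 := hM.card_smallRoots_ge 2
    exact hp.le_pairVal_start (mergeAlong_idem _ hl _) _ _ (succ_attempts hM ht) (by omega)
      (by omega)

end MatchDrift

/-! ### Drift while random isolated vertices are matched -/

section RandomPairs
variable {n b E : ℕ} {η : ℝ}

lemma sum_offDiag_fst {α : Type*} (R : Finset α) (f : α → ℝ) :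
    ∑ p ∈ R.offDiag, f p.1 = (R.card - 1) * ∑ v ∈ R, f v := by
  have h1 : ∑ p ∈ R.offDiag, f p.1 + ∑ p ∈ R.diag, f p.1 = ∑ p ∈ R ×ˢ R, f p.1 := by
    rw [← Finset.diag_union_offDiag, Finset.sum_union (Finset.disjoint_diag_offDiag R), add_comm]
  rw [Finset.sum_product, Finset.sum_diag] at h1
  simp only [Finset.sum_const, nsmul_eq_mul] at h1
  rw [← Finset.mul_sum] at h1
  linarith

lemma sum_offDiag_snd {α : Type*} (R : Finset α) (f : α → ℝ) :
    ∑ p ∈ R.offDiag, f p.2 = (R.card - 1) * ∑ v ∈ R, f v := by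
  have h1 : ∑ p ∈ R.offDiag, f p.2 + ∑ p ∈ R.diag, f p.2 = ∑ p ∈ R ×ˢ R, f p.2 := by
    rw [← Finset.diag_union_offDiag, Finset.sum_union (Finset.disjoint_diag_offDiag R), add_comm]
  rw [Finset.sum_product_right, Finset.sum_diag] at h1
  simp only [Finset.sum_const, nsmul_eq_mul] at h1
  rw [← Finset.mul_sum] at h1
  linarith

/-- The potential of the degrees does not increase on average when two random live vertices are
removed and the degree sum grows by at most `2 * b`. -/
lemma sum_degPot_offDiag_le {α : Type*} (R : Finset α) (f : α → ℝ) (hR : 4 ≤ R.card) :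
    ∑ p ∈ R.offDiag, degPot b E ((R.card : ℝ) - 2) (∑ v ∈ R, f v - f p.1 - f p.2 + 2 * b) ≤
      R.offDiag.card * degPot b E R.card (∑ v ∈ R, f v) := by
  set r : ℝ := (R.card : ℝ) with hr
  have hr4 : (4 : ℝ) ≤ r := by rw [hr]; exact_mod_cast hR
  set S := ∑ v ∈ R, f v with hS
  have hQ : (R.offDiag.card : ℝ) = r * (r - 1) := by
    rw [Finset.offDiag_card, Nat.cast_sub (Nat.le_mul_self _)]
    push_cast; ring
  have h1 : ∑ p ∈ R.offDiag, degPot b E (r - 2) (S - f p.1 - f p.2 + 2 * b) =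
      (r - 1) * S + R.offDiag.card * (2 * b / (r - 2) +
        2 * b * (Real.log (r - 2) - Real.log (E / 2))) := by
    have h2 : ∀ p : α × α, degPot b E (r - 2) (S - f p.1 - f p.2 + 2 * b) =
        (S / (r - 2) + (2 * b / (r - 2) + 2 * b * (Real.log (r - 2) - Real.log (E / 2)))) -
          f p.1 / (r - 2) - f p.2 / (r - 2) := by
      intro p; rw [degPot]; ring
    simp only [h2]
    rw [Finset.sum_sub_distrib, Finset.sum_sub_distrib, ← Finset.sum_div, ← Finset.sum_div,
      sum_offDiag_fst, sum_offDiag_snd, Finset.sum_const, nsmul_eq_mul, ← hr, ← hS, hQ]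
    have : r - 2 ≠ 0 := by linarith
    field_simp
    ring
  -- The logarithm gains at least `2 / r`, which is at least `1 / (r - 2)` precisely for `r ≥ 4`. It
  -- pays for the rise of the mean degree by `2 * b / (r - 2)`.
  have hlog : 1 / (r - 2) ≤ Real.log r - Real.log (r - 2) := by
    have h2 := Real.one_sub_inv_le_log_of_pos (show 0 < r / (r - 2) from
      div_pos (by linarith) (by linarith))
    rw [Real.log_div (by linarith) (by linarith), inv_div] at h2
    refine le_trans ?_ h2
    have h3 : 1 - (r - 2) / r = 2 / r := by field_simp; ring
    rw [h3, div_le_div_iff₀ (by linarith) (by linarith)]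
    linarith
  rw [h1, degPot, mul_add _ (S / r)]
  have h4 : (R.offDiag.card : ℝ) * (S / r) = (r - 1) * S := by
    rw [hQ]; field_simp
  rw [h4]
  have h5 : 2 * b / (r - 2) + 2 * b * (Real.log (r - 2) - Real.log (E / 2)) ≤
      2 * b * (Real.log r - Real.log (E / 2)) := by
    have := mul_le_mul_of_nonneg_left hlog (by positivity : (0 : ℝ) ≤ 2 * b)
    rw [mul_one_div] at this
    linarith
  have := mul_le_mul_of_nonneg_left h5 (Nat.cast_nonneg (α := ℝ) R.offDiag.card)
  linarith

/-- PhantomBreaker's answer is replaced by its worst effect `2 * b` on the degree sum. The degree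
term then depends on the pair only through the two removed degrees and can be averaged. -/
lemma startNum_pair_le {lab lab' : Fin n → Fin n}
    {P P' : Finset (Fin n)} {G G' : SimpleGraph (Fin n)} {t : ℕ} {v x : Fin n}
    (hv : v ∈ liveSet lab P) (hx : x ∈ liveSet lab P) (hvx : v ≠ x)
    (hGG : G ≤ G') (hGb : edgeCount G' ≤ edgeCount G + b)
    (hlive : liveSet lab' P' = ((liveSet lab P).erase v).erase x)
    (hr : 4 ≤ (liveSet lab P).card) :
    startNum n b E lab' P' G' (t + 1) ≤ 8 / E * excess lab' (t + 1) +
      pendCost n b E * (pendSet lab' P').card + matchRate n b E * ((liveSet lab P).card - 2) +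
      4 * E / n * degPot b E ((liveSet lab P).card - 2)
        (∑ u ∈ liveSet lab P, (deg G u : ℝ) - deg G v - deg G x + 2 * b) := by
  have hcard : ((liveSet lab' P').card : ℝ) = (liveSet lab P).card - 2 := by
    have h1 := Finset.card_erase_add_one hv
    have h2 := Finset.card_erase_add_one (Finset.mem_erase.2 ⟨hvx.symm, hx⟩)
    rw [← hlive] at h2
    rw [← h1, ← h2]; push_cast; ring
  have hsum : ((∑ u ∈ liveSet lab' P', deg G' u : ℕ) : ℝ) ≤
      ∑ u ∈ liveSet lab P, (deg G u : ℝ) - deg G v - deg G x + 2 * b := by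
    have h1 := Finset.add_sum_erase (liveSet lab P) (deg G) hv
    have h2 := Finset.add_sum_erase _ (deg G) (Finset.mem_erase.2 ⟨hvx.symm, hx⟩)
    rw [← hlive] at h2
    have h3 := sum_deg_le_sum_deg_add hGG hGb (liveSet lab' P')
    have h4 : ∑ u ∈ liveSet lab P, (deg G u : ℝ) = ((∑ u ∈ liveSet lab P, deg G u : ℕ) : ℝ) := by
      push_cast; rfl
    rw [h4, ← h1, ← h2]
    have h5 : ((∑ u ∈ liveSet lab' P', deg G' u : ℕ) : ℝ) ≤
      ((∑ u ∈ liveSet lab' P', deg G u + 2 * b : ℕ) : ℝ) := by exact_mod_cast h3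
    push_cast at h5 ⊢
    linarith
  have hr' : (4 : ℝ) ≤ (liveSet lab P).card := by exact_mod_cast hr
  rw [startNum, hcard]
  refine add_le_add le_rfl (mul_le_mul_of_nonneg_left ?_ (by positivity))
  rw [degPot, degPot]
  exact add_le_add (div_le_div_of_nonneg_right hsum (by linarith)) le_rfl

/-- Matched or pending, both drawn vertices leave the live set. So the degree term is averaged over
all ordered pairs, without bias from the blocked ones, by `sum_degPot_offDiag_le`. A failure costs
`8 / E` for the clock and two pending vertices; at most `2 * n` of at least `E * (E - 1)` pairs are
blocked, and the fall of the `matchRate` term by two live vertices pays for this. -/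
lemma PairParams.le_nextSum_pair (hp : PairParams n b E η) {lab : Fin n → Fin n}
    (hl : ∀ v, lab (lab v) = lab v) (P : Finset (Fin n))
    (G : SimpleGraph (Fin n)) {t : ℕ} (G' : Fin n × Fin n → SimpleGraph (Fin n))
    (hG : edgeCount G ≤ 2 * t) (hG' : ∀ p, G ≤ G' p ∧ edgeCount (G' p) ≤ edgeCount G + b)
    (ht : n ≤ t + (roots lab).card) (hpend : ¬ (pendSet lab P).Nonempty)
    (hσ : E ≤ (smallRoots lab 2).card) (hU : startNum n b E lab P G t < 1) :
    ((pairPlan n E).moves lab P).card * (1 - 3 * η - startNum n b E lab P G t) ≤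
      nextSum n b E η lab P G t G' := by
  have hE16 := hp.hE
  have hE := hp.E_pos
  have hn : (0 : ℝ) < n := by linarith [hp.E_le']
  have hpe : smallRoots lab 2 ∩ P = ∅ := Finset.not_nonempty_iff_eq_empty.1 hpend
  have hp0 : (pendSet lab P).card = 0 := by rw [pendSet, hpe, Finset.card_empty]
  have hlive : liveSet lab P = smallRoots lab 2 := by
    rw [liveSet, Finset.sdiff_eq_self_iff_disjoint, Finset.disjoint_iff_inter_eq_empty]
    exact hpe
  set R := smallRoots lab 2 with hR
  have hmoves : (pairPlan n E).moves lab P = R.offDiag := by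
    simp only [pairPlan]
    rw [dif_neg hpend, if_pos (Finset.card_pos.1 (by rw [← hR]; omega)), levelMoves, if_pos hσ]
  have honFail : ∀ e, (pairPlan n E).onFail lab P e = e.toFinset := fun e => by
    simp only [pairPlan]
    rw [if_pos ⟨hpend, hσ⟩]
  obtain ⟨-, hedge, -⟩ := hp.bounds_of_startNum_lt hl P G hG ht (by rw [hp0, ← hR]; omega) hU
  have hmerge : ∀ p ∈ R.offDiag, ∃ c₁ c₂, IsMerge lab (mergeAlong lab s(p.1, p.2)) c₁ c₂ ∧
      smallRoots (mergeAlong lab s(p.1, p.2)) 2 = (R.erase p.1).erase p.2 := by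
    intro p hp'
    rw [Finset.mem_offDiag] at hp'
    have h1 := (mem_smallRoots.1 hp'.1).1
    have h2 := (mem_smallRoots.1 hp'.2.1).1
    obtain ⟨c₁, c₂, hM, hcc⟩ := exists_isMerge hl
      (show lab p.1 ≠ lab p.2 by rw [h1, h2]; exact hp'.2.2)
    refine ⟨c₁, c₂, hM, ?_⟩
    rw [h1, h2] at hcc
    have h3 := Finset.Subset.antisymm hM.smallRoots_two_subset (hM.erase_erase_subset 2)
    rw [h3]
    rcases hcc with ⟨rfl, rfl⟩ | ⟨rfl, rfl⟩
    · rw [Finset.erase_right_comm]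
    · rfl
  have hfailPend : ∀ p ∈ R.offDiag, pendSet lab (s(p.1, p.2)).toFinset = {p.1, p.2} := by
    intro p hp'
    rw [Finset.mem_offDiag] at hp'
    rw [pendSet, Sym2.toFinset_mk_eq]
    refine Finset.inter_eq_right.2 fun u hu' => ?_
    rw [Finset.mem_insert, Finset.mem_singleton] at hu'
    rcases hu' with rfl | rfl
    exacts [hp'.1, hp'.2.1]
  have hfailLive : ∀ p : Fin n × Fin n, liveSet lab (s(p.1, p.2)).toFinset =
      (R.erase p.1).erase p.2 := by
    intro p
    ext u
    rw [liveSet, Sym2.toFinset_mk_eq, Finset.mem_sdiff, Finset.mem_insert, Finset.mem_singleton,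
      Finset.mem_erase, Finset.mem_erase]
    tauto
  have hsuccPend : ∀ p ∈ R.offDiag, pendSet (mergeAlong lab s(p.1, p.2)) P = ∅ := by
    intro p hp'
    obtain ⟨c₁, c₂, hM, -⟩ := hmerge p hp'
    exact Finset.not_nonempty_iff_eq_empty.1 (hM.pendSet_empty hpend)
  have hsuccLive : ∀ p ∈ R.offDiag, liveSet (mergeAlong lab s(p.1, p.2)) P =
      (R.erase p.1).erase p.2 := by
    intro p hp'
    obtain ⟨c₁, c₂, hM, heq⟩ := hmerge p hp'
    have := hsuccPend p hp'
    rw [pendSet] at this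
    rw [liveSet, ← heq, Finset.sdiff_eq_self_iff_disjoint, Finset.disjoint_iff_inter_eq_empty]
    exact this
  have hcardErase : ∀ p ∈ R.offDiag, ((R.erase p.1).erase p.2).card + 2 = R.card := by
    intro p hp'
    rw [Finset.mem_offDiag] at hp'
    have h1 := Finset.card_erase_add_one hp'.1
    have h2 := Finset.card_erase_add_one (Finset.mem_erase.2 ⟨hp'.2.2.symm, hp'.2.1⟩)
    omega
  set μ := matchRate n b E with hμ
  set c := pendCost n b E with hc
  have hsum : ∑ p ∈ R.offDiag, (if G.Adj p.1 p.2
      then startNum n b E lab (s(p.1, p.2)).toFinset (G' p) (t + 1)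
      else startNum n b E (mergeAlong lab s(p.1, p.2)) P (G' p) (t + 1)) ≤
      R.offDiag.card * startNum n b E lab P G t := by
    let z : Fin n × Fin n → ℝ := fun p => 4 * E / n * degPot b E ((R.card : ℝ) - 2)
      (∑ u ∈ R, (deg G u : ℝ) - deg G p.1 - deg G p.2 + 2 * b)
    have hterm : ∀ p ∈ R.offDiag, (if G.Adj p.1 p.2
        then startNum n b E lab (s(p.1, p.2)).toFinset (G' p) (t + 1)
        else startNum n b E (mergeAlong lab s(p.1, p.2)) P (G' p) (t + 1)) ≤
        (8 / E * excess lab t + μ * R.card - 2 * μ) + z p +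
          (if G.Adj p.1 p.2 then 8 / E + 2 * c else 0) := by
      intro p hp'
      have hmem := Finset.mem_offDiag.1 hp'
      have h4 : 4 ≤ (liveSet lab P).card := by rw [hlive]; omega
      split_ifs with hadj
      · have h1 := startNum_pair_le (n := n) (b := b) (E := E) (lab' := lab) (P := P) (P' := (s(p.1, p.2)).toFinset) (t := t)
          (by rw [hlive]; exact hmem.1) (by rw [hlive]; exact hmem.2.1) hmem.2.2 (hG' p).1
          (hG' p).2 (by rw [hlive]; exact hfailLive p) h4
        rw [hfailPend p hp', Finset.card_pair hmem.2.2, hlive] at h1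
        have h2 : excess lab (t + 1) = excess lab t + 1 := by
          rw [excess, excess]; push_cast; ring
        rw [h2] at h1
        refine h1.trans (le_of_eq ?_)
        simp only [z]
        push_cast
        ring
      · have h1 := startNum_pair_le (n := n) (b := b) (E := E) (lab' := mergeAlong lab s(p.1, p.2)) (P := P) (P' := P)
          (t := t) (by rw [hlive]; exact hmem.1) (by rw [hlive]; exact hmem.2.1) hmem.2.2
          (hG' p).1 (hG' p).2 (by rw [hlive]; exact hsuccLive p hp') h4
        rw [hsuccPend p hp', hlive, Finset.card_empty] at h1
        have h2 : excess (mergeAlong lab s(p.1, p.2)) (t + 1) = excess lab t := by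
          obtain ⟨c₁, c₂, hM, heq⟩ := hmerge p hp'
          have h3 : (((R.erase p.1).erase p.2).card : ℝ) + 2 = R.card := by
            exact_mod_cast hcardErase p hp'
          rw [excess, excess, heq, ← hR, ← h3]; push_cast; ring
        rw [h2] at h1
        refine h1.trans (le_of_eq ?_)
        simp only [z]
        push_cast
        ring
    refine (Finset.sum_le_sum hterm).trans ?_
    rw [Finset.sum_add_distrib, Finset.sum_add_distrib, Finset.sum_const, nsmul_eq_mul,
      ← Finset.sum_filter, Finset.sum_const, nsmul_eq_mul]
    have hz : ∑ p ∈ R.offDiag, z p ≤ R.offDiag.card *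
        (4 * E / n * degPot b E R.card (∑ u ∈ R, (deg G u : ℝ))) := by
      rw [← Finset.mul_sum]
      have := mul_le_mul_of_nonneg_left (sum_degPot_offDiag_le (b := b) (E := E) R
        (fun u => (deg G u : ℝ)) (by omega)) (by positivity : (0 : ℝ) ≤ 4 * E / n)
      linarith
    have hF : ((R.offDiag.filter fun p => G.Adj p.1 p.2).card : ℝ) ≤ 2 * n := by
      exact_mod_cast (card_adj_offDiag_le G R).trans (Nat.mul_le_mul_left 2 hedge)
    have hQ : (E : ℝ) * (E - 1) ≤ R.offDiag.card := by
      rw [Finset.offDiag_card, Nat.cast_sub (Nat.le_mul_self _)]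
      push_cast
      have : (E : ℝ) ≤ R.card := by exact_mod_cast hσ
      nlinarith
    have hcost : ((R.offDiag.filter fun p => G.Adj p.1 p.2).card : ℝ) * (8 / E + 2 * c) ≤
        R.offDiag.card * (2 * μ) := by
      have hEE : (0 : ℝ) < E * (E - 1) := mul_pos (by linarith) (by linarith)
      have h1 : 0 ≤ 8 / (E : ℝ) + 2 * c := by
        have := hp.pendCost_nonneg
        positivity
      calc _ ≤ 2 * n * (8 / E + 2 * c) := mul_le_mul_of_nonneg_right hF h1
        _ = E * (E - 1) * (2 * μ) := by
          have hE1 : (E : ℝ) - 1 ≠ 0 := by linarith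
          rw [hμ, matchRate, ← hc]; field_simp
        _ ≤ _ := mul_le_mul_of_nonneg_right hQ (by
          have := hp.matchRate_nonneg
          linarith)
    have hstart : startNum n b E lab P G t = 8 / E * excess lab t + μ * R.card +
        4 * E / n * degPot b E R.card (∑ u ∈ R, (deg G u : ℝ)) := by
      rw [startNum, hp0, hlive]; push_cast; ring
    rw [hstart]
    linarith
  have h0 := card_mul_const_sub_le R.offDiag (fun p : Fin n × Fin n => G.Adj p.1 p.2) _ _
    (c := 1 - 3 * η) hsum
  rw [nextSum, hmoves]
  refine h0.trans (Finset.sum_le_sum fun p hp' => ?_)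
  split_ifs with hadj
  · rw [honFail]
    have h1 : (pendSet lab (s(p.1, p.2)).toFinset).card = 2 := by
      rw [hfailPend p hp', Finset.card_pair (Finset.mem_offDiag.1 hp').2.2]
    exact hp.le_pairVal_start hl _ _ (by omega) h1.le (by rw [h1, ← hR]; omega)
  · obtain ⟨c₁, c₂, hM, heq⟩ := hmerge p hp'
    have h1 : (pendSet (mergeAlong lab s(p.1, p.2)) P).card = 0 := by
      rw [hsuccPend p hp', Finset.card_empty]
    have h2 := hM.card_smallRoots_ge 2
    rw [← hR] at h2
    exact hp.le_pairVal_start (mergeAlong_idem _ hl _) _ _ (succ_attempts hM ht) (by omega)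
      (by omega)

end RandomPairs

/-! ### Assembling the almost sure win -/

section AlmostSureWin
variable {n b E : ℕ} {η : ℝ}

theorem PairParams.pairPlan_drift (hp : PairParams n b E η) {a : ℕ} (ha : 0 < a)
    (hab : b ≤ 2 * a) : Drift a b (pairPlan n E) (pairVal n b E η) := by
  intro lab P G t hl hu hedge G' hG'
  -- The condition on the bias enters here: on average at most two edges of PhantomBreaker per
  -- attempt.
  have hG : edgeCount G ≤ 2 * t := by
    have h1 : a * edgeCount G ≤ a * (2 * t) :=
      hedge.trans ((Nat.mul_le_mul_right t hab).trans_eq (by ring))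
    exact Nat.le_of_mul_le_mul_left h1 ha
  have hG'' : ∀ p, G ≤ G' p ∧ edgeCount (G' p) ≤ edgeCount G + b := fun p =>
    ⟨(hG' p).1, (hG' p).2.1⟩
  change ((pairPlan n E).moves lab P).card * pairVal n b E η lab P G t ≤
    nextSum n b E η lab P G t G'
  have h0 : 0 ≤ nextSum n b E η lab P G t G' := Finset.sum_nonneg fun p _ => by
    split_ifs <;> exact pairVal_nonneg _ _ _ _
  have hmax : ∀ x : ℝ, (0 < x → ((pairPlan n E).moves lab P).card * x ≤
      nextSum n b E η lab P G t G') → ((pairPlan n E).moves lab P).card * max 0 x ≤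
      nextSum n b E η lab P G t G' := by
    intro x hx
    rcases le_or_gt x 0 with h | h
    · rw [max_eq_left h, mul_zero]; exact h0
    · rw [max_eq_right h.le]; exact hx h
  rw [pairVal]
  by_cases ht : n ≤ t + (roots lab).card
  swap
  · rw [if_neg ht, mul_zero]; exact h0
  rw [if_pos ht]
  by_cases hs : (pendSet lab P).Nonempty ∨ E ≤ (smallRoots lab 2).card
  · rw [if_pos hs]
    by_cases hi : (pendSet lab P).card ≤ 2 ∧
        E + 2 * (pendSet lab P).card ≤ (smallRoots lab 2).card + 4
    · rw [if_pos hi]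
      refine hmax _ fun hpos => ?_
      have hU : startNum n b E lab P G t < 1 := by linarith [hp.hη]
      by_cases hpend : (pendSet lab P).Nonempty
      · exact hp.le_nextSum_pend hl P G G' hG hG'' ht hpend hi.1 hi.2 hU
      · exact hp.le_nextSum_pair hl P G G' hG hG'' ht hpend (hs.resolve_left hpend) hU
    · rw [if_neg hi, mul_zero]; exact h0
  · rw [if_neg hs]
    push Not at hs
    have hpend : ¬ (pendSet lab P).Nonempty := Finset.not_nonempty_iff_eq_empty.2 hs.1
    by_cases h2 : (smallRoots lab 2).Nonempty
    · rw [if_pos h2]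
      by_cases hdeg : ∀ v ∈ smallRoots lab 2, (deg G v : ℝ) ≤ n / 4 + b * (t + E - n / 2)
      · rw [if_pos hdeg]
        exact hmax _ fun hpos => hp.le_nextSum_two hl hu P G G' hG'' ht hpend hs.2 h2 hdeg hpos
      · rw [if_neg hdeg, mul_zero]; exact h0
    · rw [if_neg h2]
      by_cases h4 : (smallRoots lab 4).Nonempty
      · rw [if_pos h4]
        exact hmax _ fun hpos => hp.le_nextSum_four hl hu P G G' hG ht h2 h4 hpos
      · rw [if_neg h4]
        exact hmax _ fun hpos => hp.le_nextSum_all hl hu P G G' hG ht h2 h4 hpos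

/-- Time `2 * n` exceeds even the last centre `n` plus the allowance, and in the matching stage the
excess alone makes the risk at least 1. -/
lemma PairParams.pairVal_nonpos (hp : PairParams n b E η) {lab : Fin n → Fin n}
    (hl : ∀ v, lab (lab v) = lab v) (P : Finset (Fin n)) (G : SimpleGraph (Fin n)) {t : ℕ}
    (ht : 2 * n ≤ t) : pairVal n b E η lab P G t ≤ 0 := by
  have hE := hp.E_pos
  have hEn := hp.E_le'
  have hη := hp.hη
  have htR : 2 * (n : ℝ) ≤ t := by exact_mod_cast ht
  have hlev : ∀ {off θ c : ℝ} {m : ℕ}, 0 ≤ off → 0 ≤ θ → c ≤ n →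
      levelVal n b E off θ c m t ≤ 0 := by
    intro off θ c m hoff hθ hc
    by_contra h
    have := hp.attempts_lt' hoff hθ (not_le.1 h)
    linarith
  rw [pairVal]
  split_ifs with h1 h2 h3 h4 h5 h6
  · refine max_le le_rfl ?_
    obtain ⟨-, -, h5, -⟩ := hp.startNum_parts hl P G h1 h3.2
    have h6 : 1 ≤ 8 / E * excess lab t := by
      rw [div_mul_eq_mul_div, one_le_div (by linarith), excess]
      have : (0 : ℝ) ≤ (smallRoots lab 2).card := Nat.cast_nonneg _
      linarith
    linarith
  · exact le_rfl
  · exact max_le le_rfl (hlev (by linarith) (by norm_num) (by linarith))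
  · exact le_rfl
  · exact max_le le_rfl (hlev (by linarith) (by norm_num) (by linarith))
  · exact max_le le_rfl (hlev le_rfl zero_le_one le_rfl)
  · exact le_rfl

lemma smallRoots_id : smallRoots (id : Fin n → Fin n) 2 = Finset.univ := by
  ext c
  have : comp (id : Fin n → Fin n) c = {c} := by ext u; simp [mem_comp]
  simp [mem_smallRoots, compSize, this]

/-- The value allots `3 * η` to the later levels, and `start` bounds the initial risk by one more
`η`. -/
lemma PairParams.le_pairVal_id (hp : PairParams n b E η) :
    1 - 4 * η ≤ pairVal n b E η id ∅ ⊥ 0 := by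
  have hE := hp.E_pos
  have hn : (0 : ℝ) < n := by linarith [hp.E_le']
  have hpend : (pendSet (id : Fin n → Fin n) ∅).card = 0 := by simp [pendSet]
  have hlive : liveSet (id : Fin n → Fin n) ∅ = Finset.univ := by
    rw [liveSet, smallRoots_id, Finset.sdiff_empty]
  have hσ : (smallRoots (id : Fin n → Fin n) 2).card = n := by rw [smallRoots_id]; simp
  have hEn : E ≤ n := by
    have : (E : ℝ) ≤ n := by linarith [hp.E_le']
    exact_mod_cast this
  refine le_trans ?_ (hp.le_pairVal_start (lab := id) (fun _ => rfl) ∅ ⊥ (by rw [card_roots_id]; omega)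
    (by omega) (by rw [hpend, hσ]; omega))
  have h1 : startNum n b E id ∅ ⊥ 0 = matchRate n b E * n +
      8 * b * E / n * Real.log (2 * n / E) := by
    have hlog : Real.log n - Real.log (E / 2) = Real.log (2 * n / E) := by
      rw [← Real.log_div hn.ne' (by positivity)]
      congr 1; field_simp
    have hdeg : ∑ v : Fin n, deg (⊥ : SimpleGraph (Fin n)) v = 0 :=
      Finset.sum_eq_zero fun v _ => deg_bot v
    rw [startNum, degPot, excess, hpend, hlive, hσ, hdeg, Finset.card_univ, Fintype.card_fin, hlog]
    push_cast; ring
  have h2 := hp.start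
  rw [h1, matchRate, pendCost]
  linarith

set_option maxHeartbeats 400000 in
/-- Constants for the pairing strategy with arbitrarily small losses exist. -/
lemma eventually_exists_pairParams (hb : 1 ≤ b) (hη : 0 < η) (hη1 : η ≤ 1) :
    ∀ᶠ n : ℕ in atTop, ∃ E, PairParams n b E η := by
  have hbR : (1 : ℝ) ≤ b := by exact_mod_cast hb
  -- The aim is `E` about `ε * n` with `ε = θ ^ 2`: then `log (4 / ε) = 2 * log (2 / θ) ≤ 4 / θ`, so
  -- the degree risk `8 * b * ε * log (4 / ε)` is at most `32 * b * θ = η / 2`.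
  obtain ⟨θ, hθ0, hbθ⟩ : ∃ θ : ℝ, 0 < θ ∧ b * θ = η / 64 :=
    ⟨η / (64 * b), by positivity, by field_simp⟩
  have hθ1 : θ ≤ 1 / 64 := by nlinarith
  obtain ⟨ε, hε⟩ : ∃ ε : ℝ, ε = θ ^ 2 := ⟨_, rfl⟩
  have hε0 : 0 < ε := by rw [hε]; positivity
  have hbε : b * ε ≤ η / 4096 := by
    have : b * ε = b * θ * θ := by rw [hε]; ring
    rw [this, hbθ]; nlinarith
  have hlog : 8 * b * ε * Real.log (4 / ε) ≤ η / 2 := by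
    have h1 : (4 : ℝ) / ε = (2 / θ) ^ 2 := by rw [hε, div_pow]; norm_num
    have h2 : Real.log (2 / θ) ≤ 2 / θ := (Real.log_le_sub_one_of_pos (by positivity)).trans
      (by linarith)
    rw [h1, Real.log_pow]
    calc 8 * b * ε * ((2 : ℕ) * Real.log (2 / θ)) ≤ 8 * b * ε * ((2 : ℕ) * (2 / θ)) := by gcongr
      _ = 32 * (b * θ) := by rw [hε]; push_cast; field_simp; norm_num
      _ = η / 2 := by rw [hbθ]; ring
  have hlarge : ∀ C : ℝ, ∀ᶠ n : ℕ in atTop, C ≤ n := fun C =>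
    tendsto_natCast_atTop_atTop.eventually_ge_atTop C
  set M : ℝ := 16 / ε + 8 * (160 + 64 * b) / ε ^ 2 with hM
  have hM0 : 0 < M := by positivity
  -- With `ε` fixed, `E` has order `n`, so the costs of failed random draws become negligible for
  -- large `n`; the terms linear in `E` are controlled by the choice of `ε`.
  filter_upwards [hlarge (34 / ε), hlarge (80 / ε ^ 2), hlarge (80 / ε ^ 2 * (32 * b / η)),
    hlarge (M * (8 / ε ^ 2) * (2 / η))] with n hn1 hn2 hn3 hn4
  have hn : (0 : ℝ) < n := lt_of_lt_of_le (by positivity) hn1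
  rw [div_le_iff₀ hε0] at hn1
  refine ⟨⌊ε * n⌋₊, ?_⟩
  set E := ⌊ε * n⌋₊ with hEdef
  have hE1 : (E : ℝ) ≤ ε * n := Nat.floor_le (by positivity)
  have hE2 : ε * n / 2 ≤ E := by
    have := Nat.lt_floor_add_one (ε * n)
    linarith
  have hE16 : (16 : ℝ) ≤ E := by linarith
  have hbE : b * (E : ℝ) ≤ η * n / 4096 := by
    calc b * (E : ℝ) ≤ b * (ε * n) := mul_le_mul_of_nonneg_left hE1 (by positivity)
      _ = b * ε * n := by ring
      _ ≤ η / 4096 * n := mul_le_mul_of_nonneg_right hbε hn.le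
      _ = _ := by ring
  have hηn : η * n ≤ n := mul_le_of_le_one_left hn.le hη1
  have hEE : ε ^ 2 * n ^ 2 / 8 ≤ E * (E - 1 : ℝ) := by
    have h1 : (E : ℝ) / 2 ≤ E - 1 := by linarith
    have h2 : ε * n / 2 * (ε * n / 4) ≤ E * (E - 1 : ℝ) :=
      mul_le_mul hE2 (by linarith) (by positivity) (by linarith)
    linarith
  have hEE0 : (0 : ℝ) < E * (E - 1) := lt_of_lt_of_le (by positivity) hEE
  have hinv : (n : ℝ) * n / (E * (E - 1)) ≤ 8 / ε ^ 2 := by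
    rw [div_le_div_iff₀ hEE0 (by positivity)]
    linarith
  refine ⟨hb, by exact_mod_cast hE16, ?_, hη.le, ?_, ?_, ?_⟩
  · have h1 : 16 * (b * (E : ℝ)) ≤ n := by linarith
    exact_mod_cast h1
  · have h1 : 10 * (n : ℝ) ≤ E * (E - 1) := by
      rw [div_le_iff₀ (by positivity)] at hn2
      have := mul_le_mul_of_nonneg_right hn2 hn.le
      linarith
    have h2 : 1 ≤ E := by
      have : (1 : ℝ) ≤ E := by linarith
      exact_mod_cast this
    have h3 : ((E - 1 : ℕ) : ℝ) = (E : ℝ) - 1 := by rw [Nat.cast_sub h2]; simp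
    rw [← h3] at h1
    exact_mod_cast h1
  · have h1 : 10 * n / (E * (E - 1) : ℝ) * n ≤ 80 / ε ^ 2 := by
      have : 10 * n / (E * (E - 1) : ℝ) * n = 10 * (n * n / (E * (E - 1))) := by ring
      rw [this]
      calc _ ≤ 10 * (8 / ε ^ 2) := by gcongr
        _ = _ := by ring
    have h2 : 80 / ε ^ 2 ≤ η * n / (32 * b) := by
      rw [← mul_div_assoc, div_le_iff₀ hη] at hn3
      rw [le_div_iff₀ (by positivity)]
      linarith
    have h3 : 17 * (E : ℝ) ≤ η * n / (32 * b) := by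
      rw [le_div_iff₀ (by positivity)]
      have : 17 * (E : ℝ) * (32 * b) = 544 * (b * E) := by ring
      have : 0 ≤ η * n := by positivity
      linarith
    have h4 : η * (n / (16 * b)) = η * n / (32 * b) + η * n / (32 * b) := by field_simp; norm_num
    rw [h4]
    exact add_le_add (h1.trans h2) h3
  · have hdiv : (n : ℝ) / E ≤ 2 / ε := by
      rw [div_le_div_iff₀ (by linarith) hε0]; linarith
    have h1 : n * (8 / E + 2 * ((160 + 64 * b) * n / E ^ 2) : ℝ) ≤ M := by
      have e1 : n * (8 / E + 2 * ((160 + 64 * b) * n / E ^ 2) : ℝ) =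
          8 * (n / E) + 2 * (160 + 64 * b) * (n / E) ^ 2 := by ring
      rw [e1, hM]
      calc _ ≤ 8 * (2 / ε) + 2 * (160 + 64 * b) * (2 / ε) ^ 2 := by gcongr
        _ = _ := by rw [div_pow]; ring
    have h2 : (n * (8 / E + 2 * ((160 + 64 * b) * n / E ^ 2)) / (E * (E - 1)) : ℝ) * n ≤ η / 2 := by
      have e2 : (n : ℝ) / (E * (E - 1)) ≤ 8 / ε ^ 2 / n := by
        rw [le_div_iff₀ hn]
        exact (le_of_eq (by ring)).trans hinv
      calc _ = n * (8 / E + 2 * ((160 + 64 * b) * n / E ^ 2)) * (n / (E * (E - 1)) : ℝ) := by ring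
        _ ≤ M * (8 / ε ^ 2 / n) := mul_le_mul h1 e2 (by positivity) hM0.le
        _ = M * (8 / ε ^ 2) / n := by ring
        _ ≤ η / 2 := by
          rw [← mul_div_assoc, div_le_iff₀ hη] at hn4
          rw [div_le_iff₀ hn]; linarith
    have h3 : 8 * b * E / n * Real.log (2 * n / E) ≤ η / 2 := by
      refine le_trans ?_ hlog
      have e3 : 8 * b * E / (n : ℝ) ≤ 8 * b * ε := by
        rw [div_le_iff₀ hn]
        have := mul_le_mul_of_nonneg_left hE1 (by positivity : (0 : ℝ) ≤ 8 * b)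
        linarith
      have e4 : 2 * n / (E : ℝ) ≤ 4 / ε := by
        rw [mul_div_assoc]
        calc 2 * (n / (E : ℝ)) ≤ 2 * (2 / ε) := by gcongr
          _ = _ := by ring
      have e5 : Real.log (2 * n / E) ≤ Real.log (4 / ε) :=
        Real.log_le_log (div_pos (by linarith) (by linarith)) e4
      have e6 : 0 ≤ Real.log (4 / ε) := by
        apply Real.log_nonneg
        rw [le_div_iff₀ hε0]
        nlinarith
      exact (mul_le_mul_of_nonneg_left e5 (by positivity)).trans (mul_le_mul_of_nonneg_right e3 e6)
    linarith

/-- A family of statements that hold eventually for every fixed error holds with errors tending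
to zero. -/
lemma exists_tendsto_zero_of_forall_eventually {p : ℕ → ℝ → Prop}
    (h : ∀ η : ℝ, 0 < η → ∀ᶠ n in atTop, p n η) :
    ∃ δ : ℕ → ℝ, Tendsto δ atTop (𝓝 0) ∧ ∀ᶠ n in atTop, p n (δ n) := by
  -- The largest `k ≤ n` for which the error `1 / (k + 1)` is valid at `n`. Each fixed error is
  -- eventually valid, so `k` tends to infinity.
  let k : ℕ → ℕ := fun n => Nat.findGreatest (fun k => p n (1 / ((k : ℝ) + 1))) n
  refine ⟨fun n => 1 / ((k n : ℝ) + 1), ?_, ?_⟩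
  · refine tendsto_one_div_add_atTop_nhds_zero_nat.comp (tendsto_atTop.2 fun m => ?_)
    filter_upwards [h (1 / ((m : ℝ) + 1)) (by positivity), eventually_ge_atTop m] with n hn hm
    exact Nat.le_findGreatest hm hn
  · filter_upwards [h (1 / ((0 : ℕ) + 1)) (by norm_num)] with n hn
    exact Nat.findGreatest_spec (P := fun k => p n (1 / ((k : ℝ) + 1))) (Nat.zero_le n) hn

/-- If PhantomBreaker's bias is at most twice Maker's, then Maker wins asymptotically almost
surely. -/
theorem exists_tendsto_winProb (a b : ℕ) (ha : 0 < a) (hb : 0 < b) (hab : b ≤ 2 * a) :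
    ∃ δ : ℕ → ℝ, Tendsto δ atTop (𝓝 0) ∧ ∀ᶠ n : ℕ in atTop, ∃ μ : PMF (MakerStrategy n),
      ∀ ν : PMF (BreakerStrategy n b), 1 - δ n ≤ winProb a (spanningTrees n) μ ν := by
  refine exists_tendsto_zero_of_forall_eventually (p := fun n η => ∃ μ : PMF (MakerStrategy n),
    ∀ ν : PMF (BreakerStrategy n b), 1 - η ≤ winProb a (spanningTrees n) μ ν) fun η hη => ?_
  -- The strategy loses four times its parameter, hence `η / 4`; the cap 1 is required for choosing
  -- the constants.
  filter_upwards [eventually_exists_pairParams (η := min (η / 4) 1) hb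
    (lt_min (by linarith) one_pos) (min_le_right _ _)] with n ⟨E, hp⟩
  have hn := hp.n_ge
  obtain ⟨μ, hμ⟩ := exists_mixed (n := n) (b := b) (by omega) ha (pairPlan n E)
    (pairVal n b E (min (η / 4) 1)) (2 * n) (pairPlan_moves (by linarith [hp.hE]))
    (fun lab P G t _ hu => pairVal_le_one_of_finished hp hu P G t)
    (fun lab P G t ht hl _ => hp.pairVal_nonpos hl P G ht) (hp.pairPlan_drift ha hab)
  refine ⟨μ, fun ν => le_trans ?_ (hμ ν)⟩
  have h1 := hp.le_pairVal_id
  have h2 : min (η / 4) 1 ≤ η / 4 := min_le_left _ _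
  linarith

end AlmostSureWin

end MakerPhantomBreaker

theorem theorem1p5 (a b : ℕ) (ha : 0 < a) (hb : 0 < b) :
    (2 * a < b →
      ∃ c : ℝ, 0 < c ∧ ∀ᶠ n : ℕ in atTop,
        ∃ μ : PMF (MakerPhantomBreaker.MakerStrategy n),
          ∀ ν : PMF (MakerPhantomBreaker.BreakerStrategy n b),
            c ≤ MakerPhantomBreaker.winProb a (MakerPhantomBreaker.spanningTrees n) μ ν) ∧
    (b ≤ 2 * a →
      ∃ δ : ℕ → ℝ, Tendsto δ atTop (𝓝 0) ∧ ∀ᶠ n : ℕ in atTop,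
        ∃ μ : PMF (MakerPhantomBreaker.MakerStrategy n),
          ∀ ν : PMF (MakerPhantomBreaker.BreakerStrategy n b),
            1 - δ n ≤ MakerPhantomBreaker.winProb a (MakerPhantomBreaker.spanningTrees n) μ ν) := by
  exact ⟨fun _ => MakerPhantomBreaker.exists_pos_winProb a b ha hb,
    MakerPhantomBreaker.exists_tendsto_winProb a b ha hb⟩
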